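/- Let $k$ be an algebraically closed field of characteristic zero. Let $K_0(\mathrm{Var}/k)$ be the Grothendieck ring of varieties: the abelian group generated by the isomorphism classes $[X]$ of schemes $X$ of finite type over $k$, modulo the relations $[X]=[U]+[Z]$ for every closed subscheme $Z\subset X$ with open complement $U$, with the product induced by $X\times_k Y$; let $\mathbb L=[\mathbb A^1_k]$. By a point of a curve we mean a closed point. For all integers $n\ge 2$ and $1\le d\le n+1$ there exist a smooth connected curve $C$ over $k$, a point $0\in C$, and a flat proper morphism $\pi\colon\mathcal X\to C$ with $\mathcal X$ smooth over $k$, such that 1. for every point $t\ne 0$ of $C$ the fiber $\pi^{-1}(t)$ is a smooth projective hypersurface of dimension $n$ and degree $d$, that is, it is smooth of dimension $n$ over $k$ and isomorphic over $k$ to $V(F)\subset\mathbb P^{n+1}_k$ for some nonzero form $F$ of degree $d$; 2. the fiber $\pi^{-1}(0)$ is a reduced simple normal crossing divisor in $\mathcal X$ (at each of its points it is cut out in the local ring of $\mathcal X$ by $x_1\cdots x_r$, for a regular system of parameters $x_1,\dots,x_m$ and some $1\le r\le m$), and $$[\pi^{-1}(0)]\equiv 1 \pmod{\mathbb L}\quad\text{in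 } K_0(\mathrm{Var}/k).$$ -/

import Mathlib

open CategoryTheory CategoryTheory.Limits AlgebraicGeometry

universe u

noncomputable section

attribute [local instance] CategoryTheory.Over.cartesianMonoidalCategory
attribute [local instance] CategoryTheory.Over.braidedCategory

/-! ### The Grothendieck ring of varieties -/

/-- The `k`-schemes of finite type, among all schemes over `Spec k`. -/
def finiteTypeOver (k : Type u) [Field k] : ObjectProperty (Over (Spec (.of k))) :=
  fun X => LocallyOfFiniteType X.hom ∧ QuasiCompact X.hom

instance finiteTypeOver_isMonoidal (k : Type u) [Field k] : (finiteTypeOver k).IsMonoidal where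
  prop_unit := by
    constructor <;> (dsimp; infer_instance)
  prop_tensor X Y hX hY := by
    obtain ⟨_, _⟩ := hX
    obtain ⟨_, _⟩ := hY
    constructor <;> (rw [Over.tensorObj_hom]; infer_instance)

/-- The category of schemes of finite type over `k`, with its fibre product over `k`. -/
abbrev FiniteTypeScheme (k : Type u) [Field k] : Type (u + 1) :=
  (finiteTypeOver k).FullSubcategory

/-- The commutative ring `ℤ[M]`, where `M` is the commutative monoid of isomorphism classes of
schemes of finite type over `k`, multiplied by the fibre product over `k`: the free abelian group
on the isomorphism classes, with the product that is induced by the product of schemes. -/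
abbrev FreeVarietyRing (k : Type u) [Field k] : Type (u + 1) :=
  MonoidAlgebra ℤ (Skeleton (FiniteTypeScheme k))

/-- The generator that belongs to the isomorphism class of `X`. -/
def freeClass {k : Type u} [Field k] (X : FiniteTypeScheme k) : FreeVarietyRing k :=
  MonoidAlgebra.of ℤ _ (toSkeleton X)

/-- The scissor relators `[X] - ([U] + [Z])`, for a closed subscheme `Z` of `X` with open
complement `U`. -/
def scissorRelators (k : Type u) [Field k] : Set (FreeVarietyRing k) :=
  {r | ∃ (X U Z : FiniteTypeScheme k) (j : U ⟶ X) (i : Z ⟶ X),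
    IsOpenImmersion j.hom.left ∧ IsClosedImmersion i.hom.left ∧
    Set.range j.hom.left = (Set.range i.hom.left)ᶜ ∧
    r = freeClass X - (freeClass U + freeClass Z)}

/-- The Grothendieck ring of varieties `K₀(Var/k)`. The scissor relators are stable under
multiplication by classes of schemes, so that the ideal which they generate is the subgroup which
they generate. -/
abbrev K0Var (k : Type u) [Field k] : Type (u + 1) :=
  FreeVarietyRing k ⧸ Ideal.span (scissorRelators k)

/-- The class `[Z]` in `K₀(Var/k)` of a scheme `f : Z ⟶ Spec k` of finite type. -/
def K0Var.classOf {k : Type u} [Field k] {Z : Scheme.{u}} (f : Z ⟶ Spec (.of k))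
    [LocallyOfFiniteType f] [QuasiCompact f] : K0Var k :=
  Ideal.Quotient.mk _ (freeClass ⟨Over.mk f, ‹LocallyOfFiniteType f›, ‹QuasiCompact f›⟩)

/-- The class `𝕃` of the affine line. -/
def K0Var.lefschetz (k : Type u) [Field k] : K0Var k :=
  K0Var.classOf (𝔸(PUnit.{u + 1}; Spec (.of k)) ↘ Spec (.of k))

/-! ### Hypersurfaces in projective space -/

attribute [local instance] MvPolynomial.gradedAlgebra

/-- Projective space of dimension `N` over `k`, as `Proj k[x₀, …, x_N]`. -/
abbrev projSpace (k : Type u) [Field k] (N : ℕ) : Scheme.{u} :=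
  Proj (MvPolynomial.homogeneousSubmodule (Fin (N + 1)) k)

/-- The structure morphism of projective space. -/
def projSpaceHom (k : Type u) [Field k] (N : ℕ) : projSpace k N ⟶ Spec (.of k) :=
  Proj.toSpecZero (MvPolynomial.homogeneousSubmodule (Fin (N + 1)) k) ≫
    Spec.map (CommRingCat.ofHom
      (algebraMap k (MvPolynomial.homogeneousSubmodule (Fin (N + 1)) k 0)))

/-- The section `F / x_i ^ d` of the structure sheaf of projective space on the standard chart
`D₊(x_i)`, where `F` is a form of degree `d`. -/
def dehomogenize {k : Type u} [Field k] {N d : ℕ}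
    (F : MvPolynomial.homogeneousSubmodule (Fin (N + 1)) k d) (i : Fin (N + 1)) :
    Γ(projSpace k N, Proj.basicOpen (MvPolynomial.homogeneousSubmodule (Fin (N + 1)) k)
      (MvPolynomial.X i)) :=
  Proj.awayToSection (MvPolynomial.homogeneousSubmodule (Fin (N + 1)) k) (MvPolynomial.X i)
    (HomogeneousLocalization.Away.mk (MvPolynomial.homogeneousSubmodule (Fin (N + 1)) k)
      (MvPolynomial.isHomogeneous_X k i) d F.1 (by simp [F.2]))

/-- `ι : Z ⟶ ℙ^N` is the closed subscheme `V(F)`: a closed immersion whose ideal on each standard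
chart `D₊(x_i)` is generated by `F / x_i ^ d`. -/
def IsZeroScheme {k : Type u} [Field k] {N d : ℕ}
    (F : MvPolynomial.homogeneousSubmodule (Fin (N + 1)) k d) {Z : Scheme.{u}}
    (ι : Z ⟶ projSpace k N) : Prop :=
  IsClosedImmersion ι ∧ ∀ i : Fin (N + 1),
    RingHom.ker (ι.app (Proj.basicOpen (MvPolynomial.homogeneousSubmodule (Fin (N + 1)) k)
      (MvPolynomial.X i))).hom = Ideal.span {dehomogenize F i}

/-- The `k`-scheme `f : Z ⟶ Spec k` is a smooth projective hypersurface of dimension `n` and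
degree `d`: it is smooth of dimension `n` over `k`, and isomorphic over `k` to `V(F) ⊆ ℙ^(n+1)`
for a nonzero form `F` of degree `d`. -/
def IsSmoothHypersurface {k : Type u} [Field k] (n d : ℕ) {Z : Scheme.{u}}
    (f : Z ⟶ Spec (.of k)) : Prop :=
  SmoothOfRelativeDimension n f ∧
  ∃ (F : MvPolynomial.homogeneousSubmodule (Fin (n + 1 + 1)) k d) (ι : Z ⟶ projSpace k (n + 1)),
    F ≠ 0 ∧ IsZeroScheme F ι ∧ ι ≫ projSpaceHom k (n + 1) = f

/-! ### Simple normal crossing divisors -/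

/-- `ι : D ⟶ X` is a reduced simple (= strict) normal crossing divisor: a closed immersion such
that at each point `p` of `D` the local ring of `X` is regular and has a regular system of
parameters `x₁, …, x_m`, for which the ideal of `D` at `p` is generated by `x₁ ⋯ x_r` for some
`1 ≤ r ≤ m`. (These are Zariski local rings, so that the components of `D` are regular.) -/
def IsSNCDivisor {D X : Scheme.{u}} (ι : D ⟶ X) : Prop :=
  IsClosedImmersion ι ∧ ∀ p : D,
    IsRegularLocalRing (X.presheaf.stalk (ι p)) ∧
    ∃ (m r : ℕ) (x : Fin m → X.presheaf.stalk (ι p)),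
      ringKrullDim (X.presheaf.stalk (ι p)) = m ∧
      Ideal.span (Set.range x) = IsLocalRing.maximalIdeal (X.presheaf.stalk (ι p)) ∧
      1 ≤ r ∧ r ≤ m ∧
      RingHom.ker (ι.stalkMap p).hom =
        Ideal.span {∏ i ∈ Finset.univ.filter (fun i : Fin m => i.1 < r), x i}

/-! ### Curves, and families over them -/

/-- `C` is a smooth connected curve over `k`: connected, separated and of finite type over `k`, and
smooth of dimension `1` over `k`. -/
structure IsSmoothConnectedCurve {k : Type u} [Field k] {C : Scheme.{u}}
    (s : C ⟶ Spec (.of k)) : Prop where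
  smooth : SmoothOfRelativeDimension 1 s
  separated : IsSeparated s
  quasiCompact : QuasiCompact s
  connected : ConnectedSpace C

/-- The `k`-rational points of a `k`-scheme. For a scheme of finite type over an algebraically
closed field `k`, these are its closed points (`AlgebraicGeometry.pointEquivClosedPoint`). -/
abbrev RationalPoint {k : Type u} [Field k] {C : Scheme.{u}} (s : C ⟶ Spec (.of k)) : Type u :=
  {t : Spec (.of k) ⟶ C // t ≫ s = 𝟙 _}

/-- The scheme-theoretic fibre `π⁻¹(t)` over a rational point `t`. -/
abbrev fibre {k : Type u} [Field k] {C X : Scheme.{u}} {s : C ⟶ Spec (.of k)} (π : X ⟶ C)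
    (t : RationalPoint s) : Scheme.{u} :=
  pullback π t.1

/-- The inclusion of the fibre into the total space. -/
abbrev fibreι {k : Type u} [Field k] {C X : Scheme.{u}} {s : C ⟶ Spec (.of k)} (π : X ⟶ C)
    (t : RationalPoint s) : fibre π t ⟶ X :=
  pullback.fst π t.1

/-- The fibre over a rational point, as a `k`-scheme. -/
abbrev fibreHom {k : Type u} [Field k] {C X : Scheme.{u}} {s : C ⟶ Spec (.of k)} (π : X ⟶ C)
    (t : RationalPoint s) : fibre π t ⟶ Spec (.of k) :=
  pullback.snd π t.1

end

-- Put d = e + 1, so that e ≤ n, and let F = ∑ xᵢ^d in the homogeneous coordinates x₀, …, x_{n+1}.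
-- The family is P = t F with P = x₀ ⋯ x_e, over the t-line without the zeros of 1 - (d t)^d. For t
-- ≠ 0 the member is smooth: at a singular point the derivatives x_s ∂_s give P = d t x_s^d for s <
-- d and 0 = d t x_s^d for the other s. Not all coordinates vanish, so P ≠ 0, and multiplying over s
-- < d gives (d t)^d = 1 (`fibreForm_jacobian`).
--
-- The hypersurface P = t F is singular where t = F = 0 and two of x₀, …, x_e vanish. It is resolved
-- by blowing up the ideals (t, x₀ ⋯ xᵢ) for i < e. All of them are blown up at once: the ideal (t,
-- x₀ ⋯ xᵢ) is represented in degree i + 1 by the forms x₀ ⋯ xᵢ and t x_c^(i+1), and the products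
-- `monom` of an x_b with one such form for each i define a projective model inside a field K
-- (`exists_projectiveModel`). Properness and flatness are then formal: the model is a Proj, and it
-- is torsion-free over a Dedekind domain.
--
-- Relations between the monomials show that the charts `vertex e a j` with j ≤ e suffice
-- (`exists_vertex_mem`). There x_a = 1, the product x₀ ⋯ xᵢ divides t for i < j, and t divides it
-- for j ≤ i < e. With u = x₀ ⋯ x_j / t and v = t / (x₀ ⋯ x_{j-1}) the chart is given by x_a = 1,
-- x_j = u v, u ∏_{j<i<d} xᵢ = F, and an inverse w of the discriminant. By `chartRel_jacobian` the
-- differentials of these equations are independent, even together with those of vanishing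
-- coordinates other than x_j. This gives smoothness and, since t = v ∏_{i<j} xᵢ, the normal
-- crossings. The same independence makes the coordinates other than x_j nonzerodivisors, whence the
-- four equations are all relations in K (`ker_eq_span_chartRel`).
--
-- For the class of the zero fibre, remove from each chart (a, j) the charts (b, l) with b < a, or b
-- = a and l > j. What remains is given by x_b = 0 for b < a and, if j < e, by u = 0; it lies in an
-- affine line with coordinate v over the affine space x_b = 0 (b < a), x_a = 1. Modulo the class of
-- the line, the pieces with fixed a add up to the class of P = 0 in that affine space
-- (`sum_algClass_strata`). For a < n + 1 the coordinate x_{n+1} is free, because e ≤ n, and the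
-- class is 0. For a = n + 1 there is one point, and the class is 1.

attribute [local instance] CategoryTheory.Over.cartesianMonoidalCategory
attribute [local instance] CategoryTheory.Over.braidedCategory
attribute [local instance] MvPolynomial.gradedAlgebra
/-! ### Regular systems of parameters -/

section RegularLocalRing

open IsLocalRing

/-- A regular system of parameters of a local ring: a family that generates the maximal ideal, with
as many members as the dimension. -/
structure IsRegularSystem {R : Type*} [CommRing R] [IsLocalRing R] {α : Type*} (x : α → R) :
    Prop where
  span_eq : Ideal.span (Set.range x) = maximalIdeal R
  dim_eq : ringKrullDim R = Nat.card α

/-- Elements of the maximal ideal whose classes in the cotangent space are independent. -/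
structure IsCotangentIndependent {R : Type*} [CommRing R] [IsLocalRing R] {α : Type*} [Fintype α]
    (x : α → R) : Prop where
  mem : ∀ i, x i ∈ maximalIdeal R
  indep : ∀ c : α → R, ∑ i, c i * x i ∈ maximalIdeal R ^ 2 → ∀ i, c i ∈ maximalIdeal R

variable {R : Type*} [CommRing R] [IsLocalRing R]

lemma IsRegularSystem.isRegularLocalRing [IsNoetherianRing R] {α : Type*} [Finite α] {x : α → R}
    (h : IsRegularSystem x) : IsRegularLocalRing R := by
  apply IsRegularLocalRing.of_spanFinrank_maximalIdeal_le
  rw [h.dim_eq, ← h.span_eq]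
  norm_cast
  refine (Submodule.spanFinrank_span_le_ncard_of_finite (Set.finite_range x)).trans ?_
  rw [← Set.image_univ]
  exact (Set.ncard_image_le Set.finite_univ).trans (by rw [Set.ncard_univ])

lemma IsRegularSystem.comp_equiv {α β : Type*} {x : α → R} (h : IsRegularSystem x) (e : β ≃ α) :
    IsRegularSystem (x ∘ e) where
  span_eq := by rw [e.surjective.range_comp, h.span_eq]
  dim_eq := by rw [h.dim_eq, Nat.card_congr e]

lemma IsRegularSystem.map_ringEquiv {S : Type*} [CommRing S] [IsLocalRing S] {α : Type*}
    {x : α → R} (h : IsRegularSystem x) (e : R ≃+* S) : IsRegularSystem (e ∘ x) where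
  span_eq := by
    rw [Set.range_comp, ← map_ringEquiv_maximalIdeal e, ← h.span_eq, Ideal.map_span]
  dim_eq := by rw [← ringKrullDim_eq_of_ringEquiv e, h.dim_eq]

/-- Dividing by a part of a regular system of parameters leaves a regular system. -/
lemma IsRegularSystem.of_surjective [IsNoetherianRing R] {S : Type*} [CommRing S] [IsLocalRing S]
    {α β : Type*} [Finite α] [Finite β] {f : α → R} {z : β → R}
    (h : IsRegularSystem (Sum.elim f z)) (φ : R →+* S) (hφ : Function.Surjective φ)
    (hker : RingHom.ker φ = Ideal.span (Set.range f)) : IsRegularSystem (φ ∘ z) := by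
  have hm : (maximalIdeal R).map φ = maximalIdeal S := by
    refine le_antisymm ?_ ?_
    · refine le_maximalIdeal fun htop => ?_
      have h1 : maximalIdeal R ⊔ RingHom.ker φ = ⊤ := by
        rw [← Ideal.comap_map_of_surjective' φ hφ, htop, Ideal.comap_top]
      rw [sup_eq_left.mpr (le_maximalIdeal (RingHom.ker_ne_top φ))] at h1
      exact Ideal.IsPrime.ne_top' h1
    · intro y hy
      obtain ⟨x, rfl⟩ := hφ y
      refine Ideal.mem_map_of_mem φ ?_
      rw [mem_maximalIdeal] at hy ⊢
      exact fun hx => hy (hx.map φ)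
  have hspan : Ideal.span (Set.range (φ ∘ z)) = maximalIdeal S := by
    rw [← hm, ← h.span_eq, Set.Sum.elim_range, Ideal.map_span, Set.image_union, Ideal.span_union,
      ← Set.range_comp, ← Set.range_comp, eq_comm, sup_eq_right]
    rw [Ideal.span_le]
    rintro _ ⟨i, rfl⟩
    have : φ (f i) = 0 := by
      rw [← RingHom.mem_ker, hker]
      exact Ideal.subset_span ⟨i, rfl⟩
    simp [this]
  refine ⟨hspan, ?_⟩
  have : IsNoetherianRing S := isNoetherianRing_of_surjective R S φ hφ
  have h1 : ringKrullDim S ≤ Nat.card β := by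
    refine (ringKrullDim_le_spanFinrank_maximalIdeal S).trans ?_
    rw [← hspan]
    norm_cast
    refine (Submodule.spanFinrank_span_le_ncard_of_finite (Set.finite_range _)).trans ?_
    rw [← Set.image_univ]
    exact (Set.ncard_image_le Set.finite_univ).trans (by rw [Set.ncard_univ])
  -- Each generator of the kernel lowers the dimension by at most one. Together with `h1` this
  -- determines the dimension of `S`.
  have h2 : ringKrullDim R ≤ ringKrullDim S + Nat.card α := by
    have e := RingHom.quotientKerEquivOfSurjective hφ
    rw [← ringKrullDim_eq_of_ringEquiv e]
    have hle : RingHom.ker φ ≤ Ring.jacobson R := by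
      rw [IsLocalRing.ringJacobson_eq_maximalIdeal]
      exact le_maximalIdeal (RingHom.ker_ne_top φ)
    refine (ringKrullDim_le_ringKrullDim_quotient_add_spanFinrank _ hle).trans ?_
    gcongr
    rw [hker]
    refine (Submodule.spanFinrank_span_le_ncard_of_finite (Set.finite_range _)).trans ?_
    rw [← Set.image_univ]
    exact (Set.ncard_image_le Set.finite_univ).trans (by rw [Set.ncard_univ])
  rw [h.dim_eq, Nat.card_sum] at h2
  have hne : ringKrullDim S ≠ ⊥ := ringKrullDim_ne_bot
  obtain ⟨s, hs⟩ := WithBot.ne_bot_iff_exists.mp hne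
  rw [← hs] at h1 h2 ⊢
  have hs1 : s ≤ (Nat.card β : ℕ∞) := by exact_mod_cast h1
  have hs2 : ((Nat.card α + Nat.card β : ℕ) : ℕ∞) ≤ s + (Nat.card α : ℕ∞) := by exact_mod_cast h2
  lift s to ℕ using (ne_top_of_le_ne_top (ENat.natCast_ne_top _) hs1)
  norm_cast at hs1 hs2 ⊢
  omega

/-- Elements that are independent in the cotangent space of a regular local ring belong to a regular
system of parameters. -/
lemma IsCotangentIndependent.exists_isRegularSystem {R : Type*} [CommRing R]
    [IsRegularLocalRing R] {α : Type*} [Fintype α]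
    {f : α → R} (hf : IsCotangentIndependent f) :
    ∃ (N : ℕ) (z : Fin N → R), IsRegularSystem (Sum.elim f z) := by
  classical
  let v : α → CotangentSpace R := fun i => (maximalIdeal R).toCotangent ⟨f i, hf.mem i⟩
  have hv : LinearIndependent (ResidueField R) v := by
    rw [Fintype.linearIndependent_iff]
    intro c hc
    choose c' hc' using fun i => residue_surjective (c i)
    have hsum : (maximalIdeal R).toCotangent (∑ i, c' i • ⟨f i, hf.mem i⟩) = 0 := by
      rw [map_sum, ← hc]
      refine Finset.sum_congr rfl fun i _ => ?_
      rw [map_smul, ← hc' i]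
      rfl
    rw [Ideal.toCotangent_eq_zero] at hsum
    intro i
    rw [← hc' i, residue_eq_zero_iff]
    exact hf.indep c' (by simpa using hsum) i
  -- Complete the independent classes to a basis of the cotangent space; by Nakayama any lifts of a
  -- basis generate the maximal ideal.
  obtain ⟨κ, w, hw⟩ : ∃ (N : ℕ) (w : Fin N → CotangentSpace R),
      LinearIndependent (ResidueField R) (Sum.elim v w) ∧
      Submodule.span (ResidueField R) (Set.range (Sum.elim v w)) = ⊤ := by
    obtain ⟨C, hC⟩ := Submodule.exists_isCompl (Submodule.span (ResidueField R) (Set.range v))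
    let b := Module.finBasis (ResidueField R) C
    refine ⟨_, fun i => (b i : CotangentSpace R), ?_, ?_⟩
    · refine hv.sum_type (b.linearIndependent.map' C.subtype (by simp)) ?_
      have : Submodule.span (ResidueField R) (Set.range (fun i => (b i : CotangentSpace R))) = C := by
        have := congrArg (Submodule.map C.subtype) b.span_eq
        rw [Submodule.map_span, ← Set.range_comp, Submodule.map_top, Submodule.range_subtype] at this
        exact this
      change Disjoint _ (Submodule.span (ResidueField R) (Set.range fun i => (b i : CotangentSpace R)))
      rw [this]
      exact hC.disjoint
    · have : Submodule.span (ResidueField R) (Set.range (fun i => (b i : CotangentSpace R))) = C := by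
        have := congrArg (Submodule.map C.subtype) b.span_eq
        rw [Submodule.map_span, ← Set.range_comp, Submodule.map_top, Submodule.range_subtype] at this
        exact this
      rw [Set.Sum.elim_range, Submodule.span_union, this]
      exact hC.codisjoint.eq_top
  obtain ⟨hw1, hw2⟩ := hw
  choose z hz using fun i => (maximalIdeal R).toCotangent_surjective (w i)
  refine ⟨κ, fun i => z i, ?_, ?_⟩
  · have h1 : Set.range (Sum.elim v w) = (maximalIdeal R).toCotangent ''
        (Set.range (Sum.elim (fun i => ⟨f i, hf.mem i⟩) z)) := by
      rw [← Set.range_comp]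
      congr 1
      ext i
      cases i <;> simp [v, hz]
    rw [h1, CotangentSpace.span_image_eq_top_iff] at hw2
    have h2 := congrArg (Submodule.map (maximalIdeal R).subtype) hw2
    rw [Submodule.map_span, Submodule.map_top, Submodule.range_subtype, ← Set.range_comp] at h2
    refine Eq.trans ?_ h2
    congr 2
    ext i
    cases i <;> simp
  · let b := Module.Basis.mk hw1 hw2.ge
    rw [← (IsRegularLocalRing.iff_finrank_cotangentSpace R).mp inferInstance,
      Module.finrank_eq_nat_card_basis b]

lemma isCotangentIndependent_singleton {x : R} (hx : x ∈ maximalIdeal R)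
    (hx2 : x ∉ maximalIdeal R ^ 2) : IsCotangentIndependent (fun _ : Unit => x) where
  mem _ := hx
  indep c hc i := by
    by_contra h
    have hu : IsUnit (c i) := by simpa using h
    apply hx2
    rw [Fintype.sum_unique] at hc
    exact (Ideal.unit_mul_mem_iff_mem _ hu).mp hc

/-- The induction step for `IsRegularLocalRing.isDomain`: an element outside the square of the
maximal ideal is a regular parameter. -/
lemma exists_dim_quotient_eq {R : Type*} [CommRing R] [IsRegularLocalRing R] {x : R}
    (hx : x ∈ maximalIdeal R) (hx2 : x ∉ maximalIdeal R ^ 2) :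
    ∃ N : ℕ, ringKrullDim R = (N + 1 : ℕ) ∧ ringKrullDim (R ⧸ Ideal.span {x}) = N ∧
      IsRegularLocalRing (R ⧸ Ideal.span {x}) := by
  obtain ⟨N, z, hz⟩ := (isCotangentIndependent_singleton hx hx2).exists_isRegularSystem
  have : Nontrivial (R ⧸ Ideal.span {x}) := Ideal.Quotient.nontrivial_iff.mpr
    fun h => Ideal.IsPrime.ne_top' (top_le_iff.mp (h ▸ (Ideal.span_singleton_le_iff_mem _).mpr hx))
  have : IsLocalRing (R ⧸ Ideal.span {x}) :=
    IsLocalRing.of_surjective' (Ideal.Quotient.mk _) Ideal.Quotient.mk_surjective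
  have h := hz.of_surjective (Ideal.Quotient.mk (Ideal.span {x})) Ideal.Quotient.mk_surjective
    (by simp)
  refine ⟨N, ?_, ?_, h.isRegularLocalRing⟩
  · simpa [add_comm] using hz.dim_eq
  · simpa using h.dim_eq

/-- A regular local ring is a domain. -/
theorem IsRegularLocalRing.isDomain (R : Type*) [CommRing R] [IsRegularLocalRing R] :
    IsDomain R := by
  obtain ⟨N, hN⟩ : ∃ N : ℕ, ringKrullDim R = N :=
    ⟨_, (IsRegularLocalRing.spanFinrank_maximalIdeal (R := R)).symm⟩
  induction N generalizing R with
  | zero =>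
    have hbot : maximalIdeal R = ⊥ := by
      have h := IsRegularLocalRing.spanFinrank_maximalIdeal (R := R)
      rw [hN] at h
      norm_cast at h
      rwa [Submodule.spanFinrank_eq_zero_iff_eq_bot (IsNoetherian.noetherian _)] at h
    have := IsLocalRing.isField_iff_maximalIdeal_eq.mpr hbot
    exact this.isDomain
  | succ N ih =>
    have hfin := minimalPrimes.finite_of_isNoetherianRing R
    have hpos : ∀ p ∈ minimalPrimes R, ¬ maximalIdeal R ≤ p := by
      intro p hp hle
      have hpp : p.IsPrime := Ideal.IsMinimalPrime.isPrime hp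
      have hpm : p = maximalIdeal R := le_antisymm (le_maximalIdeal hpp.ne_top) hle
      have h0 : (maximalIdeal R).height = 0 := by
        rw [← hpm]
        exact Ideal.height_eq_zero_iff.mpr hp
      have h1 := IsLocalRing.maximalIdeal_height_eq_ringKrullDim (R := R)
      rw [h0, hN] at h1
      norm_cast at h1
    have hsq : ¬ maximalIdeal R ≤ maximalIdeal R ^ 2 := by
      intro hle
      have hb : maximalIdeal R = ⊥ := by
        apply Submodule.eq_bot_of_le_smul_of_le_jacobson_bot (maximalIdeal R) _
          (IsNoetherian.noetherian _)
        · rwa [smul_eq_mul, ← pow_two]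
        · rw [IsLocalRing.jacobson_eq_maximalIdeal _ bot_ne_top]
      have h := IsRegularLocalRing.spanFinrank_maximalIdeal (R := R)
      rw [hN, hb] at h
      norm_cast at h
      simp at h
    -- Prime avoidance, which tolerates the one ideal `maximalIdeal R ^ 2` that need not be prime.
    obtain ⟨x, hx, hx2, hxp⟩ : ∃ x ∈ maximalIdeal R, x ∉ maximalIdeal R ^ 2 ∧
        ∀ p ∈ minimalPrimes R, x ∉ p := by
      by_contra! hcon
      have h := (Ideal.subset_union_prime (s := insert (maximalIdeal R ^ 2) hfin.toFinset)
        (f := id) (maximalIdeal R ^ 2) (maximalIdeal R ^ 2) ?_ (I := maximalIdeal R)).mp ?_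
      · obtain ⟨q, hq, hle⟩ := h
        rw [Finset.mem_insert] at hq
        rcases hq with rfl | hq
        · exact hsq hle
        · exact hpos q (by simpa using hq) hle
      · intro q hq hne _
        rw [Finset.mem_insert, or_iff_right hne] at hq
        exact Ideal.IsMinimalPrime.isPrime (by simpa using hq : q ∈ minimalPrimes R)
      · intro x hx
        by_cases hx2 : x ∈ maximalIdeal R ^ 2
        · exact Set.mem_biUnion (x := maximalIdeal R ^ 2) (by simp) hx2
        · obtain ⟨p, hp, hxp⟩ := hcon x hx hx2
          exact Set.mem_biUnion (x := p) (by simp [hp]) hxp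
    obtain ⟨M, hM, hM', hreg⟩ := exists_dim_quotient_eq hx hx2
    have hNM : M = N := by
      rw [hN] at hM
      have : N + 1 = M + 1 := by exact_mod_cast hM
      omega
    subst hNM
    have hdom := ih (R ⧸ Ideal.span {x}) hM'
    have hprime : (Ideal.span {x}).IsPrime := (Ideal.Quotient.isDomain_iff_prime _).mp hdom
    obtain ⟨p, hp, hple⟩ := Ideal.exists_minimalPrimes_le (I := (⊥ : Ideal R))
      (J := Ideal.span {x}) bot_le
    have hpp : p.IsPrime := Ideal.IsMinimalPrime.isPrime hp
    -- Each element of `p` is a multiple of `x`, and `x ∉ p`, so its cofactor lies in `p` again.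
    -- Thus `p` is contained in `x p`, and Nakayama applies.
    have hpbot : p = ⊥ := by
      apply Submodule.eq_bot_of_le_smul_of_le_jacobson_bot (Ideal.span {x}) _
        (IsNoetherian.noetherian _)
      · intro y hy
        obtain ⟨z, rfl⟩ := Ideal.mem_span_singleton'.mp (hple hy)
        have hz : z ∈ p := (hpp.mem_or_mem hy).resolve_right (hxp p hp)
        rw [mul_comm, smul_eq_mul]
        exact Ideal.mul_mem_mul (Ideal.mem_span_singleton_self x) hz
      · rw [IsLocalRing.jacobson_eq_maximalIdeal _ bot_ne_top]
        exact (Ideal.span_singleton_le_iff_mem _).mpr hx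
    rw [hpbot] at hpp
    exact IsDomain.of_bot_isPrime R

/-- The members of a regular system of parameters are prime elements. -/
lemma IsRegularSystem.prime [IsNoetherianRing R] {α : Type*} [Finite α] {x : α → R}
    (h : IsRegularSystem x) (i : α) : (Ideal.span {x i}).IsPrime := by
  classical
  have h' := h.comp_equiv (Equiv.sumCompl (fun j => j = i))
  let f : {j // j = i} → R := fun j => x j
  let z : {j // ¬ j = i} → R := fun j => x j
  have he : x ∘ (Equiv.sumCompl (fun j => j = i)) = Sum.elim f z := by
    ext j
    cases j <;> rfl
  rw [he] at h'
  have hr : Set.range f = {x i} := by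
    ext y
    simp [f, eq_comm]
  have hxi : x i ∈ maximalIdeal R := h.span_eq ▸ Ideal.subset_span ⟨i, rfl⟩
  have : Nontrivial (R ⧸ Ideal.span {x i}) := Ideal.Quotient.nontrivial_iff.mpr
    fun h => Ideal.IsPrime.ne_top' (top_le_iff.mp (h ▸ (Ideal.span_singleton_le_iff_mem _).mpr hxi))
  have : IsLocalRing (R ⧸ Ideal.span {x i}) :=
    IsLocalRing.of_surjective' (Ideal.Quotient.mk _) Ideal.Quotient.mk_surjective
  have hq := h'.of_surjective (Ideal.Quotient.mk (Ideal.span {x i})) Ideal.Quotient.mk_surjective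
    (by rw [Ideal.mk_ker, hr])
  have := hq.isRegularLocalRing
  exact (Ideal.Quotient.isDomain_iff_prime _).mp (IsRegularLocalRing.isDomain _)

/-- The maximal ideal needs at least as many generators as the dimension, so no member of a regular
system is redundant. -/
lemma IsRegularSystem.span_image_compl_ne [IsNoetherianRing R] {α : Type*} [Finite α] {x : α → R}
    (h : IsRegularSystem x) (j : α) : Ideal.span (x '' {j}ᶜ) ≠ maximalIdeal R := by
  intro hspan
  have h1 := ringKrullDim_le_spanFinrank_maximalIdeal R
  rw [h.dim_eq, ← hspan] at h1
  norm_cast at h1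
  have h2 := (Submodule.spanFinrank_span_le_ncard_of_finite (R := R)
    (Set.toFinite (x '' {j}ᶜ))).trans (Set.ncard_image_le (Set.toFinite _))
  have h3 := h1.trans h2
  have h4 := Set.ncard_add_ncard_compl {j}
  rw [Set.ncard_singleton] at h4
  omega

lemma IsRegularSystem.notMem_span [IsNoetherianRing R] {α : Type*} [Finite α] {x : α → R}
    (h : IsRegularSystem x) {i j : α} (hij : i ≠ j) : x j ∉ Ideal.span {x i} := by
  classical
  intro hmem
  refine h.span_image_compl_ne j ?_
  rw [← h.span_eq]
  refine le_antisymm (Ideal.span_mono (Set.image_subset_range _ _)) ?_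
  rw [Ideal.span_le]
  rintro _ ⟨l, rfl⟩
  by_cases hl : l = j
  · subst hl
    exact Ideal.span_mono (by rintro _ rfl; exact ⟨i, hij, rfl⟩) hmem
  · exact Ideal.subset_span ⟨l, hl, rfl⟩

/-- A product of different members of a regular system of parameters generates a radical ideal. -/
lemma IsRegularSystem.prod_dvd [IsNoetherianRing R] {α : Type*} [Finite α] {x : α → R}
    (h : IsRegularSystem x) (s : Finset α) {y : R} {N : ℕ} (hy : ∏ i ∈ s, x i ∣ y ^ N) :
    ∏ i ∈ s, x i ∣ y := by
  classical
  have hdvd (i) (hi : i ∈ s) : x i ∣ y := by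
    have h1 : y ^ N ∈ Ideal.span {x i} :=
      Ideal.mem_span_singleton.mpr ((Finset.dvd_prod_of_mem x hi).trans hy)
    exact Ideal.mem_span_singleton.mp ((h.prime i).mem_of_pow_mem N h1)
  clear hy
  induction s using Finset.induction_on with
  | empty => simp
  | insert i s hi ih =>
    obtain ⟨w, rfl⟩ := ih fun j hj => hdvd j (Finset.mem_insert_of_mem hj)
    have h1 : (∏ i ∈ s, x i) * w ∈ Ideal.span {x i} :=
      Ideal.mem_span_singleton.mpr (hdvd i (Finset.mem_insert_self _ _))
    rw [Finset.prod_insert hi, mul_comm]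
    -- The prime `x i` divides the product of the earlier members times `w`, but none of these
    -- members, hence it divides `w`.
    refine mul_dvd_mul_left _ (Ideal.mem_span_singleton.mp
      (((h.prime i).mem_or_mem h1).resolve_left fun h2 => ?_))
    obtain ⟨j, hj, hji⟩ := (Ideal.IsPrime.prod_mem_iff (hp := h.prime i)).mp h2
    exact h.notMem_span (by rintro rfl; exact hi hj) hji

end RegularLocalRing
/-! ### The Jacobian criterion -/

section Jacobian

open IsLocalRing MvPolynomial

/-- Polynomials whose differentials are independent at a prime ideal `P` are independent in the
cotangent space of the local ring at `P`. -/
lemma isCotangentIndependent_of_jacobian {k : Type*} [Field k] {σ : Type*}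
    (P : Ideal (MvPolynomial σ k)) [P.IsPrime] {κ : Type*} [Field κ]
    (ev : MvPolynomial σ k →+* κ) (hev : RingHom.ker ev = P) {α : Type*} [Fintype α]
    (f : α → MvPolynomial σ k) (hf : ∀ i, f i ∈ P)
    (hJ : ∀ c : α → κ, (∀ s, ∑ i, c i * ev (pderiv s (f i)) = 0) → c = 0)
    (R : Type*) [CommRing R] [IsLocalRing R] [Algebra (MvPolynomial σ k) R]
    [IsLocalization.AtPrime R P] :
    IsCotangentIndependent (fun i => algebraMap (MvPolynomial σ k) R (f i)) := by
  have hmem (x : MvPolynomial σ k) : algebraMap _ R x ∈ maximalIdeal R ↔ x ∈ P :=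
    IsLocalization.AtPrime.to_map_mem_maximal_iff R P x
  refine ⟨fun i => (hmem _).mpr (hf i), fun c hc => ?_⟩
  -- Clearing denominators turns a relation modulo the square of the maximal ideal into `s * ∑ q i *
  -- f i ∈ P ^ 2` with polynomials `q i` and `s ∉ P`.
  obtain ⟨b, hb⟩ := IsLocalization.exist_integer_multiples_of_finite P.primeCompl c
  choose q hq using hb
  have hmap : maximalIdeal R ^ 2 = (P ^ 2).map (algebraMap _ R) := by
    rw [Ideal.map_pow, IsLocalization.AtPrime.map_eq_maximalIdeal P R]
  have h1 : algebraMap _ R (∑ i, q i * f i) ∈ (P ^ 2).map (algebraMap _ R) := by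
    rw [← hmap]
    have : algebraMap _ R (∑ i, q i * f i) =
        algebraMap _ R b.1 * ∑ i, c i * algebraMap _ R (f i) := by
      rw [map_sum, Finset.mul_sum]
      refine Finset.sum_congr rfl fun i _ => ?_
      rw [map_mul, hq, Algebra.smul_def, mul_assoc]
    rw [this]
    exact Ideal.mul_mem_left _ _ hc
  rw [IsLocalization.algebraMap_mem_map_algebraMap_iff P.primeCompl] at h1
  obtain ⟨s, hs, hsP⟩ := h1
  have hev0 (x) : ev x = 0 ↔ x ∈ P := by rw [← hev, RingHom.mem_ker]
  -- Derivations map `P ^ 2` into `P`. Since the `f i` vanish at `P`, differentiating the relation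
  -- leaves a linear relation between the differentials of the `f i`, with coefficients `ev (q i)`.
  have hder (i : σ) (x) (hx : x ∈ P ^ 2) : ev (pderiv i x) = 0 := by
    rw [pow_two] at hx
    refine Submodule.mul_induction_on hx (fun a ha b hb => ?_) fun a b ha hb => ?_
    · rw [Derivation.leibniz]
      simp [(hev0 a).mpr ha, (hev0 b).mpr hb]
    · simp [ha, hb]
  have hq0 : (fun i => ev (q i)) = 0 := by
    apply hJ
    intro i
    have h2 := hder i _ hsP
    rw [Derivation.leibniz, map_sum] at h2
    have h3 : ev (∑ i, q i * f i) = 0 := by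
      rw [map_sum]
      exact Finset.sum_eq_zero fun j _ => by rw [map_mul, (hev0 _).mpr (hf j), mul_zero]
    simp only [Derivation.leibniz, smul_eq_mul, map_add, map_mul, map_sum, (hev0 _).mpr (hf _),
      zero_mul, add_zero] at h2 h3
    simp only [mul_zero, Finset.sum_const_zero, zero_mul, add_zero] at h2
    exact (mul_eq_zero.mp h2).resolve_left fun h => hs ((hev0 _).mp h)
  intro i
  have hqi : q i ∈ P := (hev0 _).mp (congrFun hq0 i)
  have h4 := (hmem _).mpr hqi
  rw [hq, Algebra.smul_def] at h4
  refine ((maximalIdeal.isMaximal R).isPrime.mem_or_mem h4).resolve_left fun h => ?_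
  exact b.2 ((hmem _).mp h)

/-- If the differentials of the relations of an algebra are independent at each point, then the
algebra is smooth of the expected dimension. -/
theorem locally_isStandardSmooth_of_jacobian {k : Type u} [Field k] {σ τ : Type} [Fintype σ]
    [Fintype τ] {S : Type u} [CommRing S] [Algebra k S] (φ : MvPolynomial σ k →ₐ[k] S)
    (hφ : Function.Surjective φ) (f : τ → MvPolynomial σ k)
    (hker : RingHom.ker φ = Ideal.span (Set.range f)) {n : ℕ}
    (hn : Fintype.card σ = n + Fintype.card τ)
    (hJ : ∀ (κ : Type u) [Field κ] (ev : S →+* κ) (c : τ → κ),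
      (∀ s, ∑ i, c i * ev (φ (pderiv s (f i))) = 0) → c = 0) :
    RingHom.Locally (RingHom.IsStandardSmoothOfRelativeDimension n) (algebraMap k S) := by
  classical
  have hφ' : φ = aeval (fun s => φ (X s)) := by
    ext; simp
  let G : Algebra.Generators k S σ := Algebra.Generators.ofSurjective (fun s => φ (X s))
    (by rw [← hφ']; exact hφ)
  let P (a : {a : τ → σ // Function.Injective a}) : Algebra.PreSubmersivePresentation k S σ τ :=
    { G with
      relation := f
      span_range_relation_eq_ker := by
        rw [← hker, Algebra.Generators.ker_eq_ker_aeval_val]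
        change RingHom.ker φ = RingHom.ker (aeval (fun s => φ (X s)))
        rw [← hφ']
      map := a.1
      map_inj := a.2 }
  have hjac (a) : (P a).jacobian =
      Matrix.det (Matrix.of fun i j : τ => φ (pderiv (a.1 i) (f j))) := by
    rw [Algebra.PreSubmersivePresentation.jacobian_eq_jacobiMatrix_det, RingHom.map_det]
    congr 1
    ext i j
    rw [RingHom.mapMatrix_apply, Matrix.map_apply,
      Algebra.PreSubmersivePresentation.jacobiMatrix_apply]
    change aeval (fun s => φ (X s)) _ = _
    rw [← hφ']
    rfl
  -- The maximal minors of the Jacobian matrix generate the unit ideal, and inverting one of them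
  -- makes the presentation submersive.
  refine ⟨Set.range fun a => (P a).jacobian, ?_, ?_⟩
  · by_contra hne
    obtain ⟨M, hM, hle⟩ := Ideal.exists_le_maximal _ hne
    let κ := S ⧸ M
    let _ : Field κ := Ideal.Quotient.field M
    let ev : S →+* κ := Ideal.Quotient.mk M
    let v : σ → τ → κ := fun s i => ev (φ (pderiv s (f i)))
    -- A linear form that kills all the vectors of partial derivatives is a relation between the
    -- differentials. So these vectors span, and a basis chosen among them gives a minor that does
    -- not vanish.
    have hv : Submodule.span κ (Set.range v) = ⊤ := by
      by_contra hv
      obtain ⟨l, hl0, hl⟩ := Submodule.exists_le_ker_of_lt_top _ (lt_top_iff_ne_top.mpr hv)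
      apply hl0
      have hlc : (fun i => l (Pi.single i 1)) = 0 := by
        refine hJ κ ev _ fun s => ?_
        have h1 : l (v s) = 0 := hl (Submodule.subset_span ⟨s, rfl⟩)
        rw [← h1]
        conv_rhs => rw [pi_eq_sum_univ' (v s), map_sum]
        refine Finset.sum_congr rfl fun i _ => ?_
        rw [map_smul, smul_eq_mul, mul_comm]
      refine LinearMap.pi_ext' fun i => LinearMap.ext_ring ?_
      simpa using congrFun hlc i
    obtain ⟨κ', a, ha, hspan, hli⟩ := exists_linearIndependent' κ v
    have b := Module.Basis.mk hli (by rw [hspan, hv])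
    have e : τ ≃ κ' := (Pi.basisFun κ τ).indexEquiv b
    let a' : {a : τ → σ // Function.Injective a} := ⟨a ∘ e, ha.comp e.injective⟩
    have hli' : LinearIndependent κ (v ∘ a'.1) := by
      have := hli.comp e e.injective
      exact this
    have hdet : IsUnit (Matrix.det (Matrix.of fun i j : τ => v (a'.1 i) j)) := by
      rw [← Matrix.isUnit_iff_isUnit_det, ← Matrix.linearIndependent_rows_iff_isUnit]
      exact hli'
    have h0 : ev (P a').jacobian = 0 :=
      Ideal.Quotient.eq_zero_iff_mem.mpr (hle (Ideal.subset_span ⟨a', rfl⟩))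
    rw [hjac, RingHom.map_det] at h0
    exact hdet.ne_zero h0
  · rintro _ ⟨a, rfl⟩
    let T := Localization.Away (P a).jacobian
    have hT : (algebraMap S T).comp (algebraMap k S) = algebraMap k T :=
      (IsScalarTower.algebraMap_eq k S T).symm
    rw [hT, RingHom.isStandardSmoothOfRelativeDimension_algebraMap]
    -- Inverting the minor costs one variable and one relation, so the dimension of the presentation
    -- does not change.
    let Q := Algebra.PreSubmersivePresentation.localizationAway T (P a).jacobian
    let Q' : Algebra.SubmersivePresentation k T (Unit ⊕ σ) (Unit ⊕ τ) :=
      { Q.comp (P a) with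
        jacobian_isUnit := by
          change IsUnit (Q.comp (P a)).jacobian
          rw [Algebra.PreSubmersivePresentation.comp_jacobian_eq_jacobian_smul_jacobian,
            Algebra.PreSubmersivePresentation.localizationAway_jacobian, Algebra.smul_def]
          exact (IsLocalization.Away.algebraMap_isUnit _).mul
            (IsLocalization.Away.algebraMap_isUnit _) }
    refine Q'.isStandardSmoothOfRelativeDimension ?_
    simp only [Algebra.Presentation.dimension, Nat.card_eq_fintype_card, Fintype.card_sum]
    omega

end Jacobian

/-! ### Regular systems of parameters from the Jacobian criterion -/

section JacobianRegular

open IsLocalRing MvPolynomial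

lemma IsRegularSystem.ne_zero {R : Type*} [CommRing R] [IsLocalRing R] [IsNoetherianRing R]
    {α : Type*} [Finite α] {x : α → R} (h : IsRegularSystem x) (i : α) : x i ≠ 0 := by
  intro h0
  refine h.span_image_compl_ne i (le_antisymm ?_ ?_)
  · rw [← h.span_eq]
    exact Ideal.span_mono (Set.image_subset_range _ _)
  · rw [← h.span_eq, Ideal.span_le]
    rintro _ ⟨l, rfl⟩
    by_cases hl : l = i
    · rw [hl, h0]
      exact zero_mem _
    · exact Ideal.subset_span ⟨l, hl, rfl⟩

/-- If the differentials of the relations of an algebra and those of some functions that vanish at a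
prime ideal are independent there, then these functions belong to a regular system of parameters. -/
theorem exists_isRegularSystem_of_jacobian {k : Type*} [Field k] {σ τ β : Type*} [Finite σ]
    [Fintype τ] [Fintype β] {S : Type*} [CommRing S] (φ : MvPolynomial σ k →+* S)
    (hφ : Function.Surjective φ) (f : τ → MvPolynomial σ k)
    (hker : RingHom.ker φ = Ideal.span (Set.range f)) (q : Ideal S) [q.IsPrime]
    (y : β → MvPolynomial σ k) (hy : ∀ b, φ (y b) ∈ q) {κ : Type*} [Field κ] (ev : S →+* κ)
    (hev : RingHom.ker ev = q)
    (hJ : ∀ (c : τ → κ) (e : β → κ), (∀ s, ∑ i, c i * ev (φ (pderiv s (f i))) +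
      ∑ i, e i * ev (φ (pderiv s (y i))) = 0) → c = 0 ∧ e = 0)
    (R : Type*) [CommRing R] [IsLocalRing R] [Algebra S R] [IsLocalization.AtPrime R q] :
    IsNoetherianRing R ∧
    ∃ (N : ℕ) (z : Fin N → R), IsRegularSystem (Sum.elim (fun b => algebraMap S R (φ (y b))) z) := by
  let P := q.comap φ
  let T := Localization.AtPrime P
  have hT : IsRegularLocalRing T := IsRegularRing.isRegularLocalRing_localization P
  have hf0 (i) : φ (f i) = 0 := by
    rw [← RingHom.mem_ker, hker]
    exact Ideal.subset_span ⟨i, rfl⟩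
  -- The relations and the functions are treated together in the regular local ring of affine space;
  -- the relations are divided out afterwards.
  have hind : IsCotangentIndependent (fun i => algebraMap (MvPolynomial σ k) T (Sum.elim f y i)) := by
    refine isCotangentIndependent_of_jacobian P (ev.comp φ) ?_ (Sum.elim f y) ?_ ?_ T
    · rw [← RingHom.comap_ker, hev]
    · rintro (i | i)
      · change φ (f i) ∈ q
        rw [hf0]
        exact zero_mem _
      · exact hy i
    · intro c hc
      obtain ⟨h1, h2⟩ := hJ (c ∘ Sum.inl) (c ∘ Sum.inr) fun s => by
        simpa [Fintype.sum_sum_type] using hc s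
      ext (i | i)
      · exact congrFun h1 i
      · exact congrFun h2 i
  obtain ⟨N, z, hz⟩ := hind.exists_isRegularSystem
  have hM : Submonoid.map φ P.primeCompl = q.primeCompl := by
    ext s
    constructor
    · rintro ⟨p, hp, rfl⟩
      exact hp
    · intro hs
      obtain ⟨p, rfl⟩ := hφ s
      exact ⟨p, hs, rfl⟩
  let ψ : T →+* R := IsLocalization.map R φ (M := P.primeCompl) (T := q.primeCompl)
    (hM.symm ▸ P.primeCompl.le_comap_map)
  have hψ : Function.Surjective ψ := by
    intro r
    obtain ⟨s, m, rfl⟩ := IsLocalization.exists_mk'_eq q.primeCompl r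
    obtain ⟨p, rfl⟩ := hφ s
    obtain ⟨p', hp'⟩ := hφ m.1
    have : p' ∈ P.primeCompl := fun h => m.2 (by rw [← hp']; exact h)
    refine ⟨IsLocalization.mk' T p ⟨p', this⟩, ?_⟩
    rw [IsLocalization.map_mk']
    congr 1
    exact Subtype.ext hp'
  have hψa (p) : ψ (algebraMap _ T p) = algebraMap S R (φ p) := IsLocalization.map_eq _ _
  have hkerψ : RingHom.ker ψ = Ideal.span (Set.range fun i => algebraMap _ T (f i)) := by
    rw [IsLocalization.ker_map R φ hM, hker, Ideal.map_span, ← Set.range_comp]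
    rfl
  refine ⟨isNoetherianRing_of_surjective T R ψ hψ, N, fun i => ψ (z i), ?_⟩
  have h1 := hz.comp_equiv (Equiv.sumAssoc τ β (Fin N)).symm
  have h2 : Sum.elim (fun i => algebraMap (MvPolynomial σ k) T (Sum.elim f y i)) z ∘
      (Equiv.sumAssoc τ β (Fin N)).symm =
      Sum.elim (fun i => algebraMap _ T (f i)) (Sum.elim (fun i => algebraMap _ T (y i)) z) := by
    ext (i | i | i) <;> rfl
  rw [h2] at h1
  have h3 := h1.of_surjective ψ hψ hkerψ
  convert h3 using 1
  ext (i | i)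
  · exact (hψa _).symm
  · rfl

/-- An element is a nonzerodivisor if at each prime ideal that contains it, it belongs to a regular
system of parameters of the local ring. -/
lemma mem_nonZeroDivisors_of_isRegularSystem {S : Type*} [CommRing S] (y : S)
    (h : ∀ (q : Ideal S) [q.IsPrime], IsRegularLocalRing (Localization.AtPrime q) ∧
      (y ∈ q → algebraMap S (Localization.AtPrime q) y ≠ 0)) :
    y ∈ nonZeroDivisors S := by
  rw [mem_nonZeroDivisors_iff_right]
  intro s hs
  refine eq_zero_of_localization s fun q _ => ?_
  obtain ⟨h1, h2⟩ := h q
  have := IsRegularLocalRing.isDomain (Localization.AtPrime q)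
  have h3 : algebraMap S (Localization.AtPrime q) s * algebraMap S (Localization.AtPrime q) y = 0 := by
    rw [← map_mul, hs, map_zero]
  refine (mul_eq_zero.mp h3).resolve_right ?_
  by_cases hy : y ∈ q
  · exact h2 hy
  · exact (IsLocalization.map_units (M := q.primeCompl) (Localization.AtPrime q) ⟨y, hy⟩).ne_zero

end JacobianRegular
/-! ### Projective models inside a field -/

noncomputable section ProjectiveModel

open Polynomial HomogeneousLocalization

variable (A : Type u) {K : Type u} [CommRing A] [Field K] [Algebra A K] {ι : Type} (m : ι → K)

/-- The subalgebra of `K` generated by the ratios `m j / m i`. -/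
def ratioAlgebra (i : ι) : Subalgebra A K :=
  Algebra.adjoin A (Set.range fun j => m j / m i)

lemma div_mem_ratioAlgebra (i j : ι) : m j / m i ∈ ratioAlgebra A m i :=
  Algebra.subset_adjoin ⟨j, rfl⟩

/-- The ratio `m j / m i` as an element of `ratioAlgebra A m i`. -/
def ratio (i j : ι) : ratioAlgebra A m i := ⟨m j / m i, div_mem_ratioAlgebra A m i j⟩

/-- The blow-up algebra `⨁ Vⁿ` of the span `V` of the `m i`, inside `K[X]`. -/
def blowupAlgebra : Subalgebra A K[X] where
  carrier := {p | ∀ n, p.coeff n ∈ Submodule.span A (Set.range m) ^ n}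
  mul_mem' {p q} hp hq n := by
    rw [coeff_mul]
    refine Submodule.sum_mem _ fun x hx => ?_
    rw [← Finset.HasAntidiagonal.mem_antidiagonal.mp hx, pow_add]
    exact Submodule.mul_mem_mul (hp _) (hq _)
  add_mem' {p q} hp hq n := by
    rw [coeff_add]
    exact Submodule.add_mem _ (hp n) (hq n)
  algebraMap_mem' r n := by
    rw [Polynomial.algebraMap_apply, coeff_C]
    split_ifs with h
    · subst h
      rw [pow_zero]
      exact ⟨r, by simp [Algebra.algebraMap_eq_smul_one]⟩
    · exact Submodule.zero_mem _

lemma monomial_mem_blowupAlgebra {n : ℕ} {c : K} (hc : c ∈ Submodule.span A (Set.range m) ^ n) :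
    monomial n c ∈ blowupAlgebra A m := by
  intro j
  rw [coeff_monomial]
  split_ifs with h
  · exact h ▸ hc
  · exact Submodule.zero_mem _

/-- The homogeneous part of degree `n` of the blow-up algebra. -/
def blowupGrading (n : ℕ) : Submodule A (blowupAlgebra A m) where
  carrier := {p | ∀ j, j ≠ n → p.1.coeff j = 0}
  add_mem' {p q} hp hq j hj := by simp [hp j hj, hq j hj]
  zero_mem' := by simp
  smul_mem' r p hp j hj := by simp [hp j hj]

lemma eq_monomial_of_mem_blowupGrading {n : ℕ} {p : blowupAlgebra A m}
    (hp : p ∈ blowupGrading A m n) : p.1 = monomial n (p.1.coeff n) := by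
  ext j
  rw [coeff_monomial]
  split_ifs with h
  · rw [h]
  · exact hp j (Ne.symm h)

lemma monomial_mem_blowupGrading {n : ℕ} {c : K}
    (hc : c ∈ Submodule.span A (Set.range m) ^ n) :
    (⟨monomial n c, monomial_mem_blowupAlgebra A m hc⟩ : blowupAlgebra A m) ∈
      blowupGrading A m n := by
  intro j hj
  exact coeff_monomial_of_ne c (Ne.symm hj).symm

instance : SetLike.GradedMonoid (blowupGrading A m) where
  one_mem j hj := by
    simp [Polynomial.coeff_one, hj]
  mul_mem i j p q hp hq l hl := by
    change (p.1 * q.1).coeff l = 0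
    rw [eq_monomial_of_mem_blowupGrading A m hp, eq_monomial_of_mem_blowupGrading A m hq,
      monomial_mul_monomial, coeff_monomial, if_neg (Ne.symm hl)]

lemma blowupGrading_isInternal : DirectSum.IsInternal (blowupGrading A m) := by
  classical
  constructor
  · have hco (x : DirectSum ℕ fun i => blowupGrading A m i) (i : ℕ) :
        (DirectSum.coeAddMonoidHom (blowupGrading A m) x).1.coeff i = (x i).1.1.coeff i := by
      rw [DirectSum.coeAddMonoidHom_eq_dfinsuppSum]
      simp only [DFinsupp.sum, AddSubmonoidClass.coe_finsetSum, finsetSum_coeff]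
      refine Finset.sum_eq_single i (fun j _ hj => (x j).2 i (Ne.symm hj)) fun hi => ?_
      have : x i = 0 := by simpa using hi
      simp [this]
    intro x y hxy
    ext i : 1
    apply Subtype.ext
    apply Subtype.ext
    rw [eq_monomial_of_mem_blowupGrading A m (x i).2, eq_monomial_of_mem_blowupGrading A m (y i).2,
      ← hco, ← hco, hxy]
  · intro p
    refine ⟨∑ i ∈ p.1.support, DirectSum.of (fun i => blowupGrading A m i) i
      ⟨⟨monomial i (p.1.coeff i), monomial_mem_blowupAlgebra A m (p.2 i)⟩,
        monomial_mem_blowupGrading A m (p.2 i)⟩, ?_⟩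
    rw [map_sum]
    simp only [DirectSum.coeAddMonoidHom_of]
    apply Subtype.ext
    simpa using (p.1.as_sum_support).symm

instance : GradedAlgebra (blowupGrading A m) :=
  (blowupGrading_isInternal A m).gradedAlgebra

/-- The degree one generator of the blow-up algebra that belongs to `m i`. -/
def blowupGen (i : ι) : blowupAlgebra A m :=
  ⟨monomial 1 (m i), monomial_mem_blowupAlgebra A m
    (by rw [pow_one]; exact Submodule.subset_span ⟨i, rfl⟩)⟩

lemma blowupGen_mem (i : ι) : blowupGen A m i ∈ blowupGrading A m 1 :=
  monomial_mem_blowupGrading A m (by rw [pow_one]; exact Submodule.subset_span ⟨i, rfl⟩)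

lemma blowupAlgebra_le_adjoin :
    blowupAlgebra A m ≤ Algebra.adjoin A (Set.range fun i => monomial 1 (m i)) := by
  set T := Algebra.adjoin A (Set.range fun i => monomial 1 (m i)) with hT
  let N (n : ℕ) : Submodule A K :=
    (Subalgebra.toSubmodule T).comap ((monomial n : K →ₗ[K] K[X]).restrictScalars A)
  have hN (n : ℕ) (c : K) : c ∈ N n ↔ monomial n c ∈ T := Iff.rfl
  have key (n : ℕ) : Submodule.span A (Set.range m) ^ n ≤ N n := by
    induction n with
    | zero =>
      rw [pow_zero]
      intro c hc
      obtain ⟨r, rfl⟩ := Submodule.mem_one.mp hc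
      rw [hN]
      have := Subalgebra.algebraMap_mem T r
      rwa [Polynomial.algebraMap_apply] at this
    | succ n ih =>
      rw [pow_succ]
      have h1 : Submodule.span A (Set.range m) ≤ N 1 := by
        rw [Submodule.span_le]
        rintro _ ⟨i, rfl⟩
        exact Algebra.subset_adjoin ⟨i, rfl⟩
      refine (mul_le_mul' ih h1).trans (Submodule.mul_le.mpr fun a ha b hb => ?_)
      rw [hN] at ha hb ⊢
      rw [← monomial_mul_monomial]
      exact mul_mem ha hb
  intro p hp
  rw [p.as_sum_support]
  exact sum_mem fun i _ => key i (hp i)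

lemma adjoin_blowupGen : Algebra.adjoin A (Set.range (blowupGen A m)) = ⊤ := by
  apply Subalgebra.map_injective (f := (blowupAlgebra A m).val) Subtype.val_injective
  rw [AlgHom.map_adjoin, ← Set.range_comp, Algebra.map_top, Subalgebra.range_val]
  refine le_antisymm (Algebra.adjoin_le ?_) (blowupAlgebra_le_adjoin A m)
  rintro _ ⟨i, rfl⟩
  exact (blowupGen A m i).2

lemma algebraMap_zero_surjective :
    Function.Surjective (algebraMap A (blowupGrading A m 0)) := by
  rintro ⟨p, hp⟩
  have h := p.2 0
  rw [pow_zero] at h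
  obtain ⟨r, hr⟩ := Submodule.mem_one.mp h
  refine ⟨r, ?_⟩
  apply Subtype.ext
  apply Subtype.ext
  rw [eq_monomial_of_mem_blowupGrading A m hp, ← hr]
  rfl

lemma adjoin_zero_blowupGen :
    Algebra.adjoin (blowupGrading A m 0) (Set.range (blowupGen A m)) = ⊤ := by
  rw [eq_top_iff]
  intro y _
  have hy : y ∈ Algebra.adjoin A (Set.range (blowupGen A m)) := by
    rw [adjoin_blowupGen]; trivial
  induction hy using Algebra.adjoin_induction with
  | mem x hx => exact Algebra.subset_adjoin hx
  | algebraMap r =>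
    exact Subalgebra.algebraMap_mem (Algebra.adjoin (blowupGrading A m 0) _)
      (algebraMap A (blowupGrading A m 0) r)
  | add x y _ _ hx hy => exact add_mem (hx trivial) (hy trivial)
  | mul x y _ _ hx hy => exact mul_mem (hx trivial) (hy trivial)

lemma finiteType_blowupAlgebra [Finite ι] :
    Algebra.FiniteType (blowupGrading A m 0) (blowupAlgebra A m) :=
  ⟨⟨(Set.finite_range (blowupGen A m)).toFinset, by simpa using adjoin_zero_blowupGen A m⟩⟩

/-- Evaluation at `1` of the elements of the blow-up algebra. -/
def blowupEval : blowupAlgebra A m →+* K :=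
  (Polynomial.evalRingHom (1 : K)).comp (blowupAlgebra A m).val.toRingHom

lemma blowupEval_of_mem {n : ℕ} {p : blowupAlgebra A m} (hp : p ∈ blowupGrading A m n) :
    blowupEval A m p = p.1.coeff n := by
  change Polynomial.eval 1 p.1 = _
  conv_lhs => rw [eq_monomial_of_mem_blowupGrading A m hp]
  simp

@[simp]
lemma blowupEval_gen (i : ι) : blowupEval A m (blowupGen A m i) = m i := by
  rw [blowupEval_of_mem A m (blowupGen_mem A m i)]
  simp [blowupGen]

variable {m}

/-- The homogeneous localization of the blow-up algebra at `f` maps to `K`. -/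
def blowupAwayToField (f : blowupAlgebra A m) (hf : blowupEval A m f ≠ 0) :
    Away (blowupGrading A m) f →+* K :=
  (IsLocalization.Away.lift (S := Localization.Away f) f (g := blowupEval A m)
    (isUnit_iff_ne_zero.mpr hf)).comp (algebraMap (Away (blowupGrading A m) f) _)

lemma blowupAwayToField_mk (f : blowupAlgebra A m) (hf : blowupEval A m f ≠ 0) {d : ℕ}
    (hfd : f ∈ blowupGrading A m d) (n : ℕ) (x : blowupAlgebra A m)
    (hx : x ∈ blowupGrading A m (n • d)) :
    blowupAwayToField A f hf (Away.mk _ hfd n x hx) = blowupEval A m x / blowupEval A m f ^ n := by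
  simp only [blowupAwayToField, RingHom.comp_apply, HomogeneousLocalization.algebraMap_apply,
    Away.val_mk]
  rw [eq_div_iff (pow_ne_zero _ hf), Localization.mk_eq_mk', ← map_pow,
    ← IsLocalization.Away.lift_eq (S := Localization.Away f) f (isUnit_iff_ne_zero.mpr hf) (f ^ n),
    ← map_mul]
  erw [IsLocalization.mk'_spec]
  rw [IsLocalization.Away.lift_eq]

/-- A homogeneous element of known degree has a single coefficient, and this is its value at `1`. -/
lemma blowupAwayToField_injective (f : blowupAlgebra A m) (hf : blowupEval A m f ≠ 0) {d : ℕ}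
    (hfd : f ∈ blowupGrading A m d) : Function.Injective (blowupAwayToField A f hf) := by
  rw [injective_iff_map_eq_zero]
  intro x hx
  obtain ⟨n, a, ha, rfl⟩ := Away.mk_surjective _ hfd x
  rw [blowupAwayToField_mk, div_eq_zero_iff, or_iff_left (pow_ne_zero _ hf),
    blowupEval_of_mem A m ha] at hx
  have : a = 0 := by
    apply Subtype.ext
    rw [eq_monomial_of_mem_blowupGrading A m ha, hx]
    simp
  subst this
  apply HomogeneousLocalization.val_injective
  rw [Away.val_mk, Localization.mk_zero, HomogeneousLocalization.val_zero]

/-- This compatibility on the overlap of two charts shows that the charts have the same generic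
point in `K`. -/
lemma blowupAwayToField_awayMap (f g : blowupAlgebra A m) (hf : blowupEval A m f ≠ 0)
    (hg : blowupEval A m g ≠ 0) {d e : ℕ} (hfd : f ∈ blowupGrading A m d)
    (hge : g ∈ blowupGrading A m e) {x : blowupAlgebra A m} (hx : x = f * g)
    (hx0 : blowupEval A m x ≠ 0) :
    (blowupAwayToField A x hx0).comp (awayMap (blowupGrading A m) hge hx) =
      blowupAwayToField A f hf := by
  ext a
  obtain ⟨n, a, ha, rfl⟩ := Away.mk_surjective _ hfd a
  subst hx
  rw [RingHom.comp_apply, awayMap_mk, blowupAwayToField_mk, blowupAwayToField_mk, map_mul, map_mul,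
    map_pow, mul_pow, mul_div_mul_right _ _ (pow_ne_zero _ hg)]

/-- Division by `m i ^ n` carries the `n`-th power of the span of the `m j` into the algebra
generated by the ratios `m j / m i`. -/
lemma blowupAwayToField_mem (i : ι) (hi : blowupEval A m (blowupGen A m i) ≠ 0)
    (x : Away (blowupGrading A m) (blowupGen A m i)) :
    blowupAwayToField A (blowupGen A m i) hi x ∈ ratioAlgebra A m i := by
  obtain ⟨n, a, ha, rfl⟩ := Away.mk_surjective _ (blowupGen_mem A m i) x
  rw [blowupAwayToField_mk, blowupEval_of_mem A m ha, blowupEval_gen]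
  have key (n : ℕ) : Submodule.span A (Set.range m) ^ n ≤
      (Subalgebra.toSubmodule (ratioAlgebra A m i)).comap (LinearMap.mulRight A (m i ^ n)⁻¹) := by
    induction n with
    | zero =>
      rw [pow_zero]
      intro c hc
      obtain ⟨r, rfl⟩ := Submodule.mem_one.mp hc
      simp
    | succ n ih =>
      rw [pow_succ]
      refine Submodule.mul_le.mpr fun a ha b hb => ?_
      have h1 : Submodule.span A (Set.range m) ≤
        (Subalgebra.toSubmodule (ratioAlgebra A m i)).comap (LinearMap.mulRight A (m i)⁻¹) := by
        rw [Submodule.span_le]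
        rintro _ ⟨j, rfl⟩
        simpa [div_eq_mul_inv] using div_mem_ratioAlgebra A m i j
      have : (a * (m i ^ n)⁻¹) * (b * (m i)⁻¹) ∈ ratioAlgebra A m i := mul_mem (ih ha) (h1 hb)
      change a * b * (m i ^ (n + 1))⁻¹ ∈ ratioAlgebra A m i
      convert! this using 1
      simp only [pow_succ, mul_inv]
      ring
  have h := key _ (a.2 (n • 1))
  rw [Submodule.mem_comap, LinearMap.mulRight_apply] at h
  simpa [div_eq_mul_inv] using h

lemma exists_blowupAwayToField_eq (i : ι) (hi : blowupEval A m (blowupGen A m i) ≠ 0)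
    {y : K} (hy : y ∈ ratioAlgebra A m i) :
    ∃ x, blowupAwayToField A (blowupGen A m i) hi x = y := by
  induction hy using Algebra.adjoin_induction with
  | mem y hy =>
    obtain ⟨j, rfl⟩ := hy
    refine ⟨Away.mk _ (blowupGen_mem A m i) 1 (blowupGen A m j) (blowupGen_mem A m j), ?_⟩
    rw [blowupAwayToField_mk]
    simp
  | algebraMap r =>
    refine ⟨Away.mk _ (blowupGen_mem A m i) 0 (algebraMap A _ r) ?_, ?_⟩
    · rw [zero_smul]
      exact SetLike.algebraMap_mem_graded _ r
    · rw [blowupAwayToField_mk]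
      simp [blowupEval, Polynomial.algebraMap_apply]
  | add x y _ _ hx hy =>
    obtain ⟨a, rfl⟩ := hx
    obtain ⟨b, rfl⟩ := hy
    exact ⟨a + b, map_add _ _ _⟩
  | mul x y _ _ hx hy =>
    obtain ⟨a, rfl⟩ := hx
    obtain ⟨b, rfl⟩ := hy
    exact ⟨a * b, map_mul _ _ _⟩

/-- The chart `D₊(m i)` of the projective model is the spectrum of `ratioAlgebra A m i`. -/
def blowupAwayToRatioAlgebra (i : ι) (hi : blowupEval A m (blowupGen A m i) ≠ 0) :
    Away (blowupGrading A m) (blowupGen A m i) →+* ratioAlgebra A m i :=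
  (blowupAwayToField A (blowupGen A m i) hi).codRestrict
    (ratioAlgebra A m i) (blowupAwayToField_mem A i hi)

lemma blowupAwayToRatioAlgebra_bijective (i : ι)
    (hi : blowupEval A m (blowupGen A m i) ≠ 0) :
    Function.Bijective (blowupAwayToRatioAlgebra A i hi) :=
  ⟨fun _ _ h => blowupAwayToField_injective A _ hi (blowupGen_mem A m i)
      (congrArg Subtype.val h), fun y => by
        obtain ⟨x, hx⟩ := exists_blowupAwayToField_eq A i hi y.2
        exact ⟨x, Subtype.ext hx⟩⟩

/-- Finitely many nonzero elements `m i` of a field `K` over `A` define a proper model over `A`: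
it is covered by the spectra of the algebras `A[m j / m i : j]`, which are glued inside `K`. -/
theorem exists_projectiveModel [Finite ι] [Nonempty ι] (hm : ∀ i, m i ≠ 0) :
    ∃ (X : Scheme.{u}) (π : X ⟶ Spec (.of A)) (g : Spec (.of K) ⟶ X)
      (f : ∀ i, Spec (.of (ratioAlgebra A m i)) ⟶ X), IsProper π ∧ (∀ i, IsOpenImmersion (f i)) ∧
      (∀ i, f i ≫ π = Spec.map (CommRingCat.ofHom (algebraMap A (ratioAlgebra A m i)))) ∧
      (∀ i, Spec.map (CommRingCat.ofHom (algebraMap (ratioAlgebra A m i) K)) ≫ f i = g) ∧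
      (∀ x, ∃ i, x ∈ Set.range (f i)) ∧
      ∀ i j (q : PrimeSpectrum (ratioAlgebra A m i)),
        f i q ∈ Set.range (f j) ↔ ratio A m i j ∉ q.asIdeal := by
  have hm' (i : ι) : blowupEval A m (blowupGen A m i) ≠ 0 := by simpa using hm i
  have := finiteType_blowupAlgebra A m
  let c (i : ι) := Proj.awayι (blowupGrading A m) _ (blowupGen_mem A m i) Nat.one_pos
  let e (i : ι) : Spec (.of (ratioAlgebra A m i)) ⟶
      Spec (.of (Away (blowupGrading A m) (blowupGen A m i))) :=
    Spec.map (CommRingCat.ofHom (blowupAwayToRatioAlgebra A i (hm' i)))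
  have he (i : ι) : IsIso (e i) := by
    have : IsIso (CommRingCat.ofHom (blowupAwayToRatioAlgebra A i (hm' i))) :=
      (ConcreteCategory.isIso_iff_bijective _).mpr (blowupAwayToRatioAlgebra_bijective A i (hm' i))
    exact inferInstanceAs (IsIso (Spec.map _))
  let i₀ : ι := Classical.arbitrary ι
  let F (i : ι) : Spec (.of (ratioAlgebra A m i)) ⟶ Proj (blowupGrading A m) := e i ≫ c i
  have hF (i : ι) : IsOpenImmersion (F i) := inferInstance
  let ρ : CommRingCat.of A ⟶ CommRingCat.of (blowupGrading A m 0) :=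
    CommRingCat.ofHom (algebraMap A (blowupGrading A m 0))
  have hcl : IsClosedImmersion (Spec.map ρ) :=
    IsClosedImmersion.spec_of_surjective ρ (algebraMap_zero_surjective A m)
  have hrange (i : ι) : Set.range (F i) = (Proj.basicOpen (blowupGrading A m) (blowupGen A m i) :
      Set (Proj (blowupGrading A m))) := by
    rw [← Proj.opensRange_awayι _ _ (blowupGen_mem A m i) Nat.one_pos]
    have : (F i).opensRange = (c i).opensRange := Scheme.Hom.opensRange_comp_of_isIso _ _
    rw [← Scheme.Hom.coe_opensRange, this]
  -- Proj is proper over the spectrum of the degree zero part, since the algebra is of finite type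
  -- over that part; and the degree zero part is a quotient of `A`.
  refine ⟨Proj (blowupGrading A m), Proj.toSpecZero _ ≫ Spec.map ρ,
    Spec.map (CommRingCat.ofHom (algebraMap (ratioAlgebra A m i₀) K)) ≫ F i₀, F,
    inferInstance, hF, ?_, ?_, ?_, ?_⟩
  · intro i
    simp only [F, c, Category.assoc]
    rw [Proj.awayι_toSpecZero_assoc, ← Spec.map_comp, ← Spec.map_comp]
    congr 1
    ext r
    have h : fromZeroRingHom (blowupGrading A m) (Submonoid.powers (blowupGen A m i))
        (algebraMap A (blowupGrading A m 0) r) =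
        Away.mk _ (blowupGen_mem A m i) 0 (algebraMap A _ r)
          (by rw [zero_smul]; exact SetLike.algebraMap_mem_graded _ r) := by
      apply HomogeneousLocalization.val_injective
      simp only [Away.val_mk, pow_zero]
      rfl
    change blowupAwayToField A (blowupGen A m i) (hm' i) (fromZeroRingHom _ _ _) = _
    refine (congrArg _ h).trans ?_
    rw [blowupAwayToField_mk]
    simp [blowupEval, Polynomial.algebraMap_apply]
  · intro i
    -- Both generic points factor through the chart of the product of the two generators, which is
    -- symmetric in the indices.
    have hgen (i j : ι) (x : blowupAlgebra A m) (hx : x = blowupGen A m i * blowupGen A m j)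
        (hx0 : blowupEval A m x ≠ 0) (hdeg : x ∈ blowupGrading A m (1 + 1)) :
        Spec.map (CommRingCat.ofHom (algebraMap (ratioAlgebra A m i) K)) ≫ F i =
        Spec.map (CommRingCat.ofHom (blowupAwayToField A x hx0)) ≫
          Proj.awayι (blowupGrading A m) x hdeg (by simp) := by
      rw [← Proj.SpecMap_awayMap_awayι (blowupGrading A m) (blowupGen_mem A m i) Nat.one_pos
        (blowupGen_mem A m j) hx]
      have h1 : Spec.map (CommRingCat.ofHom (algebraMap (ratioAlgebra A m i) K)) ≫ F i =
          Spec.map (CommRingCat.ofHom (blowupAwayToField A (blowupGen A m i) (hm' i))) ≫ c i := by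
        rw [← Spec.map_comp_assoc]
        rfl
      rw [h1, ← blowupAwayToField_awayMap A _ _ (hm' i) (hm' j) (blowupGen_mem A m i)
          (blowupGen_mem A m j) hx hx0, CommRingCat.ofHom_comp, Spec.map_comp, Category.assoc]
    have hx : blowupEval A m (blowupGen A m i * blowupGen A m i₀) ≠ 0 := by
      rw [map_mul]; exact mul_ne_zero (hm' _) (hm' _)
    have hdeg := SetLike.mul_mem_graded (blowupGen_mem A m i) (blowupGen_mem A m i₀)
    rw [hgen i i₀ _ rfl hx hdeg, hgen i₀ i _ (mul_comm _ _) hx hdeg]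
  · intro x
    have h := Proj.iSup_basicOpen_eq_top' (blowupGrading A m) (blowupGen A m)
      (fun i => ⟨1, blowupGen_mem A m i⟩) (adjoin_zero_blowupGen A m)
    have hx : x ∈ (⊤ : (Proj (blowupGrading A m)).Opens) := trivial
    rw [← h] at hx
    obtain ⟨i, hi⟩ := TopologicalSpace.Opens.mem_iSup.mp hx
    exact ⟨i, by rw [hrange]; exact hi⟩
  · intro i j q
    have h := Proj.awayι_preimage_basicOpen (blowupGrading A m) (blowupGen_mem A m i) Nat.one_pos
      (blowupGen_mem A m j) Nat.one_pos
    have h' : e i q ∈ c i ⁻¹ᵁ Proj.basicOpen (blowupGrading A m) (blowupGen A m j) ↔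
        Away.isLocalizationElem (blowupGen_mem A m i) (blowupGen_mem A m j) ∉
        (PrimeSpectrum.comap (blowupAwayToRatioAlgebra A i (hm' i)) q).asIdeal := by
      rw [h]
      rfl
    have h3 : blowupAwayToRatioAlgebra A i (hm' i) (Away.isLocalizationElem
        (blowupGen_mem A m i) (blowupGen_mem A m j)) = ratio A m i j := by
      apply Subtype.ext
      change blowupAwayToField A (blowupGen A m i) (hm' i) _ = _
      rw [blowupAwayToField_mk]
      simp [ratio]
    rw [hrange, ← h3]
    exact h'

end ProjectiveModel
/-! ### Classes in the Grothendieck ring of varieties -/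

noncomputable section GrothendieckRing

variable {k : Type u} [Field k]

lemma K0Var.classOf_congr {Z Z' : Scheme.{u}} (f : Z ⟶ Spec (.of k)) (f' : Z' ⟶ Spec (.of k))
    [LocallyOfFiniteType f] [QuasiCompact f] [LocallyOfFiniteType f'] [QuasiCompact f']
    (e : Z ≅ Z') (he : e.hom ≫ f' = f) : classOf f = classOf f' := by
  unfold classOf freeClass
  congr 2
  exact congr_toSkeleton_of_iso
    ((ObjectProperty.fullyFaithfulι _).preimageIso (Over.isoMk e he))

lemma K0Var.classOf_eq_add {X U Z : Scheme.{u}} (f : X ⟶ Spec (.of k)) (j : U ⟶ X) (i : Z ⟶ X)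
    (g : U ⟶ Spec (.of k)) (h : Z ⟶ Spec (.of k)) (hg : j ≫ f = g) (hh : i ≫ f = h)
    [LocallyOfFiniteType f] [QuasiCompact f] [LocallyOfFiniteType g] [QuasiCompact g]
    [LocallyOfFiniteType h] [QuasiCompact h] [IsOpenImmersion j] [IsClosedImmersion i]
    (hij : Set.range j = (Set.range i)ᶜ) : classOf f = classOf g + classOf h := by
  unfold classOf
  rw [← map_add, Ideal.Quotient.eq]
  let X' : FiniteTypeScheme k := ⟨Over.mk f, ‹LocallyOfFiniteType f›, ‹QuasiCompact f›⟩
  let U' : FiniteTypeScheme k := ⟨Over.mk g, ‹LocallyOfFiniteType g›, ‹QuasiCompact g›⟩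
  let Z' : FiniteTypeScheme k := ⟨Over.mk h, ‹LocallyOfFiniteType h›, ‹QuasiCompact h›⟩
  let j' : U' ⟶ X' := ObjectProperty.homMk (Over.homMk j hg)
  let i' : Z' ⟶ X' := ObjectProperty.homMk (Over.homMk i hh)
  exact Ideal.subset_span ⟨X', U', Z', j', i', ‹IsOpenImmersion j›, ‹IsClosedImmersion i›, hij, rfl⟩

lemma K0Var.classOf_mul {X Y : Scheme.{u}} (f : X ⟶ Spec (.of k)) (g : Y ⟶ Spec (.of k))
    [LocallyOfFiniteType f] [QuasiCompact f] [LocallyOfFiniteType g] [QuasiCompact g] :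
    classOf f * classOf g = classOf (pullback.fst f g ≫ f) := by
  unfold classOf freeClass
  rw [← map_mul, ← map_mul, ← Skeleton.toSkeleton_tensorObj]
  rfl

lemma K0Var.classOf_id : classOf (𝟙 (Spec (.of k))) = 1 := by
  unfold classOf freeClass
  rw [← map_one (Ideal.Quotient.mk _), ← map_one (MonoidAlgebra.of ℤ _), Skeleton.one_eq]
  rfl

/-- The Grothendieck ring of varieties modulo the class of the affine line. -/
abbrev K0VarModL (k : Type u) [Field k] : Type (u + 1) :=
  K0Var k ⧸ Ideal.span {K0Var.lefschetz k}

instance locallyOfFiniteType_SpecMap_algebraMap (k B : Type u) [CommRing k] [CommRing B]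
    [Algebra k B] [Algebra.FiniteType k B] :
    LocallyOfFiniteType (Spec.map (CommRingCat.ofHom (algebraMap k B))) := by
  rw [HasRingHomProperty.Spec_iff (P := @LocallyOfFiniteType)]
  exact (RingHom.finiteType_algebraMap).mpr ‹_›

/-- The class of the spectrum of an algebra of finite type, modulo the class of the affine line. -/
def algClass (k B : Type u) [Field k] [CommRing B] [Algebra k B] [Algebra.FiniteType k B] :
    K0VarModL k :=
  Ideal.Quotient.mk _ (K0Var.classOf (Spec.map (CommRingCat.ofHom (algebraMap k B))))

variable {B B' : Type u} [CommRing B] [Algebra k B] [Algebra.FiniteType k B]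
  [CommRing B'] [Algebra k B'] [Algebra.FiniteType k B']

lemma algClass_congr (e : B ≃ₐ[k] B') : algClass k B = algClass k B' := by
  unfold algClass
  congr 1
  refine K0Var.classOf_congr _ _ (Scheme.Spec.mapIso e.symm.toRingEquiv.toCommRingCatIso.op) ?_
  change Spec.map _ ≫ Spec.map _ = _
  rw [← Spec.map_comp]
  congr 1
  ext x
  simp

/-- Cutting a spectrum into a closed subscheme and the basic open set that is its complement. -/
lemma algClass_eq_add {C D : Type u} [CommRing C] [Algebra k C] [Algebra.FiniteType k C]
    [CommRing D] [Algebra k D] [Algebra.FiniteType k D] (f : B) (φ : B →ₐ[k] C)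
    (hφ : Function.Surjective φ) (hker : RingHom.ker φ = Ideal.span {f})
    [Algebra B D] [IsScalarTower k B D] [IsLocalization.Away f D] :
    algClass k B = algClass k D + algClass k C := by
  unfold algClass
  rw [← map_add]
  congr 1
  have : IsOpenImmersion (Spec.map (CommRingCat.ofHom (algebraMap B D))) :=
    IsOpenImmersion.of_isLocalization f
  have : IsClosedImmersion (Spec.map (CommRingCat.ofHom φ.toRingHom)) :=
    IsClosedImmersion.spec_of_surjective _ hφ
  refine K0Var.classOf_eq_add _ (Spec.map (CommRingCat.ofHom (algebraMap B D)))
    (Spec.map (CommRingCat.ofHom φ.toRingHom)) _ _ ?_ ?_ ?_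
  · rw [← Spec.map_comp, ← CommRingCat.ofHom_comp, ← IsScalarTower.algebraMap_eq]
  · rw [← Spec.map_comp, ← CommRingCat.ofHom_comp]
    congr 2
    exact φ.comp_algebraMap
  · have h1 := PrimeSpectrum.localization_away_comap_range D f
    have h2 := range_comap_of_surjective C φ.toRingHom hφ
    change Set.range (PrimeSpectrum.comap (algebraMap B D)) =
      (Set.range (PrimeSpectrum.comap φ.toRingHom))ᶜ
    rw [h1, h2]
    change _ = (PrimeSpectrum.zeroLocus (RingHom.ker φ : Set B))ᶜ
    rw [hker, PrimeSpectrum.zeroLocus_span, PrimeSpectrum.basicOpen_eq_zeroLocus_compl]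

/-- The empty scheme is the disjoint union of two copies of itself, so its class equals its double.
-/
lemma algClass_of_subsingleton [Subsingleton B] : algClass k B = 0 := by
  have : IsLocalization.Away (1 : B) B := IsLocalization.away_of_isUnit_of_bijective _ isUnit_one
    Function.bijective_id
  have h := algClass_eq_add (k := k) (B := B) (C := B) (D := B) 1 (AlgHom.id k B)
    Function.surjective_id (Subsingleton.elim _ _)
  exact left_eq_add.mp h

lemma algClass_self : algClass k k = 1 := by
  unfold algClass
  rw [← map_one (Ideal.Quotient.mk _), ← K0Var.classOf_id]
  congr 1
  refine K0Var.classOf_congr _ _ (Iso.refl _) ?_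
  change 𝟙 _ ≫ 𝟙 _ = Spec.map (𝟙 _)
  simp

lemma lefschetz_eq : K0Var.lefschetz k =
    K0Var.classOf (Spec.map (CommRingCat.ofHom (algebraMap k (MvPolynomial PUnit.{u + 1} k)))) := by
  refine K0Var.classOf_congr _ _ (AffineSpace.SpecIso PUnit (.of k)) ?_
  rw [← Iso.eq_inv_comp]
  exact (AffineSpace.SpecIso_inv_over (n := PUnit.{u + 1}) (.of k)).symm

open TensorProduct in
-- The affine line over `Spec B` is a product with the affine line over `k`, so its class is
-- divisible by that of the line.
lemma algClass_polynomial : algClass k (Polynomial B) = 0 := by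
  unfold algClass
  rw [Ideal.Quotient.eq_zero_iff_mem, Ideal.mem_span_singleton]
  refine ⟨K0Var.classOf (Spec.map (CommRingCat.ofHom (algebraMap k B))), ?_⟩
  rw [lefschetz_eq, K0Var.classOf_mul]
  let e : Polynomial B ≃ₐ[k] MvPolynomial PUnit.{u + 1} k ⊗[k] B :=
    (polyEquivTensor k B).trans ((Algebra.TensorProduct.comm k B (Polynomial k)).trans
      (Algebra.TensorProduct.congr (MvPolynomial.uniqueAlgEquiv k PUnit).symm AlgEquiv.refl))
  refine K0Var.classOf_congr _ _
    ((Scheme.Spec.mapIso e.symm.toRingEquiv.toCommRingCatIso.op) ≪≫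
      (pullbackSpecIso k (MvPolynomial PUnit.{u + 1} k) B).symm) ?_
  rw [Iso.trans_hom, Category.assoc, Iso.symm_hom, pullbackSpecIso_inv_fst_assoc]
  change Spec.map _ ≫ Spec.map _ ≫ Spec.map _ = _
  rw [← Spec.map_comp, ← Spec.map_comp]
  congr 1
  refine CommRingCat.hom_ext (RingHom.ext fun x => ?_)
  exact e.symm.commutes x

/-- The class of a scheme that is covered by finitely many affine open sets is the sum of the
classes of the parts of these that are not in the earlier ones. -/
theorem classOf_eq_sum_algClass {Y : Scheme.{u}} (f : Y ⟶ Spec (.of k)) [LocallyOfFiniteType f]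
    [QuasiCompact f] {ι : Type} [LinearOrder ι] [Fintype ι] (B : ι → Type u)
    [∀ i, CommRing (B i)] [∀ i, Algebra k (B i)] [∀ i, Algebra.FiniteType k (B i)]
    (e : ∀ i, Spec (.of (B i)) ⟶ Y) [∀ i, IsOpenImmersion (e i)]
    (he : ∀ i, e i ≫ f = Spec.map (CommRingCat.ofHom (algebraMap k (B i))))
    (hcov : ∀ y, ∃ i, y ∈ Set.range (e i)) (I : ∀ i, Ideal (B i))
    (hI : ∀ i (p : PrimeSpectrum (B i)), I i ≤ p.asIdeal ↔ ∀ j < i, e i p ∉ Set.range (e j)) :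
    Ideal.Quotient.mk (Ideal.span {K0Var.lefschetz k}) (K0Var.classOf f) =
      ∑ i, algClass k (B i ⧸ I i) := by
  classical
  have : IsLocallyNoetherian Y := LocallyOfFiniteType.isLocallyNoetherian f
  let W (s : Finset ι) : Y.Opens := s.sup fun i => (e i).opensRange
  have hW (s : Finset ι) (y : Y) : y ∈ W s ↔ ∃ i ∈ s, y ∈ Set.range (e i) := by
    induction s using Finset.induction_on with
    | empty => simp [W]
    | insert a s ha ih =>
      have : W (insert a s) = (e a).opensRange ⊔ W s := Finset.sup_insert
      rw [this]
      simp only [Finset.mem_insert, exists_eq_or_imp, ← ih]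
      rfl
  -- Add the charts in increasing order. The condition says that `s` is an initial segment, so the
  -- part of the next chart `a` outside the union for `s` is exactly the closed set of `I a`.
  have key (s : Finset ι) : (∀ i ∈ s, ∀ j < i, j ∈ s) →
      Ideal.Quotient.mk (Ideal.span {K0Var.lefschetz k}) (K0Var.classOf ((W s).ι ≫ f)) =
      ∑ i ∈ s, algClass k (B i ⧸ I i) := by
    induction s using Finset.induction_on_max with
    | empty =>
      intro _
      have : IsEmpty (W ∅ : Y.Opens) := ⟨fun y => by simpa using (hW _ _).mp y.2⟩
      have : IsClosedImmersion (𝟙 (W ∅ : Y.Opens).toScheme) := inferInstance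
      have h := K0Var.classOf_eq_add ((W ∅).ι ≫ f) (𝟙 _) (𝟙 _) _ _ (Category.id_comp _)
        (Category.id_comp _) (Subsingleton.elim _ _)
      rw [left_eq_add.mp h, map_zero, Finset.sum_empty]
    | insert a s ha ih =>
      intro hlow
      have has : a ∉ s := fun h => (ha a h).false
      have hs (j : ι) : j < a ↔ j ∈ s := ⟨fun h =>
        (Finset.mem_insert.mp (hlow a (Finset.mem_insert_self _ _) j h)).resolve_left h.ne, ha j⟩
      rw [Finset.sum_insert has, ← ih fun i hi j hj => (hs j).mp (hj.trans (ha i hi)), algClass,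
        ← map_add, add_comm]
      congr 1
      have hle : W s ≤ W (insert a s) := Finset.sup_mono (Finset.subset_insert _ _)
      let z : Spec (.of (B a ⧸ I a)) ⟶ Y :=
        Spec.map (CommRingCat.ofHom (Ideal.Quotient.mk (I a))) ≫ e a
      have hmk : IsClosedImmersion (Spec.map (CommRingCat.ofHom (Ideal.Quotient.mk (I a)))) :=
        IsClosedImmersion.spec_of_surjective _ Ideal.Quotient.mk_surjective
      have hrange : Set.range (Spec.map (CommRingCat.ofHom (Ideal.Quotient.mk (I a)))) =
          PrimeSpectrum.zeroLocus (I a) := by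
        have := range_comap_of_surjective _ _ (Ideal.Quotient.mk_surjective (I := I a))
        rw [Ideal.mk_ker] at this
        exact this
      have hz (y : Y) : y ∈ Set.range z ↔ y ∈ Set.range (e a) ∧ y ∉ W s := by
        constructor
        · rintro ⟨p, rfl⟩
          have h1 : Spec.map (CommRingCat.ofHom (Ideal.Quotient.mk (I a))) p ∈
            PrimeSpectrum.zeroLocus (I a) := hrange ▸ ⟨p, rfl⟩
          have h2 := (hI a _).mp h1
          refine ⟨⟨_, rfl⟩, fun h3 => ?_⟩
          obtain ⟨i, hi, hi'⟩ := (hW _ _).mp h3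
          exact h2 i ((hs i).mpr hi) hi'
        · rintro ⟨⟨p, rfl⟩, hp⟩
          have h1 : p ∈ PrimeSpectrum.zeroLocus (I a : Set (B a)) := by
            refine (hI a p).mpr fun j hj hp' => hp ?_
            exact (hW _ _).mpr ⟨j, (hs j).mp hj, hp'⟩
          rw [← hrange] at h1
          obtain ⟨q, rfl⟩ := h1
          exact ⟨q, rfl⟩
      have hzW : Set.range z ⊆ Set.range (W (insert a s)).ι := by
        intro y hy
        rw [Scheme.Opens.range_ι]
        exact (hW _ _).mpr ⟨a, Finset.mem_insert_self _ _, ((hz y).mp hy).1⟩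
      let i := IsOpenImmersion.lift (W (insert a s)).ι z hzW
      have hi : i ≫ (W (insert a s)).ι = z := IsOpenImmersion.lift_fac _ _ _
      have : IsPreimmersion (i ≫ (W (insert a s)).ι) := by
        rw [hi]
        infer_instance
      have : IsPreimmersion i := IsPreimmersion.of_comp i (W (insert a s)).ι
      have hij : Set.range (Y.homOfLE hle) = (Set.range i)ᶜ := by
        ext y
        have h1 : y ∈ Set.range (Y.homOfLE hle) ↔ y.1 ∈ W s := by
          constructor
          · rintro ⟨x, rfl⟩
            have := x.2
            rwa [← Y.homOfLE_apply hle x] at this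
          · intro h
            exact ⟨⟨y.1, h⟩, Subtype.ext (Y.homOfLE_apply hle _)⟩
        have h2 : y ∈ Set.range i ↔ y.1 ∈ Set.range z := by
          constructor
          · rintro ⟨x, rfl⟩
            exact ⟨x, by rw [← hi]; rfl⟩
          · rintro ⟨x, hx⟩
            refine ⟨x, Subtype.ext ?_⟩
            rw [← hx, ← hi]
            rfl
        rw [Set.mem_compl_iff, h1, h2, hz]
        have h3 := (hW _ _).mp y.2
        simp only [Finset.mem_insert, exists_eq_or_imp] at h3
        rw [← hW] at h3
        tauto
      -- The image is closed, being the complement of the union of the earlier charts.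
      have hcl : IsClosedImmersion i := by
        refine .of_isPreimmersion i ?_
        rw [← compl_compl (Set.range i), ← hij]
        exact (Y.homOfLE hle).isOpenEmbedding.isOpen_range.isClosed_compl
      refine K0Var.classOf_eq_add _ (Y.homOfLE hle) i _ _ ?_ ?_ hij
      · simp
      · rw [reassoc_of% hi, Category.assoc, he, ← Spec.map_comp, ← CommRingCat.ofHom_comp]
  have htop : W Finset.univ = ⊤ := by
    ext y
    simpa [hW] using hcov y
  rw [← key _ (by simp)]
  congr 1
  refine K0Var.classOf_congr _ _ (Y.topIso.symm ≪≫ Y.isoOfEq htop.symm) ?_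
  simp

end GrothendieckRing
/-! ### The relations of the charts -/

noncomputable section ChartRelations

open MvPolynomial

section Products

variable {R R' : Type*} [CommRing R] [CommRing R'] {N : ℕ}

/-- The form `∑ xᵢ ^ d`. -/
def fermat (d : ℕ) (x : Fin N → R) : R := ∑ i, x i ^ d

/-- The product of the `xᵢ` for `i < j`. -/
def lowProd (j : Fin N) (x : Fin N → R) : R := ∏ i ∈ Finset.Iio j, x i

/-- The product of the `xᵢ` for `j < i < d`. -/
def midProd (d : ℕ) (j : Fin N) (x : Fin N → R) : R :=
  ∏ i ∈ Finset.univ.filter (fun i => j < i ∧ i.1 < d), x i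

/-- The product of the `xᵢ` for `i < d`. -/
def fullProd (d : ℕ) (x : Fin N → R) : R :=
  ∏ i ∈ Finset.univ.filter (fun i : Fin N => i.1 < d), x i

/-- The values of the parameter of the family for which the fibre is singular, apart from `0`, are
the zeros of this polynomial. -/
def discr (d : ℕ) (t : R) : R := 1 - (d * t) ^ d

lemma lowProd_mul_midProd {d : ℕ} {j : Fin N} (hj : j.1 < d) (x : Fin N → R) :
    lowProd j x * (x j * midProd d j x) = fullProd d x := by
  have h1 : (Finset.univ.filter fun i : Fin N => i.1 < d) =
      (Finset.Iio j).disjUnion (insert j (Finset.univ.filter fun i : Fin N => j < i ∧ i.1 < d))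
        (by
          rw [Finset.disjoint_left]
          intro i hi hi'
          simp only [Finset.mem_Iio, Finset.mem_insert, Finset.mem_filter] at hi hi'
          rcases hi' with rfl | hi'
          · exact hi.false
          · exact hi.not_gt hi'.2.1) := by
    ext i
    simp only [Finset.mem_filter, Finset.mem_univ, true_and, Finset.mem_disjUnion, Finset.mem_Iio,
      Finset.mem_insert]
    constructor
    · intro h
      rcases lt_trichotomy i j with h' | h' | h' <;> tauto
    · rintro (h | rfl | h)
      · exact (Fin.lt_def.mp h).trans hj
      · exact hj
      · exact h.2
  rw [fullProd, h1, Finset.prod_disjUnion, Finset.prod_insert (by simp)]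
  rfl

variable (f : R →+* R') (d : ℕ) (j : Fin N) (x : Fin N → R)

lemma map_fermat : f (fermat d x) = fermat d (f ∘ x) := by simp [fermat]

lemma map_lowProd : f (lowProd j x) = lowProd j (f ∘ x) := by simp [lowProd]

lemma map_midProd : f (midProd d j x) = midProd d j (f ∘ x) := by simp [midProd]

lemma map_fullProd : f (fullProd d x) = fullProd d (f ∘ x) := by simp [fullProd]

lemma map_discr (t : R) : f (discr d t) = discr d (f t) := by simp [discr]

end Products

/-- The coordinates `x₀, …, x_{N-1}` and `u`, `v`, `w` of a chart. -/
abbrev ChartVar (N : ℕ) : Type := Fin N ⊕ Fin 3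

variable (k : Type*) [Field k] {N : ℕ} (d : ℕ) (a j : Fin N)

/-- The relations `x_a = 1`, `x_j = u v`, `u ∏_{j<i<d} xᵢ = ∑ xᵢ ^ d` of the chart with number
`(a, j)`, where the parameter of the family is `t = v ∏_{i<j} xᵢ`, and `w` is the inverse of the
value of the discriminant at `t`. -/
def chartRel : Fin 4 → MvPolynomial (ChartVar N) k :=
  ![X (.inl a) - 1,
    X (.inl j) - X (.inr 0) * X (.inr 1),
    X (.inr 0) * midProd d j (fun i => X (.inl i)) - fermat d (fun i => X (.inl i)),
    X (.inr 2) * discr d (X (.inr 1) * lowProd j (fun i => X (.inl i))) - 1]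

lemma chartRel_zero : chartRel k d a j 0 = X (.inl a) - 1 := rfl

lemma chartRel_one : chartRel k d a j 1 = X (.inl j) - X (.inr 0) * X (.inr 1) := rfl

lemma chartRel_two : chartRel k d a j 2 = X (.inr 0) * midProd d j (fun i => X (.inl i)) -
    fermat d (fun i => X (.inl i)) := rfl

lemma chartRel_three : chartRel k d a j 3 =
    X (.inr 2) * discr d (X (.inr 1) * lowProd j (fun i => X (.inl i))) - 1 := rfl

variable {k}

/-! ### Logarithmic derivatives of products and power sums -/

section Derivatives

variable {σ ι : Type*} {e : ι → σ}

/-- After multiplication by the variable the derivative of the product is the product itself, and no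
product with a missing factor appears. -/
lemma X_mul_pderiv_prod_X (he : Function.Injective e) [DecidableEq ι] (M : Finset ι) (i : ι) :
    X (e i) * pderiv (e i) (∏ l ∈ M, (X (e l) : MvPolynomial σ k)) =
      if i ∈ M then ∏ l ∈ M, X (e l) else 0 := by
  induction M using Finset.induction_on with
  | empty => simp
  | insert b M hb ih =>
    rw [Finset.prod_insert hb, Derivation.leibniz, smul_eq_mul, smul_eq_mul, mul_add, mul_left_comm,
      ih]
    by_cases hib : i = b
    · subst hib
      simp [hb, mul_comm]
    · rw [pderiv_X_of_ne (he.ne (Ne.symm hib))]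
      simp [hib]

lemma pderiv_prod_X_of_notMem {s : σ} (hs : ∀ i, e i ≠ s) (M : Finset ι) :
    pderiv s (∏ l ∈ M, (X (e l) : MvPolynomial σ k)) = 0 := by
  classical
  induction M using Finset.induction_on with
  | empty => simp
  | insert b M hb ih =>
    rw [Finset.prod_insert hb, Derivation.leibniz, ih, pderiv_X_of_ne (hs b)]
    simp

lemma pderiv_fermat_of_notMem {e : Fin N → σ} {s : σ} (hs : ∀ i, e i ≠ s) :
    pderiv s (fermat d fun i => (X (e i) : MvPolynomial σ k)) = 0 := by
  rw [fermat, map_sum]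
  exact Finset.sum_eq_zero fun i _ => by rw [pderiv_pow, pderiv_X_of_ne (hs i), mul_zero]

lemma X_mul_pderiv_fermat {e : Fin N → σ} (he : Function.Injective e) (hd : d ≠ 0) (i : Fin N) :
    X (e i) * pderiv (e i) (fermat d fun i => (X (e i) : MvPolynomial σ k)) =
      (d : MvPolynomial σ k) * X (e i) ^ d := by
  rw [fermat, map_sum, Finset.sum_eq_single i]
  · rw [pderiv_pow, pderiv_X_self, mul_one, mul_left_comm, mul_pow_sub_one hd]
  · intro l _ hl
    rw [pderiv_pow, pderiv_X_of_ne (he.ne hl), mul_zero]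
  · simp

end Derivatives

variable {d a j}

/-- The differentials of the relations, and of coordinates other than `x_j` that vanish, are
independent at each point of a chart. -/
theorem chartRel_jacobian [CharZero k] (hd : d ≠ 0) {κ : Type*} [Field κ]
    (ev : MvPolynomial (ChartVar N) k →+* κ) (hev : ∀ i, ev (chartRel k d a j i) = 0)
    {β : Type*} [Fintype β] {y : β → ChartVar N} (hy : Function.Injective y)
    (hy0 : ∀ b, ev (X (y b)) = 0) (hyj : ∀ b, y b ≠ .inl j) (c : Fin 4 → κ) (e : β → κ)
    (hJ : ∀ s, ∑ i, c i * ev (pderiv s (chartRel k d a j i)) +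
      ∑ b, e b * ev (pderiv s (X (y b))) = 0) : c = 0 ∧ e = 0 := by
  classical
  have : CharZero κ := charZero_of_injective_ringHom (ev.comp C).injective
  have hdκ : (d : κ) ≠ 0 := Nat.cast_ne_zero.mpr hd
  -- The coefficients `e` enter only through `E`. Only vanishing coordinates contribute to it, so `E
  -- s` times the value of the coordinate `s` is always zero.
  set E : ChartVar N → κ := fun s => ∑ b, e b * ev (pderiv s (X (y b))) with hE
  have hEX (s) : E s * ev (X s) = 0 := by
    rw [hE, Finset.sum_mul]
    refine Finset.sum_eq_zero fun b _ => ?_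
    by_cases hb : y b = s
    · rw [← hb, hy0, mul_zero]
    · rw [pderiv_X_of_ne hb, map_zero, mul_zero, zero_mul]
  have hEy (b) : E (y b) = e b := by
    rw [hE]
    dsimp only
    rw [Finset.sum_eq_single b]
    · simp
    · intro b' _ hb'
      rw [pderiv_X_of_ne (hy.ne hb'), map_zero, mul_zero]
    · simp
  have hEj : E (.inl j) = 0 := by
    refine Finset.sum_eq_zero fun b _ => ?_
    rw [pderiv_X_of_ne (hyj b), map_zero, mul_zero]
  set x : Fin N → κ := fun i => ev (X (.inl i)) with hx
  set u := ev (X (.inr 0)) with hu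
  set v := ev (X (.inr 1)) with hv
  set w := ev (X (.inr 2)) with hw
  have hcomp : (ev ∘ fun i => X (.inl i)) = x := rfl
  have ha : x a = 1 := by
    simpa [chartRel, sub_eq_zero] using hev 0
  have hxj : x j = u * v := by
    simpa [chartRel, sub_eq_zero] using hev 1
  have huF : u * midProd d j x = fermat d x := by
    simpa [chartRel, sub_eq_zero, map_midProd, map_fermat, hcomp] using hev 2
  have hwg : w * discr d (v * lowProd j x) = 1 := by
    simpa [chartRel, sub_eq_zero, map_lowProd, map_discr, hcomp] using hev 3
  have hinl (i : Fin N) (l : Fin 3) : (Sum.inl i : ChartVar N) ≠ .inr l := Sum.inl_ne_inr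
  -- Only the last relation involves `w`, its derivative there is the invertible discriminant, and
  -- `w` itself does not vanish.
  have hc3 : c 3 = 0 := by
    have h := hJ (.inr 2)
    change _ + E _ = 0 at h
    have hEw : E (.inr 2) = 0 :=
      (mul_eq_zero.mp (hEX _)).resolve_right (left_ne_zero_of_mul_eq_one hwg)
    have h3 : pderiv (.inr 2) (discr d (X (.inr 1) * lowProd j (fun i => X (.inl i))) :
        MvPolynomial (ChartVar N) k) = 0 := by
      rw [discr, lowProd]
      have h4 := pderiv_prod_X_of_notMem (k := k) (e := (Sum.inl : Fin N → ChartVar N))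
        (s := .inr 2) (hinl · 2) (Finset.Iio j)
      simp [Derivation.leibniz, h4, pderiv_X]
    rw [hEw, add_zero, Fin.sum_univ_four] at h
    simp [chartRel, Derivation.leibniz, pderiv_X, h3, midProd,
      pderiv_prod_X_of_notMem (hinl · 2), pderiv_fermat_of_notMem d (hinl · 2), map_discr,
      map_lowProd, hcomp, ← hv] at h
    exact h.resolve_right (right_ne_zero_of_mul_eq_one hwg)
  have hJ' (s) : c 0 * ev (pderiv s (chartRel k d a j 0)) +
      c 1 * ev (pderiv s (chartRel k d a j 1)) + c 2 * ev (pderiv s (chartRel k d a j 2)) +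
      E s = 0 := by
    have h := hJ s
    rwa [Fin.sum_univ_four, hc3, zero_mul, add_zero] at h
  have hJv : - (c 1 * u) + E (.inr 1) = 0 := by
    have h := hJ' (.inr 1)
    simpa [chartRel, Derivation.leibniz, pderiv_X, Pi.single_apply, midProd,
      pderiv_prod_X_of_notMem (hinl · 1), pderiv_fermat_of_notMem d (hinl · 1), ← hu] using h
  have hJu : - (c 1 * v) + c 2 * midProd d j x + E (.inr 0) = 0 := by
    have h := hJ' (.inr 0)
    have h4 : pderiv (.inr 0) (midProd d j fun i => X (.inl i) :
        MvPolynomial (ChartVar N) k) = 0 := pderiv_prod_X_of_notMem (hinl · 0) _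
    simpa [chartRel, Derivation.leibniz, pderiv_X, Pi.single_apply, h4,
      pderiv_fermat_of_notMem d (hinl · 0), ← hv, map_midProd, hcomp] using h
  -- The derivative along `x i`, multiplied by `x i`, so that `E` disappears and each product
  -- becomes a full product.
  have hJx (i) : (if i = a then c 0 else 0) + (if i = j then c 1 * x j else 0) +
      c 2 * ((if j < i ∧ i.1 < d then u * midProd d j x else 0) - d * x i ^ d) = 0 := by
    have h0 : x i * ev (pderiv (.inl i) (chartRel k d a j 0)) = if i = a then 1 else 0 := by
      by_cases hi : i = a
      · simp [chartRel, hi, ha]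
      · simp [chartRel, hi, pderiv_X, Ne.symm hi]
    have h1 : x i * ev (pderiv (.inl i) (chartRel k d a j 1)) = if i = j then x j else 0 := by
      by_cases hi : i = j
      · simp [chartRel, hi, Derivation.leibniz, pderiv_X]
      · simp [chartRel, hi, Derivation.leibniz, pderiv_X, Ne.symm hi]
    have h2 : x i * ev (pderiv (.inl i) (chartRel k d a j 2)) =
        (if j < i ∧ i.1 < d then u * midProd d j x else 0) - d * x i ^ d := by
      have h3 := congrArg ev (X_mul_pderiv_prod_X (k := k) (e := (Sum.inl : Fin N → ChartVar N))
        Sum.inl_injective (Finset.univ.filter (fun i => j < i ∧ i.1 < d)) i)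
      have h4 := congrArg ev (X_mul_pderiv_fermat (k := k) d
        (e := (Sum.inl : Fin N → ChartVar N)) Sum.inl_injective hd i)
      have h5 := map_midProd ev d j (fun i => X (.inl i))
      rw [hcomp, midProd] at h5
      simp only [map_mul, apply_ite ev, map_zero, Finset.mem_filter, Finset.mem_univ, true_and,
        h5, map_pow, map_natCast] at h3 h4
      have h6 : pderiv (.inl i) (chartRel k d a j 2) = X (.inr 0) *
          pderiv (.inl i) (∏ l ∈ Finset.univ.filter (fun i => j < i ∧ i.1 < d), X (.inl l)) -
          pderiv (.inl i) (fermat d fun i => X (.inl i)) := by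
        simp [chartRel, Derivation.leibniz, pderiv_X, midProd]
      rw [h6, map_sub, map_mul, mul_sub, h4, mul_left_comm, h3, mul_ite, mul_zero]
    have h3 := hEX (.inl i)
    have h4 := hJ' (.inl i)
    have e1 : (if i = a then c 0 else 0) = c 0 * if i = a then 1 else 0 := by simp
    have e2 : (if i = j then c 1 * x j else 0) = c 1 * if i = j then x j else 0 := by simp
    rw [e1, e2, ← h0, ← h1, ← h2]
    linear_combination x i * h4 - h3
  -- The equation for `v` times `v`, with `u v = x j`. Likewise the equation for `u` times `u` gives
  -- `c 2 * fermat d x = 0` below.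
  have hc1v : c 1 * x j = 0 := by
    have h1 := hEX (.inr 1)
    rw [← hv] at h1
    linear_combination c 1 * hxj - v * hJv + h1
  have hc2F : c 2 * fermat d x = 0 := by
    have h1 := hEX (.inr 0)
    rw [← hu] at h1
    linear_combination u * hJu - h1 - c 2 * huF + hc1v - c 1 * hxj
  -- For `i ≠ a` the equation `hJx i` reduces to `c 2 * d * x i ^ d = 0`. Only the summand `x a ^ d
  -- = 1` is left in `c 2 * fermat d x = 0`.
  have hc2 : c 2 = 0 := by
    have h1 (i) (hi : i ≠ a) : c 2 * x i ^ d = 0 := by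
      have h := hJx i
      rw [if_neg hi, huF, hc1v] at h
      have h2 : c 2 * (d * x i ^ d) = 0 := by
        split_ifs at h
        · linear_combination hc2F - h
        · linear_combination - h
        · linear_combination hc2F - h
        · linear_combination - h
      rw [mul_left_comm] at h2
      exact (mul_eq_zero.mp h2).resolve_left hdκ
    rw [fermat, Finset.mul_sum, Finset.sum_eq_single a (fun i _ hi => h1 i hi) (by simp), ha,
      one_pow, mul_one] at hc2F
    exact hc2F
  -- If `j = a` then `x j = 1`. Otherwise the derivative along `x j` isolates `c 1`, because `x j`
  -- is not one of the extra coordinates and so `E` vanishes there.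
  have hc1 : c 1 = 0 := by
    by_cases hj : j = a
    · rwa [hj, ha, mul_one] at hc1v
    · have h := hJ' (.inl j)
      rw [hEj, hc2] at h
      simpa [chartRel, pderiv_X, Derivation.leibniz, Ne.symm hj] using h
  have hc0 : c 0 = 0 := by
    have h := hJx a
    rw [hc1, hc2] at h
    simpa using h
  constructor
  · ext i
    fin_cases i <;> assumption
  · ext b
    have h := hJ' (y b)
    rw [hc0, hc1, hc2, hEy] at h
    simpa using h

end ChartRelations

/-! ### Regularity of the charts and completeness of their relations -/

noncomputable section ChartKernel

open MvPolynomial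

variable {k : Type*} [Field k] [CharZero k] {N : ℕ} {d : ℕ} {a j : Fin N}

/-- The local rings of a chart are regular, and coordinates other than `x_j` that vanish at a point
belong to a regular system of parameters. -/
theorem chart_exists_isRegularSystem (hd : d ≠ 0) {S : Type*} [CommRing S]
    (φ : MvPolynomial (ChartVar N) k →+* S) (hφ : Function.Surjective φ)
    (hker : RingHom.ker φ = Ideal.span (Set.range (chartRel k d a j))) (q : Ideal S) [q.IsPrime]
    {β : Type*} [Fintype β] {y : β → ChartVar N} (hy : Function.Injective y)
    (hy0 : ∀ b, φ (X (y b)) ∈ q) (hyj : ∀ b, y b ≠ .inl j)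
    (R : Type*) [CommRing R] [IsLocalRing R] [Algebra S R] [IsLocalization.AtPrime R q] :
    IsNoetherianRing R ∧ ∃ (M : ℕ) (z : Fin M → R),
      IsRegularSystem (Sum.elim (fun b => algebraMap S R (φ (X (y b)))) z) := by
  refine exists_isRegularSystem_of_jacobian φ hφ (chartRel k d a j) hker q (fun b => X (y b)) hy0
    (algebraMap S q.ResidueField) q.ker_algebraMap_residueField (fun c e h => ?_) R
  refine chartRel_jacobian hd ((algebraMap S q.ResidueField).comp φ) (fun i => ?_) hy (fun b => ?_)
    hyj c e h
  · have : φ (chartRel k d a j i) = 0 := by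
      rw [← RingHom.mem_ker, hker]
      exact Ideal.subset_span ⟨i, rfl⟩
    rw [RingHom.comp_apply, this, map_zero]
  · rw [RingHom.comp_apply, ← RingHom.mem_ker, q.ker_algebraMap_residueField]
    exact hy0 b

/-- The local rings are regular, hence domains, and at a point where the coordinate vanishes it is a
member of a regular system of parameters, hence not zero. -/
lemma chart_coord_mem_nonZeroDivisors (hd : d ≠ 0) {S : Type*} [CommRing S]
    (φ : MvPolynomial (ChartVar N) k →+* S) (hφ : Function.Surjective φ)
    (hker : RingHom.ker φ = Ideal.span (Set.range (chartRel k d a j))) {s : ChartVar N}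
    (hs : s ≠ .inl j) : φ (X s) ∈ nonZeroDivisors S := by
  refine mem_nonZeroDivisors_of_isRegularSystem _ fun q _ => ⟨?_, fun hsq => ?_⟩
  · obtain ⟨_, M, z, hz⟩ := chart_exists_isRegularSystem hd φ hφ hker q (β := Empty) (y := nofun)
      (fun b => b.elim) (fun b => b.elim) (fun b => b.elim) (Localization.AtPrime q)
    exact hz.isRegularLocalRing
  · obtain ⟨_, M, z, hz⟩ := chart_exists_isRegularSystem hd φ hφ hker q (β := Unit)
      (y := fun _ => s) (fun _ _ _ => rfl) (fun _ => hsq) (fun _ => hs) (Localization.AtPrime q)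
    exact hz.ne_zero (.inl ())

/-- An algebra homomorphism that satisfies the relations of a chart, and is injective on the
polynomials in the `xᵢ` up to `x_a = 1`, satisfies no other relations. -/
theorem ker_eq_span_chartRel (hd : d ≠ 0) (hj : j.1 < d) {K : Type*} [CommRing K] [Algebra k K]
    (ψ : MvPolynomial (ChartVar N) k →ₐ[k] K) (hψ : ∀ i, ψ (chartRel k d a j i) = 0)
    (hx : ∀ h : MvPolynomial (Fin N) k, ψ (rename .inl h) = 0 → h ∈ Ideal.span {X a - 1}) :
    RingHom.ker ψ = Ideal.span (Set.range (chartRel k d a j)) := by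
  set I := Ideal.span (Set.range (chartRel k d a j)) with hI
  have hle : I ≤ RingHom.ker ψ := by
    rw [hI, Ideal.span_le]
    rintro _ ⟨i, rfl⟩
    exact hψ i
  refine le_antisymm (fun p hp => ?_) hle
  -- In the quotient `S` by the known relations, each element becomes a polynomial in the `x i`
  -- after multiplication by a nonzerodivisor that is such a polynomial. A relation in `K` thereby
  -- becomes one between the `x i` alone, which by `hx` follows from `x a = 1`.
  let S := MvPolynomial (ChartVar N) k ⧸ I
  let π : MvPolynomial (ChartVar N) k →ₐ[k] S := Ideal.Quotient.mkₐ k I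
  have hπ : Function.Surjective π := Ideal.Quotient.mkₐ_surjective k I
  have hkerπ : RingHom.ker π.toRingHom = I := Ideal.mk_ker
  have hnzd {s : ChartVar N} (hs : s ≠ .inl j) : π (X s) ∈ nonZeroDivisors S :=
    chart_coord_mem_nonZeroDivisors hd π.toRingHom hπ hkerπ hs
  have hrel (i) : π (chartRel k d a j i) = 0 := by
    have : chartRel k d a j i ∈ I := Ideal.subset_span ⟨i, rfl⟩
    rw [← hkerπ] at this
    exact this
  set x : Fin N → S := fun i => π (X (.inl i)) with hxdef
  set u := π (X (.inr 0)) with hu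
  set v := π (X (.inr 1)) with hv
  set w := π (X (.inr 2)) with hw
  have hcomp : (π.toRingHom ∘ fun i => X (.inl i)) = x := rfl
  have hfermat := map_fermat π.toRingHom d (fun i => X (.inl i))
  have hmid := map_midProd π.toRingHom d j (fun i => X (.inl i))
  have hlow := map_lowProd π.toRingHom j (fun i => X (.inl i))
  have hdiscr (t) := map_discr π.toRingHom d t
  rw [hcomp] at hfermat hmid hlow
  simp only [AlgHom.toRingHom_eq_coe, RingHom.coe_coe] at hfermat hmid hlow hdiscr
  have hxj : x j = u * v := by
    simpa [chartRel, sub_eq_zero] using hrel 1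
  have huF : u * midProd d j x = fermat d x := by
    simpa [chartRel, sub_eq_zero, hmid, hfermat] using hrel 2
  have hwg : w * discr d (v * lowProd j x) = 1 := by
    simpa [chartRel, sub_eq_zero, hlow, hdiscr] using hrel 3
  let R₀ : Subalgebra k S := (π.comp (rename .inl)).range
  have hxR (i) : x i ∈ R₀ := ⟨X i, by simp [hxdef]⟩
  have hmidR : midProd d j x ∈ R₀ := prod_mem fun i _ => hxR i
  have hfermatR : fermat d x ∈ R₀ := sum_mem fun i _ => pow_mem (hxR i) d
  have hfullR : fullProd d x ∈ R₀ := prod_mem fun i _ => hxR i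
  have hunzd : u ∈ nonZeroDivisors S := hnzd (by simp)
  have hmidnzd : midProd d j x ∈ nonZeroDivisors S := by
    refine prod_mem fun i hi => hnzd ?_
    simp only [Finset.mem_filter] at hi
    simpa using hi.2.1.ne'
  have hFnzd : fermat d x ∈ nonZeroDivisors S := huF ▸ mul_mem hunzd hmidnzd
  -- The elements with a denominator among the polynomials in the `x i`. The denominators are
  -- `midProd` for `u`, the Fermat form for `v`, and its `d`-th power times the discriminant for
  -- `w`.
  let T : Subalgebra k S :=
    { carrier := {s | ∃ m ∈ R₀, m ∈ nonZeroDivisors S ∧ m * s ∈ R₀}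
      mul_mem' := by
        rintro s s' ⟨m, hm, hm', h⟩ ⟨l, hl, hl', h'⟩
        refine ⟨m * l, mul_mem hm hl, mul_mem hm' hl', ?_⟩
        rw [mul_mul_mul_comm]
        exact mul_mem h h'
      add_mem' := by
        rintro s s' ⟨m, hm, hm', h⟩ ⟨l, hl, hl', h'⟩
        refine ⟨m * l, mul_mem hm hl, mul_mem hm' hl', ?_⟩
        have : m * l * (s + s') = l * (m * s) + m * (l * s') := by ring
        rw [this]
        exact add_mem (mul_mem hl h) (mul_mem hm h')
      algebraMap_mem' := fun r => ⟨1, one_mem _, one_mem _, by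
        rw [one_mul]
        exact R₀.algebraMap_mem r⟩ }
  have hT (s : ChartVar N) : π (X s) ∈ T := by
    rcases s with i | i
    · exact ⟨1, one_mem _, one_mem _, by rw [one_mul]; exact hxR i⟩
    · fin_cases i
      · exact ⟨_, hmidR, hmidnzd, by
          change _ * u ∈ _
          rw [mul_comm, huF]
          exact hfermatR⟩
      · refine ⟨_, hfermatR, hFnzd, ?_⟩
        change fermat d x * v ∈ R₀
        have : fermat d x * v = x j * midProd d j x := by
          rw [← huF, hxj]
          ring
        rw [this]
        exact mul_mem (hxR j) hmidR
      -- By `t F = x₀ ⋯ x_{d-1}`, the power `F ^ d` clears the parameter from `1 - (d t) ^ d`.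
      · have h1 : fermat d x ^ d * discr d (v * lowProd j x) =
            fermat d x ^ d - (d * fullProd d x) ^ d := by
          have h2 : fullProd d x = fermat d x * (v * lowProd j x) := by
            rw [← lowProd_mul_midProd hj, hxj, ← huF]
            ring
          rw [h2, discr, mul_sub, mul_one, ← mul_pow]
          ring
        refine ⟨fermat d x ^ d * discr d (v * lowProd j x), ?_, ?_, ?_⟩
        · rw [h1]
          exact sub_mem (pow_mem hfermatR d) (pow_mem (mul_mem (natCast_mem _ _) hfullR) d)
        · exact mul_mem (pow_mem hFnzd d) (IsUnit.of_mul_eq_one_right w hwg).mem_nonZeroDivisors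
        · change _ * w ∈ R₀
          rw [mul_assoc, mul_comm _ w, hwg, mul_one]
          exact pow_mem hfermatR d
  have hTtop (s : S) : s ∈ T := by
    obtain ⟨p, rfl⟩ := hπ s
    induction p using MvPolynomial.induction_on with
    | C r => exact T.algebraMap_mem r
    | add p q hp hq => rw [map_add]; exact add_mem hp hq
    | mul_X p s hp => rw [map_mul]; exact mul_mem hp (hT s)
  obtain ⟨m, ⟨m', hm'⟩, hm, h, hh⟩ := hTtop (π p)
  have hπh : π (rename .inl h) = 0 := by
    have h1 : ψ (rename .inl h) = 0 := by
      have h2 : rename .inl h - rename .inl m' * p ∈ I := by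
        rw [← hkerπ]
        change π _ = 0
        rw [map_sub, map_mul, sub_eq_zero]
        change π (rename .inl m') = m at hm'
        change π (rename .inl h) = m * π p at hh
        rw [hm', hh]
      have h3 : ψ _ = 0 := hle h2
      have h4 : ψ p = 0 := hp
      rwa [map_sub, map_mul, h4, mul_zero, sub_zero] at h3
    obtain ⟨g, rfl⟩ := Ideal.mem_span_singleton.mp (hx h h1)
    have h5 := hrel 0
    simp only [chartRel, Matrix.cons_val_zero] at h5
    rw [map_mul, map_mul, map_sub, rename_X, map_one, h5, zero_mul]
  have h6 : m * π p = 0 := hh.symm.trans hπh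
  have h7 : π p = 0 := (mul_left_mem_nonZeroDivisors_eq_zero_iff hm).mp h6
  rw [← hkerπ]
  exact h7

end ChartKernel

/-! ### The monomials that define the model -/

noncomputable section Monomials

section Products

variable {R : Type*} [CommRing R] {N : ℕ}

lemma lowProd_eq_fullProd (j : Fin N) (x : Fin N → R) : lowProd j x = fullProd j.1 x := by
  refine Finset.prod_congr ?_ fun _ _ => rfl
  ext i
  simp

lemma fullProd_succ (j : Fin N) (x : Fin N → R) :
    fullProd (j.1 + 1) x = fullProd j.1 x * x j := by
  have h := lowProd_mul_midProd (Nat.lt_succ_self j.1) x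
  have h1 : midProd (j.1 + 1) j x = 1 := by
    refine Finset.prod_eq_one fun i hi => ?_
    simp only [Finset.mem_filter, Fin.lt_def] at hi
    omega
  rw [← h, h1, mul_one, lowProd_eq_fullProd]

lemma fullProd_succ_mul_midProd {d : ℕ} {j : Fin N} (hj : j.1 < d) (x : Fin N → R) :
    fullProd (j.1 + 1) x * midProd d j x = fullProd d x := by
  rw [fullProd_succ, ← lowProd_eq_fullProd, mul_assoc, lowProd_mul_midProd hj]

end Products

variable {K : Type*} [Field K] {N : ℕ} (e : ℕ) (x : Fin N → K) (t : K)

lemma fullProd_ne_zero (hx : ∀ i, x i ≠ 0) (m : ℕ) : fullProd m x ≠ 0 :=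
  Finset.prod_ne_zero_iff.mpr fun i _ => hx i

lemma fullProd_div (a : Fin N) {m : ℕ} (hm : m ≤ N) :
    fullProd m (fun i => x i / x a) = fullProd m x / x a ^ m := by
  rw [fullProd, Finset.prod_div_distrib, Finset.prod_const, fullProd]
  congr 2
  rw [Fin.card_filter_val_lt, min_eq_right hm]

/-- The two kinds of factors of the monomials. -/
def weight (i : Fin e) : Option (Fin N) → K
  | none => fullProd (i.1 + 1) x
  | some c => t * x c ^ (i.1 + 1)

/-- The monomials that define the model. -/
def monom (l : Fin N × (Fin e → Option (Fin N))) : K :=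
  x l.1 * ∏ i, weight e x t i (l.2 i)

/-- The exponent vectors with factors `none` at the places in `Z`. -/
def word (b : Fin N) (Z : Finset ℕ) : Fin N × (Fin e → Option (Fin N)) :=
  (b, fun i => if i.1 ∈ Z then none else some b)

/-- The indices of the charts that suffice to cover the model. -/
def vertex (a : Fin N) (j : ℕ) : Fin N × (Fin e → Option (Fin N)) :=
  word e a (Finset.range j)

variable {e x t}

lemma weight_ne_zero (hx : ∀ i, x i ≠ 0) (ht : t ≠ 0) (i : Fin e) (o : Option (Fin N)) :
    weight e x t i o ≠ 0 := by
  cases o with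
  | none => exact fullProd_ne_zero x hx _
  | some c => exact mul_ne_zero ht (pow_ne_zero _ (hx c))

lemma monom_ne_zero (hx : ∀ i, x i ≠ 0) (ht : t ≠ 0) (l) : monom e x t l ≠ 0 :=
  mul_ne_zero (hx _) (Finset.prod_ne_zero_iff.mpr fun i _ => weight_ne_zero hx ht i _)

/-- If the monomial with factor `t x_c ^ (i + 1)` does not vanish at a point, then neither does the
one with `x_b` in place of `x_c`. The exponents match because the factor at place `i` has degree `i
+ 1` and the front variable adds one more. -/
lemma monom_pow_eq (b c : Fin N) (q : Fin e → Option (Fin N)) (i : Fin e) (hi : q i = some c) :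
    monom e x t (b, q) ^ (i.1 + 2) =
      monom e x t (b, Function.update q i (some b)) * monom e x t (c, q) ^ (i.1 + 1) := by
  have h1 (q' : Fin e → Option (Fin N)) (hq : ∀ l ≠ i, q' l = q l) :
      ∏ l, weight e x t l (q' l) =
        weight e x t i (q' i) * ∏ l ∈ Finset.univ.erase i, weight e x t l (q l) := by
    rw [← Finset.mul_prod_erase _ _ (Finset.mem_univ i)]
    congr 1
    exact Finset.prod_congr rfl fun l hl => by rw [hq l (Finset.ne_of_mem_erase hl)]
  simp only [monom]
  rw [h1 q (fun _ _ => rfl), h1 _ (fun l hl => Function.update_of_ne hl _ _), hi,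
    Function.update_self]
  simp only [weight]
  ring

/-- Exchanging the kinds of the factors at the places `i` and `i + 1` frees one variable `x_b` and
one variable `x_{i+1}`; the latter becomes the front variable of the last monomial. So a factor
`none` may be moved down one place. -/
lemma monom_word_sq (b : Fin N) (Z : Finset ℕ) (i : ℕ) (hi : i ∉ Z) (hi' : i + 1 ∈ Z)
    (hie : i + 1 < e) (heN : e ≤ N) :
    monom e x t (word e b Z) ^ 2 =
      monom e x t (word e b (insert i (Z.erase (i + 1)))) *
        monom e x t (⟨i + 1, hie.trans_le heN⟩, (word e b Z).2) := by
  let i₀ : Fin e := ⟨i, by omega⟩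
  let i₁ : Fin e := ⟨i + 1, hie⟩
  have hne : i₁ ∈ Finset.univ.erase i₀ :=
    Finset.mem_erase.mpr ⟨by simp [i₀, i₁], Finset.mem_univ _⟩
  have h1 (q q' : Fin e → Option (Fin N)) (hq : ∀ l, l ≠ i₀ → l ≠ i₁ → q' l = q l) :
      ∏ l, weight e x t l (q' l) = weight e x t i₀ (q' i₀) * (weight e x t i₁ (q' i₁) *
        ∏ l ∈ (Finset.univ.erase i₀).erase i₁, weight e x t l (q l)) := by
    rw [← Finset.mul_prod_erase _ _ (Finset.mem_univ i₀), ← Finset.mul_prod_erase _ _ hne]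
    congr 2
    refine Finset.prod_congr rfl fun l hl => ?_
    rw [Finset.mem_erase, Finset.mem_erase] at hl
    rw [hq l hl.2.1 hl.1]
  simp only [monom]
  rw [h1 (word e b Z).2 (word e b Z).2 (fun _ _ _ => rfl),
    h1 (word e b Z).2 (word e b (insert i (Z.erase (i + 1)))).2 (fun l hl hl' => ?_)]
  · have e1 : (word e b Z).2 i₀ = some b := if_neg hi
    have e2 : (word e b Z).2 i₁ = none := if_pos hi'
    have e3 : (word e b (insert i (Z.erase (i + 1)))).2 i₀ = none := if_pos (by simp [i₀])
    have e4 : (word e b (insert i (Z.erase (i + 1)))).2 i₁ = some b := if_neg (by simp [i₁])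
    have e5 := fullProd_succ ⟨i + 1, hie.trans_le heN⟩ x
    rw [e1, e2, e3, e4]
    simp only [weight, i₀, i₁, word] at e5 ⊢
    rw [e5]
    ring
  · have hl0 : l.1 ≠ i := fun h => hl (Fin.ext h)
    have hl1 : l.1 ≠ i + 1 := fun h => hl' (Fin.ext h)
    simp [word, hl0, hl1]

/-- A set of indices that contains the factors of each relation between the monomials contains a
vertex if it is not empty. -/
theorem exists_vertex_mem (heN : e ≤ N) (S : Set (Fin N × (Fin e → Option (Fin N))))
    (hS : ∀ (l l' l'' : Fin N × (Fin e → Option (Fin N))) (r s : ℕ), monom e x t l ^ r =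
      monom e x t l' * monom e x t l'' ^ s → r = s + 1 → l ∈ S → l' ∈ S)
    {b : Fin N} {q : Fin e → Option (Fin N)} (hbq : (b, q) ∈ S) :
    ∃ j ≤ e, vertex e b j ∈ S := by
  classical
  -- Replace the variables of the factors of the second kind by `x_b`, one place after the other.
  have h1 (s : Finset (Fin e)) : (b, fun i => if i ∈ s ∧ q i ≠ none then some b else q i) ∈ S := by
    induction s using Finset.induction_on with
    | empty => simpa using hbq
    | insert i s hi ih =>
      cases hqi : q i with
      | none =>
        convert ih using 3 with l
        by_cases hl : l = i
        · simp [hl, hqi]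
        · simp [hl]
      | some c =>
        have h2 := hS _ _ _ _ _ (monom_pow_eq (x := x) (t := t) b c
          (fun i => if i ∈ s ∧ q i ≠ none then some b else q i) i (by simp [hi, hqi])) rfl ih
        convert h2 using 3 with l
        by_cases hl : l = i
        · subst hl
          simp [hqi]
        · simp [hl]
  -- Induction on the sum of the places in `Z`: a place whose predecessor is missing is moved down,
  -- which lowers the sum by one. If no move is possible, `Z` is an initial segment.
  have h2 (M : ℕ) (Z : Finset ℕ) (hM : ∑ i ∈ Z, i = M) (hZe : ∀ i ∈ Z, i < e)
      (hZ : word e b Z ∈ S) : ∃ j ≤ e, vertex e b j ∈ S := by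
    induction M using Nat.strong_induction_on generalizing Z with
    | _ M ih =>
      by_cases hZ' : ∃ i, i ∉ Z ∧ i + 1 ∈ Z
      · obtain ⟨i, hi, hi'⟩ := hZ'
        have hsum : ∑ l ∈ insert i (Z.erase (i + 1)), l + 1 = M := by
          rw [Finset.sum_insert (by simp [hi]), ← hM, ← Finset.add_sum_erase Z _ hi']
          ring
        refine ih _ (by omega) (insert i (Z.erase (i + 1))) rfl (fun l hl => ?_)
          (hS _ _ _ 2 1 ((monom_word_sq b Z i hi hi' (hZe _ hi') heN).trans
            (congrArg _ (pow_one _).symm)) rfl hZ)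
        rcases Finset.mem_insert.mp hl with rfl | hl
        · exact (Nat.lt_succ_self _).trans (hZe _ hi')
        · exact hZe l (Finset.mem_of_mem_erase hl)
      · push Not at hZ'
        have hex : ∃ j, j ∉ Z := ⟨e, fun h => (hZe e h).false⟩
        refine ⟨Nat.find hex, Nat.find_le fun h => (hZe e h).false, ?_⟩
        have : Z = Finset.range (Nat.find hex) := by
          ext l
          rw [Finset.mem_range]
          constructor
          · intro hl
            by_contra hlt
            exact Nat.le_induction (P := fun l _ => l ∉ Z) (Nat.find_spec hex)
              (fun m _ hm => hZ' m hm) l (not_lt.mp hlt) hl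
          · intro hl
            exact not_not.mp (Nat.find_min hex hl)
        rw [vertex, ← this]
        exact hZ
  refine h2 _ (Finset.univ.filter (fun i => q i = none) |>.image Fin.val) rfl (by simp) ?_
  convert h1 Finset.univ using 1
  simp only [word, Prod.mk.injEq, true_and]
  ext1 i
  have hmem : i.1 ∈ (Finset.univ.filter (fun i => q i = none)).image Fin.val ↔ q i = none := by
    simp only [Finset.mem_image, Finset.mem_filter, Finset.mem_univ, true_and]
    exact ⟨fun ⟨l, hl, hl'⟩ => Fin.ext hl' ▸ hl, fun h => ⟨i, h, rfl⟩⟩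
  by_cases hq : q i = none <;> simp [hq, hmem, -Finset.mem_image]

end Monomials

/-! ### The charts of the model -/

noncomputable section Charts

open MvPolynomial

variable {k A K : Type u} [Field k] [CommRing A] [Field K] [Algebra k A] [Algebra k K]
  [Algebra A K] {N e : ℕ}

variable (k) in
/-- The homogeneous coordinates `xᵢ` of a general point of the family
`x₀ ⋯ x_e = T (x₀ ^ (e + 1) + ⋯ + x_{N-1} ^ (e + 1))` over the algebra `A`, which is generated by `T`
and the inverse `W` of the discriminant. -/
structure IsGeneralPoint (e : ℕ) (x : Fin N → K) (T W : A) : Prop where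
  lt : e < N
  ne_zero : ∀ i, x i ≠ 0
  mem_span : ∀ (a : Fin N) (h : MvPolynomial (Fin N) k),
    aeval (fun i => x i / x a) h = 0 → h ∈ Ideal.span {X a - 1}
  param_ne_zero : algebraMap A K T ≠ 0
  param_mul : algebraMap A K T * fermat (e + 1) x = fullProd (e + 1) x
  mul_discr : W * discr (e + 1) T = 1
  adjoin_eq_top : Algebra.adjoin k {T, W} = ⊤

variable (k) in
/-- The coordinates of a chart as elements of the function field. -/
def chartEval (x : Fin N → K) (t w : K) (a j : Fin N) : MvPolynomial (ChartVar N) k →ₐ[k] K :=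
  aeval (Sum.elim (fun i => x i / x a)
    ![fullProd (j.1 + 1) (fun i => x i / x a) / t, t / fullProd j.1 (fun i => x i / x a), w])

variable (k) in
/-- The quotient of a factor of a monomial by the corresponding factor for the vertex with number
`(a, j)`, in terms of the coordinates of the chart. -/
def chartFactor (heN : e < N) (j : Fin N) (i : Fin e) :
    Option (Fin N) → MvPolynomial (ChartVar N) k
  | none => if i.1 < j.1 then 1 else X (.inr 0) * midProd (i.1 + 1) j (fun l => X (.inl l))
  | some c => X (.inl c) ^ (i.1 + 1) *
      if i.1 < j.1 then X (.inr 1) * midProd j.1 ⟨i.1, i.2.trans heN⟩ (fun l => X (.inl l)) else 1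

namespace IsGeneralPoint

variable {x : Fin N → K} {T W : A} (a j : Fin N)

local notation "ψ" => chartEval k x (algebraMap A K T) (algebraMap A K W)

section
variable (x) (t w : K)

lemma chartEval_inl (i : Fin N) : chartEval k x t w a j (X (.inl i)) = x i / x a := by
  simp [chartEval]

lemma chartEval_inr_zero : chartEval k x t w a j (X (.inr 0)) =
    fullProd (j.1 + 1) (fun i => x i / x a) / t := by
  simp [chartEval]

lemma chartEval_inr_one : chartEval k x t w a j (X (.inr 1)) =
    t / fullProd j.1 (fun i => x i / x a) := by
  simp [chartEval]

lemma chartEval_inr_two : chartEval k x t w a j (X (.inr 2)) = w := by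
  simp [chartEval]

lemma chartEval_midProd (m : ℕ) (l : Fin N) :
    chartEval k x t w a j (midProd m l (fun i => X (.inl i))) =
      midProd m l (fun i => x i / x a) := by
  simp [midProd, chartEval_inl]

lemma chartEval_fullProd (m : ℕ) : chartEval k x t w a j (fullProd m (fun i => X (.inl i))) =
      fullProd m (fun i => x i / x a) := by
  simp [fullProd, chartEval_inl]

lemma chartEval_fermat (m : ℕ) : chartEval k x t w a j (fermat m (fun i => X (.inl i))) =
      fermat m (fun i => x i / x a) := by
  simp [fermat, chartEval_inl]

end

lemma chart_ne_zero (h : IsGeneralPoint k e x T W) (i : Fin N) :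
    x i / x a ≠ 0 := div_ne_zero (h.ne_zero i) (h.ne_zero a)

lemma chart_fullProd_ne_zero (h : IsGeneralPoint k e x T W) (m : ℕ) : fullProd m (fun i => x i / x a) ≠ 0 :=
  fullProd_ne_zero _ (fun i => h.chart_ne_zero a i) _

/-- Both sides of the equation of the family are forms of degree `e + 1`, so it survives division by
`x a`. -/
lemma param_mul_chart (h : IsGeneralPoint k e x T W) : algebraMap A K T * fermat (e + 1) (fun i => x i / x a) =
    fullProd (e + 1) (fun i => x i / x a) := by
  rw [fullProd_div x a (m := e + 1) h.lt, ← h.param_mul]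
  simp only [fermat, div_pow, ← Finset.sum_div]
  ring

lemma chartEval_param (h : IsGeneralPoint k e x T W) : ψ a j (X (.inr 1) * lowProd j (fun i => X (.inl i))) =
    algebraMap A K T := by
  rw [map_mul, lowProd_eq_fullProd, chartEval_fullProd, chartEval_inr_one,
    div_mul_cancel₀ _ (h.chart_fullProd_ne_zero a _)]

lemma chartEval_chartRel (h : IsGeneralPoint k e x T W) (hj : j.1 < e + 1) (i : Fin 4) :
    ψ a j (chartRel k (e + 1) a j i) = 0 := by
  match i with
  | 0 =>
    rw [chartRel_zero, map_sub, map_one, chartEval_inl, div_self (h.ne_zero a), sub_self]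
  | 1 =>
    rw [chartRel_one, map_sub, map_mul, chartEval_inl, chartEval_inr_zero, chartEval_inr_one, fullProd_succ]
    have h1 := h.chart_fullProd_ne_zero a j.1
    have h2 := h.param_ne_zero
    field_simp
    ring
  | 2 =>
    rw [chartRel_two, map_sub, map_mul, chartEval_inr_zero, chartEval_midProd, chartEval_fermat,
      div_mul_eq_mul_div, fullProd_succ_mul_midProd hj, ← h.param_mul_chart,
      mul_div_cancel_left₀ _ h.param_ne_zero, sub_self]
  | 3 =>
    have h1 := map_discr (ψ a j).toRingHom (e + 1) (X (.inr 1) * lowProd j (fun i => X (.inl i)))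
    simp only [AlgHom.toRingHom_eq_coe, RingHom.coe_coe] at h1
    rw [chartRel_three, map_sub, map_mul, h1, h.chartEval_param, chartEval_inr_two, ← map_discr, ← map_mul,
      h.mul_discr, map_one, map_one, sub_self]

/-- For the general point, the ratios `x i / x a` satisfy no relation but the one that the ratio
with index `a` is `1`. -/
lemma ker_chartEval (h : IsGeneralPoint k e x T W) [CharZero k] (hj : j.1 < e + 1) :
    RingHom.ker (ψ a j) = Ideal.span (Set.range (chartRel k (e + 1) a j)) := by
  refine ker_eq_span_chartRel (Nat.succ_ne_zero e) hj _ (h.chartEval_chartRel a j hj) fun p hp => ?_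
  refine h.mem_span a p ?_
  rw [← hp, chartEval, aeval_rename]
  rfl

/-- The factors at place `i` have the same degree `i + 1`, so the ratios `x l / x a` may replace the
`x l`. For `i < j` the claim is `t / (x₀ ⋯ xᵢ) = v ∏_{i<l<j} x_l`, and for `i ≥ j` it is `x₀ ⋯ xᵢ /
t = u ∏_{j<l≤i} x_l`. -/
lemma chartEval_chartFactor (h : IsGeneralPoint k e x T W) (i : Fin e) (o : Option (Fin N)) :
    ψ a j (chartFactor k h.lt j i o) =
      weight e x (algebraMap A K T) i o / weight e x (algebraMap A K T) i ((vertex e a j.1).2 i) := by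
  have hw (o') : weight e x (algebraMap A K T) i o' =
      weight e (fun i => x i / x a) (algebraMap A K T) i o' * x a ^ (i.1 + 1) := by
    have h0 := pow_ne_zero (i.1 + 1) (h.ne_zero a)
    cases o' with
    | none => simp only [weight]; rw [fullProd_div x a (by have := h.lt; omega), div_mul_cancel₀ _ h0]
    | some c => simp only [weight]; rw [div_pow, mul_assoc, div_mul_cancel₀ _ h0]
  rw [hw o, hw, mul_div_mul_right _ _ (pow_ne_zero _ (h.ne_zero a))]
  have ht := h.param_ne_zero
  have h1 := h.chart_fullProd_ne_zero a
  by_cases hij : i.1 < j.1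
  · have hv : (vertex e a j.1).2 i = none := if_pos (by simpa using hij)
    rw [hv]
    cases o with
    | none =>
      simp only [chartFactor, if_pos hij, map_one, weight]
      rw [div_self (h1 _)]
    | some c =>
      simp only [chartFactor, if_pos hij, map_mul, map_pow, chartEval_inl, chartEval_inr_one,
        chartEval_midProd, weight]
      have h2 := fullProd_succ_mul_midProd (j := ⟨i.1, i.2.trans h.lt⟩) hij (fun i => x i / x a)
      rw [← h2]
      have h3 : midProd j.1 ⟨i.1, i.2.trans h.lt⟩ (fun i => x i / x a) ≠ 0 := by
        refine right_ne_zero_of_mul (a := fullProd (i.1 + 1) fun i => x i / x a) ?_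
        rw [h2]
        exact h1 _
      have h4 := h1 (i.1 + 1)
      generalize fullProd (i.1 + 1) (fun i => x i / x a) = p at *
      field_simp
  · have hv : (vertex e a j.1).2 i = some a := if_neg (by simpa using hij)
    rw [hv]
    cases o with
    | none =>
      simp only [chartFactor, if_neg hij, map_mul, chartEval_inr_zero, chartEval_midProd, weight]
      rw [div_mul_eq_mul_div, fullProd_succ_mul_midProd (by omega), div_self (h.ne_zero a), one_pow,
        mul_one]
    | some c =>
      simp only [chartFactor, if_neg hij, map_mul, map_pow, chartEval_inl, map_one, weight]
      rw [div_self (h.ne_zero a), one_pow, mul_one, mul_one, mul_div_cancel_left₀ _ ht]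

lemma chartEval_ratio (h : IsGeneralPoint k e x T W) (l : Fin N × (Fin e → Option (Fin N))) :
    ψ a j (X (.inl l.1) * ∏ i, chartFactor k h.lt j i (l.2 i)) =
      monom e x (algebraMap A K T) l / monom e x (algebraMap A K T) (vertex e a j.1) := by
  rw [map_mul, map_prod, chartEval_inl]
  simp only [h.chartEval_chartFactor, monom, Finset.prod_div_distrib]
  exact div_mul_div_comm _ _ _ _

variable [IsScalarTower k A K]

/-- Each ratio of monomials is a product of chart factors, and the generators `T` and `W` of `A` are
values of polynomials in the coordinates. -/
lemma ratioAlgebra_le_range (h : IsGeneralPoint k e x T W) {z : K}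
    (hz : z ∈ ratioAlgebra A (monom e x (algebraMap A K T)) (vertex e a j.1)) :
    z ∈ (ψ a j).range := by
  induction hz using Algebra.adjoin_induction with
  | mem z hz =>
    obtain ⟨l, rfl⟩ := hz
    dsimp only
    rw [← h.chartEval_ratio]
    exact AlgHom.mem_range_self _ _
  | algebraMap s =>
    have hs : s ∈ Algebra.adjoin k {T, W} := h.adjoin_eq_top ▸ Algebra.mem_top
    have hle : Algebra.adjoin k {T, W} ≤
        (ψ a j).range.comap (IsScalarTower.toAlgHom k A K) := by
      refine Algebra.adjoin_le ?_
      rintro y (hy | hy) <;> rw [hy]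
      · change algebraMap A K T ∈ (ψ a j).range
        have h1 := AlgHom.mem_range_self (ψ a j) (X (.inr 1) * lowProd j (fun i => X (.inl i)))
        rwa [h.chartEval_param] at h1
      · change algebraMap A K W ∈ (ψ a j).range
        have h1 := AlgHom.mem_range_self (ψ a j) (X (.inr 2))
        rwa [chartEval_inr_two] at h1
    exact hle hs
  | add _ _ _ _ h1 h2 => exact add_mem h1 h2
  | mul _ _ _ _ h1 h2 => exact mul_mem h1 h2

/-- Conversely, the coordinates `x i`, and `u` and `v` apart from the extreme values of `j`, are
ratios to the vertex monomial of monomials that differ from it in one factor. -/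
lemma mem_ratioAlgebra_iff (h : IsGeneralPoint k e x T W) (hj : j.1 < e + 1) (z : K) :
    z ∈ ratioAlgebra A (monom e x (algebraMap A K T)) (vertex e a j.1) ↔ z ∈ (ψ a j).range := by
  have hm := monom_ne_zero h.ne_zero h.param_ne_zero (vertex e a j.1)
  have hfac {i : Fin e} {o o' : Option (Fin N)} (ho : o = o') :
      weight e x (algebraMap A K T) i o / weight e x (algebraMap A K T) i o' = 1 := by
    rw [ho, div_self (weight_ne_zero h.ne_zero h.param_ne_zero _ _)]
  refine ⟨h.ratioAlgebra_le_range a j, ?_⟩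
  · rintro ⟨p, rfl⟩
    have hx (i) : x i / x a ∈
        ratioAlgebra A (monom e x (algebraMap A K T)) (vertex e a j.1) := by
      have h1 := div_mem_ratioAlgebra A (monom e x (algebraMap A K T)) (vertex e a j.1)
        (i, (vertex e a j.1).2)
      rwa [← h.chartEval_ratio, map_mul, map_prod, Finset.prod_eq_one, mul_one,
        chartEval_inl] at h1
      intro l _
      rw [h.chartEval_chartFactor, hfac rfl]
    have hupd (i : Fin e) (o) : chartEval k x (algebraMap A K T) (algebraMap A K W) a j
        (chartFactor k h.lt j i o) ∈
        ratioAlgebra A (monom e x (algebraMap A K T)) (vertex e a j.1) := by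
      have h1 := div_mem_ratioAlgebra A (monom e x (algebraMap A K T)) (vertex e a j.1)
        (a, Function.update (vertex e a j.1).2 i o)
      rw [← h.chartEval_ratio, map_mul, map_prod, Finset.prod_eq_single i, chartEval_inl,
        div_self (h.ne_zero a), one_mul] at h1
      · simpa using h1
      · intro l _ hl
        rw [h.chartEval_chartFactor, hfac (Function.update_of_ne hl _ _)]
      · simp
    change ψ a j p ∈ _
    induction p using MvPolynomial.induction_on with
    | C r =>
      have : ψ a j (C r) = algebraMap A K (algebraMap k A r) := by
        rw [← IsScalarTower.algebraMap_apply]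
        exact (ψ a j).commutes r
      rw [this]
      exact Subalgebra.algebraMap_mem _ _
    | add p q hp hq => rw [map_add]; exact add_mem hp hq
    | mul_X p s hp =>
      rw [map_mul]
      refine mul_mem hp ?_
      rcases s with i | i
      · rw [chartEval_inl]
        exact hx i
      · match i with
        | 0 =>
          -- There is a factor at place `j` only if `j < e`. For `j = e` the equation of the family
          -- gives `u = F`.
          by_cases hje : j.1 < e
          · convert hupd ⟨j.1, hje⟩ none using 1
            have h1 : midProd (j.1 + 1) j (fun l => (X (.inl l) : MvPolynomial (ChartVar N) k)) =
                1 := by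
              refine Finset.prod_eq_one fun i hi => ?_
              simp only [Finset.mem_filter, Fin.lt_def] at hi
              omega
            simp [chartFactor, h1]
          · have hje' : j.1 = e := by omega
            have h1 : fullProd (j.1 + 1) (fun i => x i / x a) =
                algebraMap A K T * fermat (e + 1) (fun i => x i / x a) := by
              rw [hje', h.param_mul_chart]
            rw [chartEval_inr_zero, h1, mul_div_cancel_left₀ _ h.param_ne_zero]
            exact sum_mem fun i _ => pow_mem (hx i) _
        | 1 =>
          -- For `j = 0` the coordinate `v` is the parameter itself; otherwise it comes from the
          -- factor at place `j - 1`.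
          by_cases hj0 : j.1 = 0
          · rw [chartEval_inr_one, hj0]
            have : fullProd 0 (fun i => x i / x a) = 1 := by simp [fullProd]
            rw [this, div_one]
            exact Subalgebra.algebraMap_mem _ _
          · have hlt : j.1 - 1 < j.1 := by omega
            convert hupd ⟨j.1 - 1, by omega⟩ (some a) using 1
            have h1 (hN) : midProd j.1 ⟨j.1 - 1, hN⟩
                (fun l => (X (.inl l) : MvPolynomial (ChartVar N) k)) = 1 := by
              refine Finset.prod_eq_one fun i hi => ?_
              simp only [Finset.mem_filter, Fin.lt_def] at hi
              omega
            simp [chartFactor, h1, hlt, chartEval_inl, div_self (h.ne_zero a)]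
        | 2 =>
          rw [chartEval_inr_two]
          exact Subalgebra.algebraMap_mem _ _

/-- The coordinates of a chart. -/
def chartHom (h : IsGeneralPoint k e x T W) (hj : j.1 < e + 1) : MvPolynomial (ChartVar N) k →ₐ[k]
    ratioAlgebra A (monom e x (algebraMap A K T)) (vertex e a j.1) :=
  (ψ a j).codRestrict
    ((ratioAlgebra A (monom e x (algebraMap A K T)) (vertex e a j.1)).restrictScalars k)
    fun p => (h.mem_ratioAlgebra_iff a j hj _).mpr ⟨p, rfl⟩

lemma coe_chartHom (h : IsGeneralPoint k e x T W) (hj : j.1 < e + 1) (p) :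
    (h.chartHom a j hj p : K) = ψ a j p := rfl

lemma chartHom_surjective (h : IsGeneralPoint k e x T W) (hj : j.1 < e + 1) :
    Function.Surjective (h.chartHom a j hj) := by
  intro z
  obtain ⟨p, hp⟩ := (h.mem_ratioAlgebra_iff a j hj z.1).mp z.2
  exact ⟨p, Subtype.ext hp⟩

lemma ker_chartHom [CharZero k] (h : IsGeneralPoint k e x T W) (hj : j.1 < e + 1) :
    RingHom.ker (h.chartHom a j hj) = Ideal.span (Set.range (chartRel k (e + 1) a j)) := by
  rw [← h.ker_chartEval a j hj]
  ext p
  exact Subtype.ext_iff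

lemma algebraMap_param (h : IsGeneralPoint k e x T W) (hj : j.1 < e + 1) :
    algebraMap A (ratioAlgebra A (monom e x (algebraMap A K T)) (vertex e a j.1)) T =
      h.chartHom a j hj (X (.inr 1) * lowProd j (fun i => X (.inl i))) :=
  Subtype.ext (h.chartEval_param a j).symm

lemma ratio_eq (h : IsGeneralPoint k e x T W) (hj : j.1 < e + 1)
    (l : Fin N × (Fin e → Option (Fin N))) :
    ratio A (monom e x (algebraMap A K T)) (vertex e a j.1) l =
      h.chartHom a j hj (X (.inl l.1) * ∏ i, chartFactor k h.lt j i (l.2 i)) :=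
  Subtype.ext (h.chartEval_ratio a j l).symm

end IsGeneralPoint

end Charts

/-! ### Charts of a fibre -/

section FibreChart

/-- An open affine subscheme `Spec B` of the total space of a family over `Spec A` meets the fibre
over the point `τ = 0` in `Spec (B / τ)`. -/
theorem exists_fibreChart {k A B : Type u} [CommRing k] [CommRing A] [CommRing B] [Algebra k A]
    [Algebra k B] [Algebra A B] [IsScalarTower k A B] (ε : A →ₐ[k] k) {τ : A}
    (hτ : RingHom.ker ε = Ideal.span {τ}) {X : Scheme.{u}} (π : X ⟶ Spec (.of A))
    (t : Spec (.of k) ⟶ Spec (.of A)) (ht : t = Spec.map (CommRingCat.ofHom ε.toRingHom))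
    (f : Spec (.of B) ⟶ X) [IsOpenImmersion f]
    (hf : f ≫ π = Spec.map (CommRingCat.ofHom (algebraMap A B))) :
    ∃ g : Spec (.of (B ⧸ Ideal.span {algebraMap A B τ})) ⟶ pullback π t,
      IsOpenImmersion g ∧
      g ≫ pullback.fst π t = Spec.map (CommRingCat.ofHom (Ideal.Quotient.mk _)) ≫ f ∧
      g ≫ pullback.snd π t = Spec.map (CommRingCat.ofHom (algebraMap k _)) ∧
      ∀ p, pullback.fst π t p ∈ Set.range f → p ∈ Set.range g := by
  subst ht
  set I := Ideal.span {algebraMap A B τ}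
  have hker (a : A) : Ideal.Quotient.mk I (algebraMap A B a) = algebraMap k (B ⧸ I) (ε a) := by
    have h1 : a - algebraMap k A (ε a) ∈ RingHom.ker ε := by
      rw [RingHom.mem_ker, map_sub, AlgHom.commutes]
      exact sub_self _
    rw [hτ, Ideal.mem_span_singleton] at h1
    obtain ⟨c, hc⟩ := h1
    have h2 : algebraMap A B a - algebraMap k B (ε a) ∈ I := by
      rw [IsScalarTower.algebraMap_apply k A B, ← map_sub, hc, map_mul]
      exact Ideal.mul_mem_right _ _ (Ideal.mem_span_singleton_self _)
    rw [← sub_eq_zero]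
    exact Ideal.Quotient.eq_zero_iff_mem.mpr h2
  -- Every element of `A` differs from a constant by a multiple of `τ`, so base change of `B` along
  -- `ε` is the quotient by `τ`.
  have hpush : IsPushout (CommRingCat.ofHom (algebraMap A B)) (CommRingCat.ofHom ε.toRingHom)
      (CommRingCat.ofHom (Ideal.Quotient.mk I)) (CommRingCat.ofHom (algebraMap k (B ⧸ I))) := by
    refine ⟨⟨CommRingCat.hom_ext (RingHom.ext hker)⟩, ⟨PushoutCocone.IsColimit.mk _ ?_ ?_ ?_ ?_⟩⟩
    · intro s
      refine CommRingCat.ofHom (Ideal.Quotient.lift I s.inl.hom ?_)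
      intro b hb
      have h0 : s.inl.hom (algebraMap A B τ) = 0 := by
        have h1 : s.inl.hom (algebraMap A B τ) = s.inr.hom (ε τ) :=
          congrArg (fun m => m.hom τ) s.condition
        have h2 : ε τ = 0 := by
          rw [← RingHom.mem_ker, hτ]
          exact Ideal.mem_span_singleton_self _
        rw [h1, h2, map_zero]
      obtain ⟨c, rfl⟩ := Ideal.mem_span_singleton.mp hb
      rw [map_mul, h0, zero_mul]
    · intro s
      ext b
      rfl
    · intro s
      ext r
      have h1 : s.inl.hom (algebraMap A B (algebraMap k A r)) = s.inr.hom (ε (algebraMap k A r)) :=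
        congrArg (fun m => m.hom (algebraMap k A r)) s.condition
      rw [AlgHom.commutes, ← IsScalarTower.algebraMap_apply] at h1
      exact h1
    · intro s m h1 h2
      refine CommRingCat.hom_ext (Ideal.Quotient.ringHom_ext ?_)
      exact congrArg CommRingCat.Hom.hom h1
  have hpull := isPullback_SpecMap_of_isPushout _ _ _ _ hpush
  let g := pullback.lift (f := π) (g := Spec.map (CommRingCat.ofHom ε.toRingHom))
    (Spec.map (CommRingCat.ofHom (Ideal.Quotient.mk I)) ≫ f)
    (Spec.map (CommRingCat.ofHom (algebraMap k (B ⧸ I)))) (by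
      rw [Category.assoc, hf]
      exact hpull.w)
  have hg1 : g ≫ pullback.fst _ _ = Spec.map (CommRingCat.ofHom (Ideal.Quotient.mk I)) ≫ f :=
    pullback.lift_fst _ _ _
  have hg2 : g ≫ pullback.snd _ _ = Spec.map (CommRingCat.ofHom (algebraMap k (B ⧸ I))) :=
    pullback.lift_snd _ _ _
  -- The chart of the fibre is the base change of `f` along the inclusion of the fibre. This gives
  -- both that it is an open immersion and what its range is.
  have hleft : IsPullback (Spec.map (CommRingCat.ofHom (Ideal.Quotient.mk I))) g f
      (pullback.fst π (Spec.map (CommRingCat.ofHom ε.toRingHom))) := by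
    refine IsPullback.of_bot ?_ hg1.symm (IsPullback.of_hasPullback _ _)
    rw [hg2, hf]
    exact hpull
  refine ⟨g, ?_, hg1, hg2, ?_⟩
  · exact MorphismProperty.of_isPullback hleft ‹IsOpenImmersion f›
  · rintro p ⟨q, hq⟩
    obtain ⟨z, hz1, hz2⟩ := Scheme.Pullback.exists_preimage_pullback q p hq
    refine ⟨hleft.isoPullback.inv z, ?_⟩
    rw [← Scheme.Hom.comp_apply, hleft.isoPullback_inv_snd, hz2]

end FibreChart

/-! ### Normal crossings -/

section NormalCrossings

open IsLocalRing

/-- The ideal is generated by a product of members of a regular system of parameters. -/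
def IsSNCIdeal {R : Type*} [CommRing R] [IsLocalRing R] (I : Ideal R) : Prop :=
  IsRegularLocalRing R ∧ ∃ (m r : ℕ) (x : Fin m → R), ringKrullDim R = m ∧
    Ideal.span (Set.range x) = maximalIdeal R ∧ 1 ≤ r ∧ r ≤ m ∧
    I = Ideal.span {∏ i ∈ Finset.univ.filter (fun i : Fin m => i.1 < r), x i}

lemma IsSNCIdeal.comap {R S : Type*} [CommRing R] [IsLocalRing R] [CommRing S] [IsLocalRing S]
    {J : Ideal S} (hJ : IsSNCIdeal J) (e : R ≃+* S) : IsSNCIdeal (J.comap e) := by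
  obtain ⟨h, m, r, x, h1, h2, h3, h4, h5⟩ := hJ
  have hsys : IsRegularSystem x := ⟨h2, by simpa using h1⟩
  have hsys' := hsys.map_ringEquiv e.symm
  have : IsNoetherianRing R := isNoetherianRing_of_ringEquiv S e.symm
  refine ⟨hsys'.isRegularLocalRing, m, r, e.symm ∘ x, by simpa using hsys'.dim_eq, hsys'.span_eq,
    h3, h4, ?_⟩
  rw [h5, ← Ideal.map_symm, Ideal.map_span, Set.image_singleton, map_prod]
  rfl

lemma IsSNCIdeal.isRadical {R : Type*} [CommRing R] [IsLocalRing R] {I : Ideal R}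
    (hI : IsSNCIdeal I) : I.IsRadical := by
  obtain ⟨h, m, r, x, h1, h2, h3, h4, h5⟩ := hI
  have hsys : IsRegularSystem x := ⟨h2, by simpa using h1⟩
  rw [h5]
  rintro y ⟨N, hy⟩
  rw [Ideal.mem_span_singleton] at hy ⊢
  exact hsys.prod_dvd _ hy

/-- A product of vanishing coordinates that belong to a regular system of parameters. -/
lemma IsRegularSystem.isSNCIdeal {R : Type*} [CommRing R] [IsLocalRing R] [IsNoetherianRing R]
    {β : Type*} [Fintype β] [Nonempty β] {M : ℕ} {y : β → R} {z : Fin M → R}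
    (h : IsRegularSystem (Sum.elim y z)) : IsSNCIdeal (Ideal.span {∏ b, y b}) := by
  let c := Fintype.card β
  let E : Fin (c + M) ≃ β ⊕ Fin M :=
    finSumFinEquiv.symm.trans (Equiv.sumCongr (Fintype.equivFin β).symm (Equiv.refl _))
  have h' := h.comp_equiv E
  refine ⟨h.isRegularLocalRing, c + M, c, Sum.elim y z ∘ E, by simpa using h'.dim_eq, h'.span_eq,
    Fintype.card_pos, Nat.le_add_right _ _, ?_⟩
  congr 2
  rw [Finset.prod_filter, Fin.prod_univ_add]
  simp [E, c]
  exact (Equiv.prod_comp (Fintype.equivFin β).symm y).symm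

lemma IsSNCDivisor.isReduced {D X : Scheme.{u}} {ι : D ⟶ X} (h : IsSNCDivisor ι) :
    IsReduced D := by
  have := h.1
  refine @isReduced_of_isReduced_stalk D fun p => ?_
  have hrad : (RingHom.ker (ι.stalkMap p).hom).IsRadical := IsSNCIdeal.isRadical (h.2 p)
  have hsurj : Function.Surjective (ι.stalkMap p).hom := ι.stalkMap_surjective p
  have e := RingHom.quotientKerEquivOfSurjective hsurj
  have := (Ideal.isRadical_iff_quotient_reduced _).mp hrad
  exact isReduced_of_injective e.symm e.symm.injective

/-- A closed subscheme that is cut out by one equation in each of a family of open affine subschemes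
is a simple normal crossing divisor if it is one in the local rings of these. -/
theorem isSNCDivisor_of_charts {D X : Scheme.{u}} (ι : D ⟶ X) [IsClosedImmersion ι] {α : Type*}
    (B : α → Type u) [∀ i, CommRing (B i)] (τ : ∀ i, B i) (f : ∀ i, Spec (.of (B i)) ⟶ X)
    [∀ i, IsOpenImmersion (f i)] (g : ∀ i, Spec (.of (B i ⧸ Ideal.span {τ i})) ⟶ D)
    [∀ i, IsOpenImmersion (g i)]
    (hgf : ∀ i, g i ≫ ι = Spec.map (CommRingCat.ofHom (Ideal.Quotient.mk _)) ≫ f i)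
    (hcov : ∀ p, ∃ i, p ∈ Set.range (g i))
    (h : ∀ i (q : Ideal (B i)) [q.IsPrime] (R : Type u) [CommRing R] [IsLocalRing R]
      [Algebra (B i) R] [IsLocalization.AtPrime R q], τ i ∈ q →
      IsSNCIdeal (Ideal.span {algebraMap (B i) R (τ i)})) : IsSNCDivisor ι := by
  refine ⟨‹_›, fun p => ?_⟩
  obtain ⟨i, q', rfl⟩ := hcov p
  let mk : CommRingCat.of (B i) ⟶ CommRingCat.of (B i ⧸ Ideal.span {τ i}) :=
    CommRingCat.ofHom (Ideal.Quotient.mk _)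
  let q : Spec (.of (B i)) := Spec.map mk q'
  have hqp : q.asIdeal.IsPrime := PrimeSpectrum.isPrime q
  have hqp' : q'.asIdeal.IsPrime := PrimeSpectrum.isPrime q'
  let R := (Spec (.of (B i))).presheaf.stalk q
  let R' := (Spec (.of (B i ⧸ Ideal.span {τ i}))).presheaf.stalk q'
  let _ : Algebra (B i) R := StructureSheaf.stalkAlgebra (B i) q
  have hR : IsLocalization.AtPrime R q.asIdeal := StructureSheaf.IsLocalization.to_stalk (B i) q
  let _ : Algebra (B i ⧸ Ideal.span {τ i}) R' := StructureSheaf.stalkAlgebra _ q'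
  have hR' : IsLocalization.AtPrime R' q'.asIdeal := StructureSheaf.IsLocalization.to_stalk _ q'
  have hq : τ i ∈ q.asIdeal := by
    change Ideal.Quotient.mk _ (τ i) ∈ q'.asIdeal
    rw [Ideal.Quotient.eq_zero_iff_mem.mpr (Ideal.mem_span_singleton_self _)]
    exact zero_mem _
  have hsnc := h i q.asIdeal R hq
  -- Localization commutes with the quotient, so the kernel on stalks is still generated by `τ i`.
  have hmk : RingHom.ker ((Spec.map mk).stalkMap q').hom =
      Ideal.span {algebraMap (B i) R (τ i)} := by
    have hM : Submonoid.map mk.hom q.asIdeal.primeCompl = q'.asIdeal.primeCompl := by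
      ext s
      constructor
      · rintro ⟨p, hp, rfl⟩
        exact hp
      · intro hs
        obtain ⟨p, rfl⟩ := Ideal.Quotient.mk_surjective s
        exact ⟨p, hs, rfl⟩
    have h1 : ((Spec.map mk).stalkMap q').hom =
        IsLocalization.map R' mk.hom (hM.symm ▸ q.asIdeal.primeCompl.le_comap_map) := by
      refine (IsLocalization.map_unique _ _ fun x => ?_).symm
      exact stalkMap_toStalk_apply mk q' x
    rw [h1, IsLocalization.ker_map R' mk.hom hM]
    change (RingHom.ker (Ideal.Quotient.mk _)).map _ = _
    rw [Ideal.mk_ker, Ideal.map_span, Set.image_singleton]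
  have hpt : ι (g i q') = f i q := congrArg (fun m => m q') (hgf i)
  let E : X.presheaf.stalk (ι (g i q')) ≅ R :=
    X.presheaf.stalkCongr (.of_eq hpt) ≪≫ asIso ((f i).stalkMap q)
  have hE : ι.stalkMap (g i q') ≫ (g i).stalkMap q' = E.hom ≫ (Spec.map mk).stalkMap q' := by
    rw [← Scheme.Hom.stalkMap_comp, Scheme.Hom.stalkMap_congr_hom _ _ (hgf i),
      Scheme.Hom.stalkMap_comp]
    rfl
  have hker : RingHom.ker (ι.stalkMap (g i q')).hom =
      (Ideal.span {algebraMap (B i) R (τ i)}).comap E.commRingCatIsoToRingEquiv := by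
    -- The stalk maps of the two open immersions are isomorphisms, so the kernel for `ι` is the one
    -- computed on the affine chart.
    rw [← hmk]
    ext s
    have h2 : (g i).stalkMap q' (ι.stalkMap (g i q') s) = (Spec.map mk).stalkMap q' (E.hom s) :=
      congrArg (fun m => m.hom s) hE
    have hinj : Function.Injective ((g i).stalkMap q') :=
      (ConcreteCategory.bijective_of_isIso ((g i).stalkMap q')).1
    rw [RingHom.mem_ker, Ideal.mem_comap, RingHom.mem_ker]
    change ι.stalkMap (g i q') s = 0 ↔ (Spec.map mk).stalkMap q' (E.hom s) = 0
    rw [← h2]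
    exact (map_eq_zero_iff ((g i).stalkMap q').hom hinj).symm
  have := hsnc.comap E.commRingCatIsoToRingEquiv
  rw [← hker] at this
  exact this

end NormalCrossings

/-! ### Properties of the charts -/

noncomputable section ChartProperties

open MvPolynomial

variable {k A K : Type u} [Field k] [CommRing A] [Field K] [Algebra k A] [Algebra k K]
  [Algebra A K] [IsScalarTower k A K] {N e : ℕ}

namespace IsGeneralPoint

variable {x : Fin N → K} {T W : A} (a j : Fin N)

lemma locally_isStandardSmooth [CharZero k] (h : IsGeneralPoint k e x T W) (hj : j.1 < e + 1) :
    RingHom.Locally (RingHom.IsStandardSmoothOfRelativeDimension (N - 1))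
      (algebraMap k (ratioAlgebra A (monom e x (algebraMap A K T)) (vertex e a j.1))) := by
  refine locally_isStandardSmooth_of_jacobian (h.chartHom a j hj) (h.chartHom_surjective a j hj)
    (chartRel k (e + 1) a j) (h.ker_chartHom a j hj) ?_ ?_
  -- There are `N + 3` variables and four relations; `j.2` excludes `N = 0`.
  · have := j.2
    simp only [Fintype.card_sum, Fintype.card_fin]
    omega
  · intro κ _ ev c hc
    refine (chartRel_jacobian (Nat.succ_ne_zero e) (ev.comp (h.chartHom a j hj).toRingHom)
      (a := a) (j := j) ?_ (β := Empty) (y := nofun) (fun b => b.elim) (fun b => b.elim)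
      (fun b => b.elim) c nofun ?_).1
    · intro i
      have : h.chartHom a j hj (chartRel k (e + 1) a j i) = 0 := by
        rw [← RingHom.mem_ker, h.ker_chartHom a j hj]
        exact Ideal.subset_span ⟨i, rfl⟩
      change ev (h.chartHom a j hj _) = 0
      rw [this, map_zero]
    · intro s
      rw [Finset.univ_eq_empty (α := Empty), Finset.sum_empty, add_zero]
      exact hc s

/-- The parameter is `v ∏_{i<j} xᵢ`, a product of coordinates other than `x j`. Those that vanish at
`q` belong to a regular system of parameters, and the others are units. -/
lemma isSNCIdeal [CharZero k] (h : IsGeneralPoint k e x T W) (hj : j.1 < e + 1)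
    (q : Ideal (ratioAlgebra A (monom e x (algebraMap A K T)) (vertex e a j.1))) [q.IsPrime]
    (R : Type*) [CommRing R] [IsLocalRing R]
    [Algebra (ratioAlgebra A (monom e x (algebraMap A K T)) (vertex e a j.1)) R]
    [IsLocalization.AtPrime R q] (hq : algebraMap A _ T ∈ q) :
    IsSNCIdeal (Ideal.span {algebraMap
      (ratioAlgebra A (monom e x (algebraMap A K T)) (vertex e a j.1)) R (algebraMap A _ T)}) := by
  classical
  set φ := h.chartHom a j hj with hφ
  let s : Finset (ChartVar N) := insert (.inr 1) ((Finset.Iio j).image .inl)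
  have hprod : algebraMap A _ T = ∏ i ∈ s, φ (X i) := by
    rw [Finset.prod_insert (by simp), Finset.prod_image (Sum.inl_injective.injOn),
      h.algebraMap_param a j hj, map_mul, lowProd, map_prod]
  let β := {i : ChartVar N // i ∈ s ∧ φ (X i) ∈ q}
  have hβ : Nonempty β := by
    rw [hprod] at hq
    obtain ⟨i, hi, hi'⟩ := (Ideal.IsPrime.prod_mem_iff (s := s)).mp hq
    exact ⟨i, hi, hi'⟩
  obtain ⟨hR, M, z, hz⟩ := chart_exists_isRegularSystem (Nat.succ_ne_zero e) φ.toRingHom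
    (h.chartHom_surjective a j hj) (h.ker_chartHom a j hj) q (β := β) Subtype.val_injective
    (fun b => b.2.2) (fun b hb => by
      have := b.2.1
      rw [hb] at this
      simp [s] at this) R
  have h1 := hz.isSNCIdeal
  convert h1 using 1
  have := hz.isRegularLocalRing
  have := IsRegularLocalRing.isDomain R
  rw [Ideal.span_singleton_eq_span_singleton, hprod, map_prod]
  have h2 := Finset.prod_filter_mul_prod_filter_not s (fun i => φ (X i) ∈ q)
    (fun i => algebraMap (ratioAlgebra A (monom e x (algebraMap A K T)) (vertex e a j.1)) R (φ (X i)))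
  rw [← h2]
  have h3 : ∏ i ∈ s.filter (fun i => φ (X i) ∈ q), algebraMap
      (ratioAlgebra A (monom e x (algebraMap A K T)) (vertex e a j.1)) R (φ (X i)) =
      ∏ b : β, algebraMap _ R (φ.toRingHom (X b.1)) := by
    refine Finset.prod_subtype (p := fun i => i ∈ s ∧ φ (X i) ∈ q) _ (fun i => ?_) _
    rw [Finset.mem_filter]
  rw [h3]
  refine (associated_mul_unit_right _ _ ?_).symm
  rw [IsUnit.prod_iff]
  intro i hi
  rw [Finset.mem_filter] at hi
  exact IsLocalization.map_units R (M := q.primeCompl) ⟨_, hi.2⟩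

/-- The chart factors of the vertex `(b, j)` are `1` or powers of `x b`, so the ratio is a power of
`x b` with positive exponent. -/
lemma ratio_mem_iff (h : IsGeneralPoint k e x T W) (hj : j.1 < e + 1) (b : Fin N)
    (q : Ideal (ratioAlgebra A (monom e x (algebraMap A K T)) (vertex e a j.1))) [q.IsPrime] :
    ratio A (monom e x (algebraMap A K T)) (vertex e a j.1) (vertex e b j.1) ∈ q ↔
      h.chartHom a j hj (X (.inl b)) ∈ q := by
  rw [h.ratio_eq a j hj, map_mul]
  refine ⟨fun hq => ?_, fun hq => Ideal.mul_mem_right _ _ hq⟩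
  rcases Ideal.IsPrime.mem_or_mem ‹_› hq with hq | hq
  · exact hq
  · rw [map_prod, Ideal.IsPrime.prod_mem_iff] at hq
    obtain ⟨i, -, hi⟩ := hq
    by_cases hij : i.1 < j.1
    · have : (vertex e b j.1).2 i = none := if_pos (by simpa using hij)
      simp only [this, chartFactor, if_pos hij, map_one] at hi
      exact absurd ((Ideal.eq_top_iff_one _).mpr hi) (Ideal.IsPrime.ne_top ‹_›)
    · have : (vertex e b j.1).2 i = some b := if_neg (by simpa using hij)
      simp only [this, chartFactor, if_neg hij, mul_one, map_pow] at hi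
      exact Ideal.IsPrime.mem_of_pow_mem ‹_› _ hi

lemma chartHom_X_self (h : IsGeneralPoint k e x T W) (hj : j.1 < e + 1) :
    h.chartHom a j hj (X (.inl a)) = 1 := by
  refine Subtype.ext ?_
  rw [coe_chartHom, chartEval_inl, div_self (h.ne_zero a)]
  rfl

/-- The part of a chart that is not in the charts which come earlier in the order. -/
lemma forall_ratio_mem_iff (h : IsGeneralPoint k e x T W) (hj : j.1 < e + 1)
    (q : Ideal (ratioAlgebra A (monom e x (algebraMap A K T)) (vertex e a j.1))) [q.IsPrime] :
    (∀ b l : Fin N, l.1 < e + 1 → (b < a ∨ b = a ∧ j < l) →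
      ratio A (monom e x (algebraMap A K T)) (vertex e a j.1) (vertex e b l.1) ∈ q) ↔
      (∀ b < a, h.chartHom a j hj (X (.inl b)) ∈ q) ∧
        (j.1 < e → h.chartHom a j hj (X (.inr 0)) ∈ q) := by
  constructor
  · refine fun hq => ⟨fun b hb => (h.ratio_mem_iff a j hj b q).mp (hq b j hj (.inl hb)),
      fun hje => ?_⟩
    -- The vertices `(a, j)` and `(a, j + 1)` differ only at place `j`, where the factor is `u`; so
    -- the ratio is `u` up to powers of `x a = 1`.
    have h1 := hq a ⟨j.1 + 1, by have := h.lt; omega⟩ (by simpa using hje)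
      (.inr ⟨rfl, by simp [Fin.lt_def]⟩)
    rw [h.ratio_eq a j hj, map_mul] at h1
    have h2 := Ideal.IsPrime.mem_or_mem ‹_› h1
    change h.chartHom a j hj (X (.inl a)) ∈ q ∨ _ at h2
    rw [h.chartHom_X_self, ← Ideal.eq_top_iff_one, or_iff_right (Ideal.IsPrime.ne_top ‹_›),
      map_prod, Ideal.IsPrime.prod_mem_iff] at h2
    obtain ⟨i, -, hi⟩ := h2
    have hone : (1 : ratioAlgebra A (monom e x (algebraMap A K T)) (vertex e a j.1)) ∉ q :=
      fun h1 => Ideal.IsPrime.ne_top ‹_› ((Ideal.eq_top_iff_one _).mpr h1)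
    by_cases hij : i.1 < j.1 + 1
    · have hv : (vertex e a (j.1 + 1)).2 i = none := if_pos (by simpa using hij)
      simp only [hv, chartFactor] at hi
      split_ifs at hi with hij'
      · rw [map_one] at hi
        exact absurd hi hone
      · have h1 : midProd (i.1 + 1) j (fun l => (X (.inl l) : MvPolynomial (ChartVar N) k)) =
            1 := by
          refine Finset.prod_eq_one fun i hi => ?_
          simp only [Finset.mem_filter, Fin.lt_def] at hi
          omega
        rwa [h1, mul_one] at hi
    · have hv : (vertex e a (j.1 + 1)).2 i = some a := if_neg (by simpa using hij)
      simp only [hv, chartFactor, if_neg (by omega : ¬ i.1 < j.1), mul_one, map_pow,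
        h.chartHom_X_self, one_pow] at hi
      exact absurd hi hone
  · rintro ⟨hx, hu⟩ b l hl (hb | ⟨rfl, hjl⟩)
    · rw [h.ratio_eq a j hj, map_mul]
      exact Ideal.mul_mem_right _ _ (hx b hb)
    · rw [h.ratio_eq b j hj, map_mul, map_prod]
      rw [Fin.lt_def] at hjl
      -- For every `l > j` the factor at place `j` is a multiple of `u`.
      refine Ideal.mul_mem_left _ _ (Ideal.IsPrime.prod_mem_iff.mpr
        ⟨⟨j.1, by omega⟩, Finset.mem_univ _, ?_⟩)
      have : (vertex e b l.1).2 ⟨j.1, by omega⟩ = none := if_pos (by simpa using hjl)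
      simp only [this, chartFactor, lt_irrefl, if_false, map_mul]
      exact Ideal.mul_mem_right _ _ (hu (by omega))

/-- The ratio is a product of factors `v ∏_{i<l<j} x_l`, up to powers of `x a = 1`. Each of them
divides the parameter `v ∏_{l<j} x_l`, which does not vanish. -/
lemma ratio_zero_notMem (h : IsGeneralPoint k e x T W) (hj : j.1 < e + 1)
    (q : Ideal (ratioAlgebra A (monom e x (algebraMap A K T)) (vertex e a j.1))) [q.IsPrime]
    (hq : algebraMap A _ T ∉ q) :
    ratio A (monom e x (algebraMap A K T)) (vertex e a j.1) (vertex e a 0) ∉ q := by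
  rw [h.ratio_eq a j hj, map_mul]
  intro hmem
  have h1 := Ideal.IsPrime.mem_or_mem ‹_› hmem
  change h.chartHom a j hj (X (.inl a)) ∈ q ∨ _ at h1
  rw [h.chartHom_X_self, ← Ideal.eq_top_iff_one, or_iff_right (Ideal.IsPrime.ne_top ‹_›), map_prod,
    Ideal.IsPrime.prod_mem_iff] at h1
  obtain ⟨i, -, hi⟩ := h1
  have : (vertex e a 0).2 i = some a := by simp [vertex, word]
  simp only [this, chartFactor, map_mul, map_pow, h.chartHom_X_self, one_pow, one_mul] at hi
  split_ifs at hi with hij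
  · rw [map_mul] at hi
    apply hq
    rw [h.algebraMap_param a j hj, map_mul]
    rcases Ideal.IsPrime.mem_or_mem ‹_› hi with hi | hi
    · exact Ideal.mul_mem_right _ _ hi
    · refine Ideal.mul_mem_left _ _ ?_
      rw [midProd, map_prod, Ideal.IsPrime.prod_mem_iff] at hi
      obtain ⟨l, hl, hl'⟩ := hi
      rw [lowProd, map_prod, Ideal.IsPrime.prod_mem_iff]
      refine ⟨l, ?_, hl'⟩
      simp only [Finset.mem_filter] at hl
      exact Finset.mem_Iio.mpr (Fin.lt_def.mpr hl.2.2)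
  · rw [map_one] at hi
    exact Ideal.IsPrime.ne_top ‹_› ((Ideal.eq_top_iff_one _).mpr hi)

end IsGeneralPoint

end ChartProperties

/-! ### Morphisms to projective space, and hypersurfaces -/

noncomputable section ProjectiveMaps

open MvPolynomial HomogeneousLocalization


variable {k : Type u} [Field k] {N : ℕ}

local notation "𝒢" => homogeneousSubmodule (Fin (N + 1)) k

/-- The homomorphism from the ring of the chart `D₊(f)` of projective space that is induced by a
homomorphism of the homogeneous coordinate ring. -/
def awayLift {S : Type*} [CommRing S] (θ : MvPolynomial (Fin (N + 1)) k →+* S)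
    (f : MvPolynomial (Fin (N + 1)) k) (hf : IsUnit (θ f)) : Away 𝒢 f →+* S :=
  (IsLocalization.Away.lift (S := Localization.Away f) f hf).comp
    (algebraMap (Away 𝒢 f) (Localization.Away f))

lemma awayLift_mk_mul {S : Type*} [CommRing S] (θ : MvPolynomial (Fin (N + 1)) k →+* S)
    {f : MvPolynomial (Fin (N + 1)) k} (hf : IsUnit (θ f)) {m : ℕ} (hfm : f ∈ 𝒢 m) (n : ℕ)
    (p : MvPolynomial (Fin (N + 1)) k) (hp : p ∈ 𝒢 (n • m)) :
    awayLift θ f hf (Away.mk 𝒢 hfm n p hp) * θ f ^ n = θ p := by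
  have h1 : awayLift θ f hf (Away.mk 𝒢 hfm n p hp) =
      IsLocalization.Away.lift (S := Localization.Away f) f hf
        (Localization.mk p ⟨f ^ n, n, rfl⟩) := rfl
  rw [h1, ← map_pow, ← IsLocalization.Away.lift_eq (S := Localization.Away f) f hf (f ^ n),
    ← map_mul, ← IsLocalization.Away.lift_eq (S := Localization.Away f) f hf p]
  congr 1
  rw [Localization.mk_eq_mk']
  exact IsLocalization.mk'_spec (M := Submonoid.powers f) (Localization.Away f) p
    ⟨f ^ n, n, rfl⟩

lemma awayLift_mk {S : Type*} [CommRing S] (θ : MvPolynomial (Fin (N + 1)) k →+* S)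
    {f : MvPolynomial (Fin (N + 1)) k} (hf : θ f = 1) {m : ℕ} (hfm : f ∈ 𝒢 m) (n : ℕ)
    (p : MvPolynomial (Fin (N + 1)) k) (hp : p ∈ 𝒢 (n • m)) :
    awayLift θ f (hf ▸ isUnit_one) (Away.mk 𝒢 hfm n p hp) = θ p := by
  have h := awayLift_mk_mul θ (hf ▸ isUnit_one) hfm n p hp
  have e : θ f ^ n = 1 := by rw [hf, one_pow]
  rwa [e, mul_one] at h

/-- Homomorphisms that differ by a unit induce the same homomorphism. -/
lemma comp_awayLift {S S' : Type*} [CommRing S] [CommRing S']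
    (θ : MvPolynomial (Fin (N + 1)) k →+* S) (θ' : MvPolynomial (Fin (N + 1)) k →+* S')
    (ψ : S →+* S') {f : MvPolynomial (Fin (N + 1)) k} {m : ℕ} (hfm : f ∈ 𝒢 m) (hf : IsUnit (θ f))
    (hf' : IsUnit (θ' f)) (c : S') (hc : ∀ (n : ℕ) (p) (_ : p ∈ 𝒢 n), c ^ n * ψ (θ p) = θ' p) :
    ψ.comp (awayLift θ f hf) = awayLift θ' f hf' := by
  ext z
  obtain ⟨n, p, hp, rfl⟩ := Away.mk_surjective 𝒢 hfm z
  refine (hf'.pow n).mul_left_injective ?_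
  dsimp only [RingHom.comp_apply]
  rw [awayLift_mk_mul, ← hc m f hfm, ← hc _ p hp, mul_pow, ← map_pow, ← pow_mul, smul_eq_mul,
    mul_comm m n, mul_left_comm, ← map_mul, awayLift_mk_mul]

lemma awayLift_comp_awayMap {S : Type*} [CommRing S] (θ : MvPolynomial (Fin (N + 1)) k →+* S)
    {f g x : MvPolynomial (Fin (N + 1)) k} {m m' : ℕ} (hfm : f ∈ 𝒢 m) (hgm : g ∈ 𝒢 m')
    (hx : x = f * g) (hf : IsUnit (θ f)) (hxu : IsUnit (θ x)) :
    (awayLift θ x hxu).comp (awayMap 𝒢 hgm hx) = awayLift θ f hf := by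
  ext z
  obtain ⟨n, p, hp, rfl⟩ := Away.mk_surjective 𝒢 hfm z
  have hg : IsUnit (θ g) := by
    rw [hx, map_mul] at hxu
    exact isUnit_of_mul_isUnit_right hxu
  refine (hxu.pow n).mul_left_injective ?_
  dsimp only [RingHom.comp_apply]
  rw [awayMap_mk 𝒢 hgm hx n hfm p hp, awayLift_mk_mul, hx]
  simp only [map_mul, map_pow, mul_pow]
  rw [← mul_assoc, awayLift_mk_mul]

/-- The morphism to the chart `D₊(f)` of projective space that is given by a homomorphism of the
homogeneous coordinate ring. -/
def toProj {S : Type u} [CommRing S] (θ : MvPolynomial (Fin (N + 1)) k →+* S)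
    (f : MvPolynomial (Fin (N + 1)) k) {m : ℕ} (hfm : f ∈ 𝒢 m) (hm : 0 < m) (hf : IsUnit (θ f)) :
    Spec (.of S) ⟶ projSpace k N :=
  Spec.map (CommRingCat.ofHom (awayLift θ f hf)) ≫ Proj.awayι 𝒢 f hfm hm

/-- Both morphisms factor through the chart of the product `f * g`. -/
lemma toProj_eq_toProj {S : Type u} [CommRing S] (θ : MvPolynomial (Fin (N + 1)) k →+* S)
    (f g : MvPolynomial (Fin (N + 1)) k) {m m' : ℕ} (hfm : f ∈ 𝒢 m) (hm : 0 < m)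
    (hf : IsUnit (θ f)) (hgm : g ∈ 𝒢 m') (hm' : 0 < m') (hg : IsUnit (θ g)) :
    toProj θ f hfm hm hf = toProj θ g hgm hm' hg := by
  have hfg : IsUnit (θ (f * g)) := by
    rw [map_mul]
    exact hf.mul hg
  have key (f g x : MvPolynomial (Fin (N + 1)) k) {m m' : ℕ} (hfm : f ∈ 𝒢 m) (hm : 0 < m)
      (hgm : g ∈ 𝒢 m') (hf : IsUnit (θ f)) (hx : x = f * g) (hxu : IsUnit (θ x)) (r : ℕ)
      (hrm : r = m + m') (hxr : x ∈ 𝒢 r) (hr : 0 < r) :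
      toProj θ f hfm hm hf = toProj θ x hxr hr hxu := by
    subst hrm
    rw [toProj, toProj, ← awayLift_comp_awayMap θ hfm hgm hx hf hxu, CommRingCat.ofHom_comp,
      Spec.map_comp, Category.assoc, Proj.SpecMap_awayMap_awayι]
  rw [key f g (f * g) hfm hm hgm hf rfl hfg _ rfl (SetLike.mul_mem_graded hfm hgm) (by omega),
    key g f (f * g) hgm hm' hfm hg (mul_comm _ _) hfg _ (add_comm _ _)
      (SetLike.mul_mem_graded hfm hgm) (by omega)]

lemma appLE_comp_appTop {X Y Z : Scheme.{u}} (f : X ⟶ Y) (g : Y ⟶ Z) (p : X ⟶ Z) (hp : f ≫ g = p)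
    (U : Z.Opens) (h : ⊤ ≤ g ⁻¹ᵁ U) (h' : ⊤ ≤ p ⁻¹ᵁ U) :
    g.appLE U ⊤ h ≫ f.appTop = p.appLE U ⊤ h' := by
  subst hp
  have e₀ : (⊤ : X.Opens) ≤ f ⁻¹ᵁ ⊤ := fun _ _ ↦ trivial
  have e : f.appTop = f.appLE ⊤ ⊤ e₀ := Scheme.Hom.app_eq_appLE f
  rw [e, Scheme.Hom.appLE_comp_appLE]

/-- Translates sections on `D₊(f)` into elements of the homogeneous localization; the ideals in
`IsZeroScheme` are stated in terms of sections. -/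
lemma awayToSection_appLE (f : MvPolynomial (Fin (N + 1)) k) {m : ℕ} (hfm : f ∈ 𝒢 m) (hm : 0 < m)
    (h : ⊤ ≤ Proj.awayι 𝒢 f hfm hm ⁻¹ᵁ Proj.basicOpen 𝒢 f) :
    Proj.awayToSection 𝒢 f ≫ (Proj.awayι 𝒢 f hfm hm).appLE (Proj.basicOpen 𝒢 f) ⊤ h =
      (Scheme.ΓSpecIso _).inv := by
  have h1 : (Proj.basicOpenIsoSpec 𝒢 f hfm hm).hom ≫ Proj.awayι 𝒢 f hfm hm =
      (Proj.basicOpen 𝒢 f).ι := by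
    rw [← Proj.basicOpenIsoSpec_inv_ι, Iso.hom_inv_id_assoc]
  have h2 : (Proj.awayι 𝒢 f hfm hm).appLE (Proj.basicOpen 𝒢 f) ⊤ h ≫
      (Proj.basicOpenIsoSpec 𝒢 f hfm hm).hom.appTop =
      (Proj.basicOpen 𝒢 f).ι.appLE (Proj.basicOpen 𝒢 f) ⊤ (by simp) := by
    exact appLE_comp_appTop _ _ _ h1 _ _ _
  have h3 : (Proj.basicOpen 𝒢 f).ι.appLE (Proj.basicOpen 𝒢 f) ⊤ (by simp) =
      (Proj.basicOpen 𝒢 f).topIso.inv := by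
    rw [Scheme.Opens.ι_appLE, Scheme.Opens.topIso_inv]
    rfl
  have h4 : (Proj.basicOpenIsoSpec 𝒢 f hfm hm).hom.appTop =
      (Scheme.ΓSpecIso _).hom ≫ Proj.awayToSection 𝒢 f ≫ (Proj.basicOpen 𝒢 f).topIso.inv := by
    exact Proj.basicOpenToSpec_app_top 𝒢 f
  have : IsIso (Proj.awayToSection 𝒢 f) :=
    inferInstanceAs (IsIso (Proj.basicOpenIsoAway 𝒢 f hfm hm).hom)
  rw [h4, h3] at h2
  rw [← cancel_mono ((Scheme.ΓSpecIso _).hom ≫ Proj.awayToSection 𝒢 f ≫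
    (Proj.basicOpen 𝒢 f).topIso.inv), Category.assoc, h2, Iso.inv_hom_id_assoc]

end ProjectiveMaps

/-! ### Recognizing a zero scheme on the standard charts -/

noncomputable section ZeroScheme

open MvPolynomial HomogeneousLocalization

variable {k : Type u} [Field k] {N : ℕ}

local notation "𝒢" => homogeneousSubmodule (Fin (N + 1)) k

variable (k) in
lemma X_mem (i : Fin (N + 1)) : (X i : MvPolynomial (Fin (N + 1)) k) ∈ 𝒢 1 :=
  isHomogeneous_X k i

lemma isIso_appLE_top {X Y : Scheme.{u}} (g : X ⟶ Y) [IsOpenImmersion g] (V : Y.Opens)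
    (h : V = g.opensRange) (e : ⊤ ≤ g ⁻¹ᵁ V) : IsIso (g.appLE V ⊤ e) := by
  have h' : V = g ''ᵁ ⊤ := by rw [h, Scheme.Hom.image_top_eq_opensRange]
  subst h'
  rw [← Scheme.Hom.appIso_hom']
  infer_instance

lemma iSup_basicOpen_X :
    ⨆ i : Fin (N + 1), Proj.basicOpen 𝒢 (X i) = ⊤ := by
  refine Proj.iSup_basicOpen_eq_top' 𝒢 _ (fun i ↦ ⟨1, X_mem k i⟩) ?_
  refine top_unique fun p _ ↦ ?_
  induction p using MvPolynomial.induction_on with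
  | C a =>
    exact Subalgebra.algebraMap_mem _
      (⟨C a, (mem_homogeneousSubmodule _ _).mpr (isHomogeneous_C _ a)⟩ : 𝒢 0)
  | add p q hp hq => exact add_mem (hp trivial) (hq trivial)
  | mul_X p i hp => exact mul_mem (hp trivial) (Algebra.subset_adjoin ⟨i, rfl⟩)

/-- The standard affine chart `D₊(x_i)` of projective space. -/
def projChart (k : Type u) [Field k] {N : ℕ} (i : Fin (N + 1)) :
    Spec (.of (Away (homogeneousSubmodule (Fin (N + 1)) k) (X i))) ⟶ projSpace k N :=
  Proj.awayι (homogeneousSubmodule (Fin (N + 1)) k) (X i) (X_mem k i) one_pos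

instance (i : Fin (N + 1)) : IsOpenImmersion (projChart k i) :=
  inferInstanceAs (IsOpenImmersion (Proj.awayι 𝒢 (X i) (X_mem k i) one_pos))

lemma opensRange_projChart (i : Fin (N + 1)) :
    (projChart k i).opensRange = Proj.basicOpen 𝒢 (X i) :=
  Proj.opensRange_awayι 𝒢 (X i) (X_mem k i) one_pos

/-- Closed immersions and the ideals are local on the target. By `hcov` the preimage of `D₊(x_i)` is
exactly the chart `g i`, where `ι` is the spectrum of the surjection `β i`. -/
lemma isZeroScheme_of_charts {d : ℕ} (F : homogeneousSubmodule (Fin (N + 1)) k d) {Z : Scheme.{u}}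
    (ι : Z ⟶ projSpace k N) (S : Fin (N + 1) → Type u) [∀ i, CommRing (S i)]
    (g : ∀ i, Spec (.of (S i)) ⟶ Z) [∀ i, IsOpenImmersion (g i)]
    (β : ∀ i, Away 𝒢 (X i) →+* S i) (hβ : ∀ i, Function.Surjective (β i))
    (hker : ∀ i, RingHom.ker (β i) =
      Ideal.span {Away.mk 𝒢 (X_mem k i) d F.1 (by simp [F.2])})
    (hg : ∀ i, g i ≫ ι =
      Spec.map (CommRingCat.ofHom (β i)) ≫ projChart k i)
    (hcov : ∀ i z, ι z ∈ Proj.basicOpen 𝒢 (X i) → z ∈ Set.range (g i)) :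
    IsZeroScheme F ι := by
  have hpre (i : Fin (N + 1)) : ι ⁻¹ᵁ Proj.basicOpen 𝒢 (X i) = (g i).opensRange := by
    refine le_antisymm (fun z hz ↦ hcov i z hz) ?_
    rintro _ ⟨y, rfl⟩
    rw [← opensRange_projChart]
    refine ⟨Spec.map (CommRingCat.ofHom (β i)) y, ?_⟩
    rw [← Scheme.Hom.comp_apply, ← Scheme.Hom.comp_apply, hg]
  constructor
  · have hc (i : Fin (N + 1)) : IsClosedImmersion (pullback.snd ι
        (projChart k i)) := by
      have hpb : IsPullback (Spec.map (CommRingCat.ofHom (β i))) (g i)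
          (projChart k i) ι := by
        refine (IsOpenImmersion.isPullback _ _ _ _ (hg i) ?_)
        rw [← hpre, opensRange_projChart]
      have := IsClosedImmersion.spec_of_surjective (CommRingCat.ofHom (β i)) (hβ i)
      rw [← hpb.flip.isoPullback_inv_snd]
      infer_instance
    refine IsZariskiLocalAtTarget.of_iSup_eq_top (P := @IsClosedImmersion)
      (fun i ↦ (projChart k i).opensRange) ?_ fun i ↦
      (MorphismProperty.arrow_mk_iso_iff _ (morphismRestrictOpensRange ι _)).mpr (hc i)
    simp only [opensRange_projChart]
    exact iSup_basicOpen_X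
  · intro i
    have hle : ⊤ ≤ g i ⁻¹ᵁ ι ⁻¹ᵁ Proj.basicOpen 𝒢 (X i) := by
      rw [hpre]
      intro y _
      exact ⟨y, rfl⟩
    have hle' : ⊤ ≤ projChart k i ⁻¹ᵁ
        Proj.basicOpen 𝒢 (X i) := by
      rw [← opensRange_projChart]
      intro y _
      exact ⟨y, rfl⟩
    have := isIso_appLE_top (g i) _ (hpre i) hle
    have key : Proj.awayToSection 𝒢 (X i) ≫ ι.app (Proj.basicOpen 𝒢 (X i)) ≫
        (g i).appLE _ ⊤ hle = CommRingCat.ofHom (β i) ≫ (Scheme.ΓSpecIso _).inv := by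
      have hle'' : ⊤ ≤ (g i ≫ ι) ⁻¹ᵁ Proj.basicOpen 𝒢 (X i) := hle
      have e : ι.app (Proj.basicOpen 𝒢 (X i)) ≫ (g i).appLE _ ⊤ hle =
          (g i ≫ ι).appLE (Proj.basicOpen 𝒢 (X i)) ⊤ hle'' :=
        (Scheme.Hom.comp_appLE (g i) ι (Proj.basicOpen 𝒢 (X i)) ⊤ hle'').symm
      rw [e, ← appLE_comp_appTop _ _ _ (hg i).symm _ hle']
      have := awayToSection_appLE (X i) (X_mem k i) one_pos hle'
      refine (reassoc_of% this) _ |>.trans ?_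
      exact (Scheme.ΓSpecIso_inv_naturality _).symm
    have hiso : IsIso (Proj.awayToSection 𝒢 (X i)) :=
      inferInstanceAs (IsIso (Proj.basicOpenIsoAway 𝒢 (X i) (X_mem k i) one_pos).hom)
    have hbij := ConcreteCategory.bijective_of_isIso (Proj.awayToSection 𝒢 (X i))
    have hbij' := ConcreteCategory.bijective_of_isIso ((g i).appLE _ ⊤ hle)
    have hbij'' := ConcreteCategory.bijective_of_isIso (Scheme.ΓSpecIso (.of (S i))).inv
    have hzero (z) : ι.app (Proj.basicOpen 𝒢 (X i)) (Proj.awayToSection 𝒢 (X i) z) = 0 ↔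
        β i z = 0 := by
      rw [← map_eq_zero_iff _ hbij'.injective, ← map_eq_zero_iff _ hbij''.injective]
      exact iff_of_eq (congrArg (· = 0) (ConcreteCategory.congr_hom key z))
    ext s
    obtain ⟨z, rfl⟩ := hbij.surjective s
    rw [RingHom.mem_ker, dehomogenize, Ideal.mem_span_singleton]
    refine (hzero z).trans ?_
    rw [← RingHom.mem_ker, hker, Ideal.mem_span_singleton]
    refine ⟨fun h ↦ map_dvd _ h, fun ⟨c, hc⟩ ↦ ?_⟩
    obtain ⟨c, rfl⟩ := hbij.surjective c
    exact ⟨c, hbij.injective (hc.trans (map_mul _ _ _).symm)⟩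

end ZeroScheme

/-! ### Dehomogenization and the ideal of a hypersurface chart -/

noncomputable section Dehomogenization

open MvPolynomial HomogeneousLocalization

/-- Each monomial of degree `n` contributes one factor `c` for every variable, counted with
multiplicity. -/
lemma map_eq_pow_mul_of_isHomogeneous {σ k R : Type*} [CommRing k] [CommRing R]
    (θ θ' : MvPolynomial σ k →+* R) (c : R) (hC : ∀ r, θ' (C r) = θ (C r))
    (hX : ∀ i, θ' (X i) = c * θ (X i)) {n : ℕ} {p : MvPolynomial σ k} (hp : p.IsHomogeneous n) :
    θ' p = c ^ n * θ p := by
  conv_lhs => rw [p.as_sum]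
  conv_rhs => rw [p.as_sum]
  rw [map_sum, map_sum, Finset.mul_sum]
  refine Finset.sum_congr rfl fun s hs ↦ ?_
  have hn : s.sum (fun _ e ↦ e) = n := by
    rw [← hp (mem_support_iff.mp hs)]
    exact DFunLike.congr_fun (Finsupp.degree_eq_weight_one (R := ℕ)) s
  rw [monomial_eq, map_mul, map_mul, hC, map_finsuppProd, map_finsuppProd, mul_left_comm]
  congr 1
  rw [← hn, Finsupp.sum, ← Finset.prod_pow_eq_pow_sum, Finsupp.prod, Finsupp.prod,
    ← Finset.prod_mul_distrib]
  refine Finset.prod_congr rfl fun i _ ↦ ?_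
  rw [map_pow, map_pow, hX, mul_pow]

variable {k : Type u} [Field k] {N : ℕ}

local notation "𝒢" => homogeneousSubmodule (Fin (N + 1)) k

/-- As `X a` maps to `1`, each homogeneous component of a polynomial may be divided by its own power
of `X a` without changing its image. -/
lemma awayLift_surjective {S : Type*} [CommRing S] (θ : MvPolynomial (Fin (N + 1)) k →+* S)
    (hθ : Function.Surjective θ) (a : Fin (N + 1)) (ha : θ (X a) = 1) :
    Function.Surjective (awayLift θ (X a) (ha ▸ isUnit_one)) := by
  intro s
  obtain ⟨p, rfl⟩ := hθ s
  refine ⟨∑ n ∈ Finset.range (p.totalDegree + 1), Away.mk 𝒢 (X_mem k a) n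
    (homogeneousComponent n p) (by simpa using homogeneousComponent_isHomogeneous n p), ?_⟩
  rw [map_sum]
  conv_rhs => rw [← sum_homogeneousComponent p, map_sum]
  exact Finset.sum_congr rfl fun n _ ↦ awayLift_mk θ ha _ _ _ _

variable (k) in
/-- The dehomogenization of polynomials at the coordinate `x_a`. -/
def dehomHom (a : Fin (N + 1)) : MvPolynomial (Fin (N + 1)) k →+* Away 𝒢 (X a) :=
  eval₂Hom ((algebraMap (𝒢 0) (Away 𝒢 (X a))).comp (algebraMap k (𝒢 0)))
    fun i ↦ Away.mk 𝒢 (X_mem k a) 1 (X i) (by rw [one_smul]; exact X_mem k i)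

lemma dehomHom_of_mem (a : Fin (N + 1)) {n : ℕ} {p : MvPolynomial (Fin (N + 1)) k}
    (hp : p ∈ 𝒢 (n • 1)) :
    dehomHom k a p = Away.mk 𝒢 (X_mem k a) n p hp := by
  have hp' : p.IsHomogeneous n := by simpa using hp
  refine val_injective _ ?_
  have hu : IsUnit (algebraMap (MvPolynomial (Fin (N + 1)) k)
      (Localization.Away (X a : MvPolynomial (Fin (N + 1)) k)) (X a)) :=
    IsLocalization.Away.algebraMap_isUnit _
  refine (hu.pow n).mul_right_injective ?_
  have h1 := map_eq_pow_mul_of_isHomogeneous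
    ((algebraMap (Away 𝒢 (X a)) (Localization.Away (X a : MvPolynomial (Fin (N + 1)) k))).comp
      (dehomHom k a)) (algebraMap _ _)
    (algebraMap (MvPolynomial (Fin (N + 1)) k) (Localization.Away
      (X a : MvPolynomial (Fin (N + 1)) k)) (X a))
    (fun r ↦ ?_) (fun i ↦ ?_) hp'
  · refine h1.symm.trans ?_
    dsimp only
    rw [Away.val_mk, Localization.mk_eq_mk', ← map_pow]
    exact (IsLocalization.mk'_spec' (M := Submonoid.powers (X a : MvPolynomial (Fin (N + 1)) k))
      (Localization.Away (X a : MvPolynomial (Fin (N + 1)) k)) p ⟨X a ^ n, n, rfl⟩).symm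
  · rw [RingHom.comp_apply, dehomHom, eval₂Hom_C]
    rfl
  · rw [RingHom.comp_apply, dehomHom, eval₂Hom_X', HomogeneousLocalization.algebraMap_apply, Away.val_mk,
      Localization.mk_eq_mk']
    have := (IsLocalization.mk'_spec' (M := Submonoid.powers (X a : MvPolynomial (Fin (N + 1)) k))
      (Localization.Away (X a : MvPolynomial (Fin (N + 1)) k)) (X i) ⟨X a ^ 1, 1, rfl⟩).symm
    simpa only [pow_one] using this

/-- Dehomogenization sends `X a - 1` to zero, so of the two generators of the kernel only `F`
survives. -/
lemma ker_awayLift {S : Type*} [CommRing S] (θ : MvPolynomial (Fin (N + 1)) k →+* S)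
    (a : Fin (N + 1)) (ha : θ (X a) = 1) {d : ℕ} (F : 𝒢 d)
    (hker : RingHom.ker θ = Ideal.span {X a - 1, F.1}) :
    RingHom.ker (awayLift θ (X a) (ha ▸ isUnit_one)) =
      Ideal.span {Away.mk 𝒢 (X_mem k a) d F.1 (by simp [F.2])} := by
  apply le_antisymm
  · intro z hz
    obtain ⟨n, p, hp, rfl⟩ := Away.mk_surjective 𝒢 (X_mem k a) z
    rw [RingHom.mem_ker, awayLift_mk θ ha, ← RingHom.mem_ker, hker,
      Ideal.mem_span_pair] at hz
    obtain ⟨q, r, hqr⟩ := hz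
    rw [← dehomHom_of_mem, ← dehomHom_of_mem, ← hqr, map_add, map_mul, map_mul]
    have : dehomHom k a (X a - 1) = 0 := by
      rw [map_sub, map_one, sub_eq_zero, dehomHom_of_mem (n := 1)]
      · refine val_injective _ ?_
        rw [Away.val_mk, Localization.mk_eq_mk', val_one, IsLocalization.mk'_eq_iff_eq_mul, one_mul]
        exact congrArg _ (pow_one _).symm
      · rw [one_smul]
        exact X_mem k a
    rw [this, mul_zero, zero_add]
    exact Ideal.mul_mem_left _ _ (Ideal.mem_span_singleton_self _)
  · rw [Ideal.span_singleton_le_iff_mem, RingHom.mem_ker, awayLift_mk θ ha, ← RingHom.mem_ker, hker]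
    exact Ideal.subset_span (by simp)

end Dehomogenization

/-! ### The fibres of the family away from the origin -/

noncomputable section HypersurfaceCharts

open MvPolynomial

/-- The equation `x₀ ⋯ x_{d-1} = t ∑ xᵢ ^ d` of the member of the family with parameter `t`. -/
def fibreForm {k : Type*} [Field k] (N d : ℕ) (t : k) : MvPolynomial (Fin N) k :=
  fullProd d X - C t * fermat d X

lemma fibreForm_isHomogeneous {k : Type*} [Field k] {N d : ℕ} (hd : d ≤ N) (t : k) :
    (fibreForm N d t).IsHomogeneous d := by
  refine IsHomogeneous.sub ?_ ?_
  · have h := IsHomogeneous.prod (Finset.univ.filter fun i : Fin N ↦ i.1 < d)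
      (fun i ↦ (X i : MvPolynomial (Fin N) k)) (fun _ ↦ 1) fun i _ ↦ isHomogeneous_X k i
    have hc : (Finset.univ.filter fun i : Fin N ↦ i.1 < d).card = d := by
      rw [Fin.card_filter_val_lt, min_eq_right hd]
    simp only [Finset.sum_const, smul_eq_mul, mul_one, hc] at h
    exact h
  · have h : (fermat d (X : Fin N → MvPolynomial (Fin N) k)).IsHomogeneous d :=
      IsHomogeneous.sum _ _ _ fun i _ ↦ by simpa using (isHomogeneous_X k i).pow d
    simpa using (isHomogeneous_C (Fin N) t).mul h

/-- At the coordinate point of `x_d` the product vanishes, while the Fermat form has the value `1`.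
The hypothesis `d < N` provides a coordinate outside the product. -/
lemma fibreForm_ne_zero {k : Type*} [Field k] {N d : ℕ} (hd : d ≠ 0) (hdN : d < N) {t : k}
    (ht : t ≠ 0) : fibreForm N d t ≠ 0 := by
  intro h
  have h1 := congrArg (eval (Pi.single (⟨d, hdN⟩ : Fin N) (1 : k))) h
  have h2 : ∏ i ∈ Finset.univ.filter (fun i : Fin N ↦ i.1 < d),
      Pi.single (M := fun _ ↦ k) (⟨d, hdN⟩ : Fin N) (1 : k) i = 0 := by
    refine Finset.prod_eq_zero (i := ⟨0, by omega⟩) (by simpa using Nat.pos_of_ne_zero hd) ?_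
    rw [Pi.single_eq_of_ne]
    simpa [Fin.ext_iff] using hd.symm
  have h3 : ∑ i : Fin N, (Pi.single (M := fun _ ↦ k) (⟨d, hdN⟩ : Fin N) (1 : k) i) ^ d = 1 := by
    rw [Finset.sum_eq_single ⟨d, hdN⟩]
    · simp
    · intro i _ hi
      rw [Pi.single_eq_of_ne hi, zero_pow hd]
    · simp
  rw [fibreForm, map_sub, map_mul, fullProd, fermat, map_prod, map_sum, map_zero] at h1
  simp only [map_pow, eval_X, eval_C, h2, h3] at h1
  exact ht (by simpa using h1)

/-- The differentials of the equations of an affine chart of the hypersurface are independent. -/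
lemma fibreForm_jacobian {k : Type*} [Field k] [CharZero k] {N d : ℕ} (hd : d ≠ 0) (hdN : d ≤ N)
    {t : k} (ht : t ≠ 0) (htd : discr d t ≠ 0) (a : Fin N) {κ : Type*} [Field κ]
    (ev : MvPolynomial (Fin N) k →+* κ) (ha : ev (X a) = 1) (hF : ev (fibreForm N d t) = 0)
    (c : Fin 2 → κ)
    (hc : ∀ s, ∑ i, c i * ev (pderiv s (![X a - 1, fibreForm N d t] i)) = 0) : c = 0 := by
  classical
  have : CharZero κ := charZero_of_injective_ringHom (ev.comp C).injective
  set P := ev (fullProd d X) with hP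
  have hPF : P = ev (C t) * ev (fermat d X) := by
    rw [← map_mul, ← sub_eq_zero, hP, ← map_sub]
    exact hF
  have htκ : ev (C t) ≠ 0 := by
    rw [← RingHom.comp_apply]
    exact (map_ne_zero _).mpr ht
  have hdκ : (d : κ) ≠ 0 := Nat.cast_ne_zero.mpr hd
  -- The relation between the differentials along `x_s`, multiplied by `x_s`.
  have key (s : Fin N) : c 0 * (if s = a then 1 else 0) +
      c 1 * ((if s.1 < d then P else 0) - d * ev (C t) * ev (X s) ^ d) = 0 := by
    have h1 := congrArg (fun z ↦ ev (X s) * z) (hc s)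
    simp only [Fin.sum_univ_two, Matrix.cons_val_zero, Matrix.cons_val_one, mul_zero, mul_add,
      mul_left_comm _ (c _), ← map_mul] at h1
    refine Eq.trans ?_ h1
    congr 2
    · split_ifs with hs
      · subst hs
        rw [map_sub, pderiv_X_self, map_mul, ha, pderiv_one]
        simp
      · rw [map_sub, pderiv_X_of_ne (Ne.symm hs), pderiv_one]
        simp
    · have e1 : X s * pderiv s (fullProd d (X : Fin N → MvPolynomial (Fin N) k)) = _ :=
        X_mul_pderiv_prod_X (e := fun i : Fin N ↦ i) Function.injective_id _ s
      have e2 : X s * pderiv s (fermat d (X : Fin N → MvPolynomial (Fin N) k)) = _ :=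
        X_mul_pderiv_fermat (d := d) (e := fun i : Fin N ↦ i) Function.injective_id hd s
      rw [fibreForm, map_sub, pderiv_C_mul, mul_sub, e1, mul_left_comm, e2]
      simp only [Finset.mem_filter, Finset.mem_univ, true_and, map_sub, map_mul, map_natCast,
        map_pow, apply_ite ev, map_zero, hP, fullProd]
      ring
  -- Euler's relation: summed over all `s`, the coefficient of `c 1` is `d` times the value of the
  -- equation, which is zero.
  have hsum : c 0 = 0 := by
    have h1 : ∑ s, (c 0 * (if s = a then 1 else 0) +
      c 1 * ((if s.1 < d then P else 0) - d * ev (C t) * ev (X s) ^ d)) = 0 :=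
      Finset.sum_eq_zero fun s _ ↦ key s
    rw [Finset.sum_add_distrib, ← Finset.mul_sum, ← Finset.mul_sum, Finset.sum_sub_distrib,
      ← Finset.mul_sum, Finset.sum_ite_eq' Finset.univ a] at h1
    have h3 : ∑ s : Fin N, (if s.1 < d then P else 0) = d * P := by
      rw [← Finset.sum_filter, Finset.sum_const, Fin.card_filter_val_lt, min_eq_right hdN,
        nsmul_eq_mul]
    have h2 : ∑ s, ev (X s) ^ d = ev (fermat d (X : Fin N → MvPolynomial (Fin N) k)) := by
      simp [fermat]
    rw [h2, h3, mul_assoc, ← hPF] at h1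
    simpa using h1
  -- Otherwise `P = d t x_s ^ d` for each `s < d`, and `x_a = 1` forces `P ≠ 0`. The product over `s
  -- < d` is `P ^ d = (d t) ^ d P ^ d`, against the discriminant.
  have hc1 : c 1 = 0 := by
    by_contra hne
    have key' (s : Fin N) : (if s.1 < d then P else 0) = d * ev (C t) * ev (X s) ^ d := by
      have := key s
      rw [hsum, zero_mul, zero_add] at this
      exact sub_eq_zero.mp ((mul_eq_zero.mp this).resolve_left hne)
    have hP0 : P ≠ 0 := by
      intro h0
      have := key' a
      rw [h0, ite_self, ha, one_pow, mul_one] at this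
      exact mul_ne_zero hdκ htκ this.symm
    have h1 : ∏ s ∈ Finset.univ.filter (fun i : Fin N ↦ i.1 < d), P =
        ∏ s ∈ Finset.univ.filter (fun i : Fin N ↦ i.1 < d), (d * ev (C t) * ev (X s) ^ d) :=
      Finset.prod_congr rfl fun s hs ↦ by
        rw [← key' s, if_pos (by simpa using hs)]
    rw [Finset.prod_mul_distrib, Finset.prod_const, Finset.prod_const, Fin.card_filter_val_lt,
      min_eq_right hdN, Finset.prod_pow] at h1
    have h2 : ∏ s ∈ Finset.univ.filter (fun i : Fin N ↦ i.1 < d), ev (X s) = P := by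
      rw [hP, fullProd, map_prod]
    rw [h2] at h1
    have h3 : (d * ev (C t)) ^ d = 1 :=
      (mul_eq_right₀ (pow_ne_zero d hP0)).mp h1.symm
    refine htd ((ev.comp C).injective ?_)
    rw [map_discr, map_zero, discr, sub_eq_zero]
    exact h3.symm
  ext i
  match i with
  | 0 => exact hsum
  | 1 => exact hc1

variable {k A K : Type u} [Field k] [CommRing A] [Field K] [Algebra k A] [Algebra k K]
  [Algebra A K] [IsScalarTower k A K] {N e : ℕ}

lemma val_zero_lt (N e : ℕ) : (0 : Fin (N + 1)).1 < e + 1 := Nat.succ_pos e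

namespace IsGeneralPoint

variable {x : Fin (N + 1) → K} {T W : A}

variable (h : IsGeneralPoint k e x T W) (ε : A →ₐ[k] k) (a : Fin (N + 1))

/-- The fibre of the chart `(a, 0)` over a rational point. -/
abbrev FibreChart (_ : IsGeneralPoint k e x T W) (ε : A →ₐ[k] k) (a : Fin (N + 1)) : Type u :=
  (ratioAlgebra A (monom e x (algebraMap A K T)) (vertex e a (0 : Fin (N + 1)).1)) ⧸
    Ideal.span {algebraMap A (ratioAlgebra A (monom e x (algebraMap A K T)) (vertex e a (0 : Fin (N + 1)).1))
      (T - algebraMap k A (ε T))}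

/-- The homogeneous coordinates on the fibre of the chart `(a, 0)`. -/
def fibreEval : MvPolynomial (Fin (N + 1)) k →ₐ[k] h.FibreChart ε a :=
  (Ideal.Quotient.mkₐ k _).comp ((h.chartHom a 0 (val_zero_lt N e)).comp (rename .inl))

/-- The elimination of the coordinates `u`, `v` and `w` on the fibre. -/
def fibreElim (T W : A) (ε : A →ₐ[k] k) :
    MvPolynomial (ChartVar (N + 1)) k →ₐ[k] MvPolynomial (Fin (N + 1)) k :=
  aeval (Sum.elim X ![C (ε T)⁻¹ * X 0, C (ε T), C (ε W)])

lemma lowProd_zero {R : Type*} [CommRing R] (y : Fin (N + 1) → R) : lowProd 0 y = 1 := by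
  rw [lowProd]
  exact Finset.prod_eq_one fun i hi ↦ absurd (Finset.mem_Iio.mp hi) (Fin.not_lt_zero i)

lemma fibreElim_inl (i : Fin (N + 1)) : fibreElim T W ε (X (.inl i)) = X i := by
  rw [fibreElim, aeval_X]
  rfl

lemma fibreElim_inr_zero : fibreElim (N := N) T W ε (X (.inr 0)) = C (ε T)⁻¹ * X 0 := by
  rw [fibreElim, aeval_X]
  rfl

lemma fibreElim_inr_one : fibreElim (N := N) T W ε (X (.inr 1)) = C (ε T) := by
  rw [fibreElim, aeval_X]
  rfl

lemma fibreElim_inr_two : fibreElim (N := N) T W ε (X (.inr 2)) = C (ε W) := by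
  rw [fibreElim, aeval_X]
  rfl

lemma fibreElim_C (r : k) : fibreElim (N := N) T W ε (C r) = C r := by
  rw [fibreElim, aeval_C]
  rfl

lemma fibreElim_rename (p : MvPolynomial (Fin (N + 1)) k) :
    fibreElim T W ε (rename .inl p) = p := by
  rw [fibreElim, aeval_rename, Sum.elim_comp_inl, aeval_X_left_apply]

/-- For `j = 0` the product in the parameter is empty, so `v` is the parameter. -/
lemma chartHom_v : h.chartHom a 0 (val_zero_lt N e) (X (.inr 1) - C (ε T)) =
    algebraMap A _ (T - algebraMap k A (ε T)) := by
  have h1 := h.algebraMap_param a 0 (val_zero_lt N e)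
  rw [lowProd_zero, mul_one] at h1
  rw [map_sub, map_sub, ← IsScalarTower.algebraMap_apply, ← h1]
  congr 1
  exact (h.chartHom a 0 (val_zero_lt N e)).commutes (ε T)

lemma map_mul_discr (h : IsGeneralPoint k e x T W) : ε W * discr (e + 1) (ε T) = 1 := by
  have e1 := map_discr ε.toRingHom (e + 1) T
  have e2 := congrArg ε h.mul_discr
  rw [map_mul, map_one] at e2
  rw [← e2]
  exact congrArg _ e1.symm

lemma chartHom_chartRel [CharZero k] {a j : Fin (N + 1)} (hj : j.1 < e + 1) (i : Fin 4) :
    h.chartHom a j hj (chartRel k (e + 1) a j i) = 0 := by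
  rw [← RingHom.mem_ker, h.ker_chartHom a j hj]
  exact Ideal.subset_span ⟨i, rfl⟩

/-- On the fibre in the chart `(a, 0)` one has `v = ε T`, `u = x₀ / ε T` and `w = ε W`, so the
coordinates `x i` suffice. This requires `ε T ≠ 0`. -/
lemma fibreEval_fibreElim [CharZero k] (h0 : ε T ≠ 0) (p : MvPolynomial (ChartVar (N + 1)) k) :
    h.fibreEval ε a (fibreElim T W ε p) =
      Ideal.Quotient.mk _ (h.chartHom a 0 (val_zero_lt N e) p) := by
  set q : MvPolynomial (ChartVar (N + 1)) k →ₐ[k] h.FibreChart ε a :=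
    (Ideal.Quotient.mkₐ k _).comp (h.chartHom a 0 (val_zero_lt N e)) with hq
  have hC (r : k) : h.fibreEval ε a (C r) = q (C r) :=
    ((h.fibreEval ε a).commutes r).trans (q.commutes r).symm
  have hX (i) : h.fibreEval ε a (X i) = q (X (.inl i)) := by
    simp only [fibreEval, AlgHom.comp_apply, rename_X, hq]
  have hv : q (X (.inr 1)) = q (C (ε T)) := by
    rw [← sub_eq_zero, ← map_sub]
    change Ideal.Quotient.mk _ (h.chartHom a 0 (val_zero_lt N e) _) = 0
    rw [h.chartHom_v ε a, Ideal.Quotient.eq_zero_iff_mem]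
    exact Ideal.mem_span_singleton_self _
  have hrel (i) : q (chartRel k (e + 1) a 0 i) = 0 := by
    change Ideal.Quotient.mk _ (h.chartHom a 0 (val_zero_lt N e) _) = 0
    rw [h.chartHom_chartRel, map_zero]
  have hgen : (h.fibreEval ε a).comp (fibreElim T W ε) = q := by
    refine algHom_ext fun s ↦ ?_
    rw [AlgHom.comp_apply]
    match s with
    | .inl i => rw [← hX, fibreElim_inl]
    | .inr 0 =>
      have h1 := hrel 1
      rw [chartRel_one, map_sub, map_mul, hv, sub_eq_zero] at h1
      rw [fibreElim_inr_zero, map_mul, hX, hC, h1, mul_left_comm, ← map_mul q, ← map_mul C, inv_mul_cancel₀ h0, map_one,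
        map_one, mul_one]
    | .inr 1 =>
      rw [hv, ← hC, fibreElim_inr_one]
    | .inr 2 =>
      have h1 := hrel 3
      have h2 : q (discr (e + 1) (X (.inr 1))) = q (C (discr (e + 1) (ε T))) := by
        have e1 := map_discr q.toRingHom (e + 1) (X (.inr 1))
        have e2 := map_discr (q.toRingHom.comp C) (e + 1) (ε T)
        refine e1.trans (Eq.trans ?_ e2.symm)
        exact congrArg _ hv
      rw [chartRel_three, lowProd_zero, mul_one, map_sub, map_mul, map_one, h2, sub_eq_zero] at h1
      rw [fibreElim_inr_two, hC, ← mul_one (q (C (ε W))), ← h1, mul_left_comm, ← map_mul q, ← map_mul C, h.map_mul_discr ε,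
        map_one, map_one, mul_one]
  exact DFunLike.congr_fun hgen p

lemma fibreEval_surjective [CharZero k] (h0 : ε T ≠ 0) : Function.Surjective (h.fibreEval ε a) := by
  intro z
  obtain ⟨z, rfl⟩ := Ideal.Quotient.mk_surjective z
  obtain ⟨p, rfl⟩ := h.chartHom_surjective a 0 (val_zero_lt N e) z
  exact ⟨_, h.fibreEval_fibreElim ε a h0 p⟩

lemma fibreEval_X_self : h.fibreEval ε a (X a) = 1 := by
  simp only [fibreEval, AlgHom.comp_apply, rename_X, h.chartHom_X_self, map_one]

lemma fibreElim_chartRel_two (ε : A →ₐ[k] k) (a : Fin (N + 1)) (h0 : ε T ≠ 0) :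
    fibreElim T W ε (chartRel k (e + 1) a 0 2) = C (ε T)⁻¹ * fibreForm (N + 1) (e + 1) (ε T) := by
  have h3 := lowProd_mul_midProd (j := (0 : Fin (N + 1))) (d := e + 1) (val_zero_lt N e)
    (X : Fin (N + 1) → MvPolynomial (Fin (N + 1)) k)
  rw [lowProd_zero, one_mul] at h3
  have h4 : C (ε T)⁻¹ * C (ε T) = (1 : MvPolynomial (Fin (N + 1)) k) := by
    rw [← map_mul, inv_mul_cancel₀ h0, map_one]
  rw [chartRel_two, fibreForm, ← h3, map_sub, map_mul, fibreElim_inr_zero, mul_sub, ← mul_assoc (C _) (C _), h4,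
    one_mul, mul_assoc]
  simp only [midProd, fermat, map_prod, map_sum, map_pow, fibreElim_inl]

/-- The elimination sends the four chart relations to `X a - 1`, zero, a unit times the form, and
zero, and it sends `v - ε T` to zero. -/
lemma ker_fibreEval [CharZero k] (h0 : ε T ≠ 0) : RingHom.ker (h.fibreEval ε a) =
    Ideal.span {X a - 1, fibreForm (N + 1) (e + 1) (ε T)} := by
  have hrel := fibreElim_chartRel_two (W := W) (e := e) ε a h0
  apply le_antisymm
  · intro p hp
    rw [RingHom.mem_ker] at hp
    have h1 : h.chartHom a 0 (val_zero_lt N e) (rename .inl p) ∈ Ideal.span {algebraMap A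
        (ratioAlgebra A (monom e x (algebraMap A K T)) (vertex e a (0 : Fin (N + 1)).1))
        (T - algebraMap k A (ε T))} := Ideal.Quotient.eq_zero_iff_mem.mp hp
    obtain ⟨z, hz⟩ := Ideal.mem_span_singleton.mp h1
    obtain ⟨r, rfl⟩ := h.chartHom_surjective a 0 (val_zero_lt N e) z
    rw [← h.chartHom_v ε a, ← map_mul, ← sub_eq_zero, ← map_sub, ← RingHom.mem_ker,
      h.ker_chartHom a 0 (val_zero_lt N e)] at hz
    have hle : Ideal.span (Set.range (chartRel k (e + 1) a 0)) ≤
        Ideal.comap (fibreElim T W ε)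
          (Ideal.span {X a - 1, fibreForm (N + 1) (e + 1) (ε T)}) := by
      rw [Ideal.span_le]
      rintro _ ⟨i, rfl⟩
      rw [SetLike.mem_coe, Ideal.mem_comap]
      match i with
      | 0 =>
        rw [chartRel_zero, map_sub, map_one, fibreElim_inl]
        exact Ideal.subset_span (by simp)
      | 1 =>
        rw [chartRel_one, map_sub, map_mul, fibreElim_inl, fibreElim_inr_zero, fibreElim_inr_one,
          mul_right_comm, ← map_mul, inv_mul_cancel₀ h0, map_one, one_mul, sub_self]
        exact zero_mem _
      | 2 =>
        rw [hrel]
        exact Ideal.mul_mem_left _ _ (Ideal.subset_span (by simp))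
      | 3 =>
        have e1 := map_discr (fibreElim T W ε).toRingHom (e + 1)
          (X (.inr 1) : MvPolynomial (ChartVar (N + 1)) k)
        have e2 := map_discr (C : k →+* MvPolynomial (Fin (N + 1)) k) (e + 1) (ε T)
        have e3 : fibreElim (N := N) T W ε (discr (e + 1) (X (.inr 1))) =
            C (discr (e + 1) (ε T)) := by
          rw [e2]
          refine e1.trans (congrArg _ ?_)
          exact fibreElim_inr_one ε
        rw [chartRel_three, lowProd_zero, mul_one, map_sub, map_mul, fibreElim_inr_two, e3,
          ← map_mul, h.map_mul_discr ε, map_one, map_one, sub_self]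
        exact zero_mem _
    have h2 := hle hz
    rwa [Ideal.mem_comap, map_sub, map_mul, fibreElim_rename, map_sub, fibreElim_inr_one,
      fibreElim_C, sub_self, zero_mul, sub_zero] at h2
  · rw [Ideal.span_le]
    rintro _ (rfl | rfl)
    · rw [SetLike.mem_coe, RingHom.mem_ker, map_sub, h.fibreEval_X_self, map_one, sub_self]
    · rw [SetLike.mem_coe, RingHom.mem_ker]
      have h1 := h.fibreEval_fibreElim ε a h0 (chartRel k (e + 1) a 0 2)
      rw [h.chartHom_chartRel, map_zero, hrel, map_mul] at h1
      have h2 := congrArg (fun z ↦ h.fibreEval ε a (C (ε T)) * z) h1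
      simpa only [mul_zero, ← mul_assoc, ← map_mul, mul_inv_cancel₀ h0, map_one, one_mul] using h2

lemma locally_isStandardSmooth_fibre [CharZero k] (hN : 1 ≤ N) (h0 : ε T ≠ 0) :
    RingHom.Locally (RingHom.IsStandardSmoothOfRelativeDimension (N - 1))
      (algebraMap k (h.FibreChart ε a)) := by
  have hform (i : Fin 2) : h.fibreEval ε a
      (![X a - 1, fibreForm (N + 1) (e + 1) (ε T)] i) = 0 := by
    rw [← RingHom.mem_ker, h.ker_fibreEval ε a h0]
    refine Ideal.subset_span ?_
    match i with
    | 0 => simp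
    | 1 => simp
  refine locally_isStandardSmooth_of_jacobian (h.fibreEval ε a) (h.fibreEval_surjective ε a h0)
    ![X a - 1, fibreForm (N + 1) (e + 1) (ε T)] ?_ ?_ ?_
  · rw [h.ker_fibreEval ε a h0]
    congr 1
    simp [Matrix.range_cons, Matrix.range_empty]
    exact Set.pair_comm _ _
  · simp only [Fintype.card_fin]
    omega
  · intro κ _ ev c hc
    refine fibreForm_jacobian (Nat.succ_ne_zero e) h.lt h0 ?_ a
      (ev.comp (h.fibreEval ε a).toRingHom) ?_ ?_ c hc
    · exact right_ne_zero_of_mul (h.map_mul_discr ε ▸ one_ne_zero)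
    · change ev (h.fibreEval ε a (X a)) = 1
      rw [h.fibreEval_X_self, map_one]
    · exact (congrArg ev (hform 1)).trans (map_zero _)

end IsGeneralPoint

end HypersurfaceCharts

/-! ### The morphism from the model to projective space -/

noncomputable section MapToProj

open MvPolynomial

/-- The generic point of the spectrum of a domain lies in every nonempty open subset, in particular
in the images of the open subsets of `P`. -/
lemma isDominant_of_generic {K : Type u} [Field K] {R : Type u} [CommRing R] [IsDomain R]
    [Algebra R K] (hR : Function.Injective (algebraMap R K)) {P : Scheme.{u}}
    (p : P ⟶ Spec (.of R)) [IsOpenImmersion p] (δ : Spec (.of K) ⟶ P)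
    (hδ : δ ≫ p = Spec.map (CommRingCat.ofHom (algebraMap R K))) : IsDominant δ := by
  refine ⟨dense_iff_inter_open.mpr fun U hU ⟨y, hy⟩ ↦ ?_⟩
  let z : Spec (.of K) := (⊥ : PrimeSpectrum K)
  refine ⟨δ z, ?_, z, rfl⟩
  have hopen : IsOpen (p '' U) := p.isOpenEmbedding.isOpenMap U hU
  have hgen : p (δ z) = (⊥ : PrimeSpectrum R) := by
    rw [← Scheme.Hom.comp_apply, hδ]
    refine PrimeSpectrum.ext ?_
    change Ideal.comap (algebraMap R K) ⊥ = ⊥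
    exact (RingHom.injective_iff_ker_eq_bot _).mp hR
  have hmem : p (δ z) ∈ p '' U := by
    rw [hgen]
    have hsp : (⊥ : PrimeSpectrum R) ⤳ (p y : PrimeSpectrum R) :=
      (PrimeSpectrum.le_iff_specializes _ _).mp bot_le
    exact hsp.mem_open hopen ⟨y, hy, rfl⟩
  obtain ⟨y', hy', he⟩ := hmem
  rwa [← p.isOpenEmbedding.injective he]

/-- Morphisms to a separated scheme from the charts of a scheme glue if they agree at a common
generic point of the charts. -/
lemma exists_glue_of_generic {K : Type u} [Field K] {V : Type} (R : V → Type u)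
    [∀ v, CommRing (R v)] [∀ v, IsDomain (R v)] [∀ v, Algebra (R v) K]
    (hR : ∀ v, Function.Injective (algebraMap (R v) K)) {X Y : Scheme.{u}} [Y.IsSeparated]
    (f : ∀ v, Spec (.of (R v)) ⟶ X) [∀ v, IsOpenImmersion (f v)]
    (hcov : ∀ p, ∃ v, p ∈ Set.range (f v)) (g : Spec (.of K) ⟶ X)
    (hg : ∀ v, Spec.map (CommRingCat.ofHom (algebraMap (R v) K)) ≫ f v = g)
    (h : ∀ v, Spec (.of (R v)) ⟶ Y) (h₀ : Spec (.of K) ⟶ Y)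
    (hh : ∀ v, Spec.map (CommRingCat.ofHom (algebraMap (R v) K)) ≫ h v = h₀) :
    ∃ H : X ⟶ Y, ∀ v, f v ≫ H = h v := by
  let 𝒰 : X.OpenCover := Scheme.Cover.mkOfCovers V (fun v ↦ Spec (.of (R v))) f
    (fun p ↦ by obtain ⟨v, y, hy⟩ := hcov p; exact ⟨v, y, hy⟩)
  -- The overlap is reduced, the common generic point is dense in it, and `Y` is separated, so
  -- agreement at that point suffices.
  have key (v w : V) : pullback.fst (f v) (f w) ≫ h v = pullback.snd (f v) (f w) ≫ h w := by
    let δ : Spec (.of K) ⟶ pullback (f v) (f w) :=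
      pullback.lift (Spec.map (CommRingCat.ofHom (algebraMap (R v) K)))
        (Spec.map (CommRingCat.ofHom (algebraMap (R w) K))) (by rw [hg, hg])
    have := isDominant_of_generic (hR v) (pullback.fst (f v) (f w)) δ (pullback.lift_fst _ _ _)
    have : IsReduced (pullback (f v) (f w)) :=
      isReduced_of_isOpenImmersion (pullback.fst (f v) (f w))
    refine ext_of_isDominant δ ?_
    rw [pullback.lift_fst_assoc, pullback.lift_snd_assoc, hh, hh]
  exact ⟨𝒰.glueMorphisms h key, fun v ↦ 𝒰.ι_glueMorphisms h key v⟩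

/-- The scheme `X` with the morphism `π` is covered by the spectra of the algebras of the ratios of
the `mᵢ`, glued inside the field `K`. -/
structure IsRatioModel {A K : Type u} [CommRing A] [Field K] [Algebra A K] {ι : Type} (m : ι → K)
    {X : Scheme.{u}} (π : X ⟶ Spec (.of A)) (g : Spec (.of K) ⟶ X)
    (f : ∀ i, Spec (.of (ratioAlgebra A m i)) ⟶ X) : Prop where
  isOpenImmersion : ∀ i, IsOpenImmersion (f i)
  comp_eq : ∀ i, f i ≫ π = Spec.map (CommRingCat.ofHom (algebraMap A (ratioAlgebra A m i)))
  generic : ∀ i, Spec.map (CommRingCat.ofHom (algebraMap (ratioAlgebra A m i) K)) ≫ f i = g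
  exists_mem : ∀ x, ∃ i, x ∈ Set.range (f i)
  mem_range_iff : ∀ i j (q : PrimeSpectrum (ratioAlgebra A m i)),
    f i q ∈ Set.range (f j) ↔ ratio A m i j ∉ q.asIdeal

variable {k A K : Type u} [Field k] [CommRing A] [Field K] [Algebra k A] [Algebra k K]
  [Algebra A K] [IsScalarTower k A K] {N e : ℕ}

namespace IsGeneralPoint

section

variable {x : Fin N → K} {T W : A} {X : Scheme.{u}} {π : X ⟶ Spec (.of A)} {g : Spec (.of K) ⟶ X}
  {f : ∀ i, Spec (.of (ratioAlgebra A (monom e x (algebraMap A K T)) i)) ⟶ X}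

/-- The indices of the monomials that do not vanish at a point form a set to which
`exists_vertex_mem` applies: if a product is not in a prime ideal, its factors are not. -/
lemma exists_vertex (h : IsGeneralPoint k e x T W)
    (hM : IsRatioModel (monom e x (algebraMap A K T)) π g f) (p : X) :
    ∃ a j : Fin N, j.1 < e + 1 ∧ p ∈ Set.range (f (vertex e a j.1)) := by
  obtain ⟨i, q, rfl⟩ := hM.exists_mem p
  obtain ⟨b, w⟩ := i
  have hS : ∀ (l l' l'' : Fin N × (Fin e → Option (Fin N))) (r s : ℕ),
      monom e x (algebraMap A K T) l ^ r =
        monom e x (algebraMap A K T) l' * monom e x (algebraMap A K T) l'' ^ s → r = s + 1 →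
      l ∈ {l | f (b, w) q ∈ Set.range (f l)} → l' ∈ {l | f (b, w) q ∈ Set.range (f l)} := by
    intro l l' l'' r s hrs hr hl
    replace hl := (hM.mem_range_iff _ _ q).mp hl
    refine (hM.mem_range_iff _ _ q).mpr ?_
    have hq := PrimeSpectrum.isPrime q
    intro hl'
    refine hl (hq.mem_of_pow_mem r ?_)
    have : ratio A (monom e x (algebraMap A K T)) (b, w) l ^ r =
        ratio A (monom e x (algebraMap A K T)) (b, w) l' *
          ratio A (monom e x (algebraMap A K T)) (b, w) l'' ^ s := by
      refine Subtype.ext ?_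
      change (monom e x (algebraMap A K T) l / monom e x (algebraMap A K T) (b, w)) ^ r =
        monom e x (algebraMap A K T) l' / monom e x (algebraMap A K T) (b, w) *
          (monom e x (algebraMap A K T) l'' / monom e x (algebraMap A K T) (b, w)) ^ s
      rw [div_pow, div_pow, hrs, hr, div_mul_div_comm, pow_succ']
    rw [this]
    exact Ideal.mul_mem_right _ _ hl'
  obtain ⟨j, hj, hmem⟩ := exists_vertex_mem h.lt.le _ hS (b := b) (q := w) ⟨q, rfl⟩
  exact ⟨b, ⟨j, hj.trans_lt h.lt⟩, Nat.lt_succ_of_le hj, hmem⟩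

end

section

variable {x : Fin (N + 1) → K} {T W : A} {Y : Scheme.{u}} {π : Y ⟶ Spec (.of A)}
  {g : Spec (.of K) ⟶ Y}
  {f : ∀ i, Spec (.of (ratioAlgebra A (monom e x (algebraMap A K T)) i)) ⟶ Y}

/-- The homogeneous coordinates on a chart. -/
def coordHom (h : IsGeneralPoint k e x T W) (a j : Fin (N + 1)) (hj : j.1 < e + 1) :
    MvPolynomial (Fin (N + 1)) k →ₐ[k]
      ratioAlgebra A (monom e x (algebraMap A K T)) (vertex e a j.1) :=
  (h.chartHom a j hj).comp (rename .inl)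

lemma coordHom_X (h : IsGeneralPoint k e x T W) (a j : Fin (N + 1)) (hj : j.1 < e + 1)
    (i : Fin (N + 1)) : h.coordHom a j hj (X i) = h.chartHom a j hj (X (.inl i)) := by
  rw [coordHom, AlgHom.comp_apply, rename_X]

lemma isUnit_coordHom (h : IsGeneralPoint k e x T W) (a j : Fin (N + 1)) (hj : j.1 < e + 1) :
    IsUnit ((h.coordHom a j hj).toRingHom (X a)) := by
  change IsUnit (h.coordHom a j hj (X a))
  rw [coordHom_X, h.chartHom_X_self]
  exact isUnit_one

/-- The morphism to projective space. -/
lemma exists_hom_projSpace (h : IsGeneralPoint k e x T W)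
    (hM : IsRatioModel (monom e x (algebraMap A K T)) π g f) :
    ∃ H : Y ⟶ projSpace k N, ∀ (a j : Fin (N + 1)) (hj : j.1 < e + 1),
      f (vertex e a j.1) ≫ H = toProj (h.coordHom a j hj).toRingHom (X a) (X_mem k a) one_pos
        (h.isUnit_coordHom a j hj) := by
  have hu (a : Fin (N + 1)) : IsUnit ((aeval (R := k) x).toRingHom (X a)) := by
    change IsUnit (aeval x (X a))
    rw [aeval_X]
    exact (h.ne_zero a).isUnit
  let V : Type := {p : Fin (N + 1) × Fin (N + 1) // p.2.1 < e + 1}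
  have := hM.isOpenImmersion
  obtain ⟨H, hH⟩ := exists_glue_of_generic (Y := projSpace k N) (V := V)
    (fun v ↦ ratioAlgebra A (monom e x (algebraMap A K T)) (vertex e v.1.1 v.1.2.1))
    (fun v ↦ Subtype.val_injective) (fun v ↦ f (vertex e v.1.1 v.1.2.1))
    (fun p ↦ by
      obtain ⟨a, j, hj, hp⟩ := h.exists_vertex hM p
      exact ⟨⟨(a, j), hj⟩, hp⟩) g (fun v ↦ hM.generic _)
    (fun v ↦ toProj (h.coordHom v.1.1 v.1.2 v.2).toRingHom (X v.1.1) (X_mem k v.1.1) one_pos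
      (h.isUnit_coordHom v.1.1 v.1.2 v.2))
    -- All charts restrict to the `K`-point with homogeneous coordinates `x`. On the chart with
    -- index `a` these are divided by the unit `x a`, which does not change the point.
    (toProj (aeval (R := k) x).toRingHom (X 0) (X_mem k 0) one_pos (hu 0)) (fun v ↦ by
      rw [toProj_eq_toProj _ _ (X v.1.1) _ _ _ (X_mem k v.1.1) one_pos (hu v.1.1), toProj, toProj,
        ← Spec.map_comp_assoc, ← CommRingCat.ofHom_comp,
        comp_awayLift _ (aeval (R := k) x).toRingHom _ (X_mem k v.1.1) _ (hu v.1.1) (x v.1.1)]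
      intro n p hp
      refine (map_eq_pow_mul_of_isHomogeneous
        ((algebraMap (ratioAlgebra A (monom e x (algebraMap A K T)) (vertex e v.1.1 v.1.2.1)) K).comp
          (h.coordHom v.1.1 v.1.2 v.2).toRingHom) (aeval (R := k) x).toRingHom (x v.1.1) ?_ ?_
          hp).symm
      · intro r
        change aeval x (C r) = chartEval k x (algebraMap A K T) (algebraMap A K W) v.1.1 v.1.2
          (rename .inl (C r))
        rw [rename_C]
        exact ((aeval x).commutes r).trans (AlgHom.commutes _ r).symm
      · intro i
        change aeval x (X i) = x v.1.1 * (h.coordHom v.1.1 v.1.2 v.2 (X i) : K)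
        rw [coordHom_X, coe_chartHom, chartEval_inl, aeval_X, mul_div_cancel₀ _ (h.ne_zero _)])
  exact ⟨H, fun a j hj ↦ hH ⟨(a, j), hj⟩⟩

end

end IsGeneralPoint

end MapToProj

/-! ### The smooth fibres as projective hypersurfaces -/

noncomputable section HypersurfaceFibres

open MvPolynomial HomogeneousLocalization

lemma of_charts {P : MorphismProperty Scheme.{u}}
    {Q : ∀ {R S : Type u} [CommRing R] [CommRing S], (R →+* S) → Prop} [HasRingHomProperty P Q]
    {ι : Type} {R : Type u} {S : ι → Type u} [CommRing R] [∀ i, CommRing (S i)] {Z : Scheme.{u}}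
    (c : ∀ i, Spec (.of (S i)) ⟶ Z) [∀ i, IsOpenImmersion (c i)]
    (hcov : ∀ z, ∃ i, z ∈ Set.range (c i)) (p : Z ⟶ Spec (.of R)) (φ : ∀ i, R →+* S i)
    (hφ : ∀ i, c i ≫ p = Spec.map (CommRingCat.ofHom (φ i))) (hQ : ∀ i, Q (φ i)) : P p := by
  have := HasRingHomProperty.instIsZariskiLocalAtSource (P := P) (Q := Q)
  let 𝒰 : Z.OpenCover := Scheme.Cover.mkOfCovers ι (fun i ↦ Spec (.of (S i))) c (fun z ↦ by
      obtain ⟨a, y, hy⟩ := hcov z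
      exact ⟨a, y, hy⟩)
  have key (i : ι) : P (c i ≫ p) := by
    rw [hφ, HasRingHomProperty.Spec_iff (P := P) (Q := Q)]
    exact hQ i
  exact (IsZariskiLocalAtSource.iff_of_openCover (P := P) 𝒰).mpr key

section

variable {k : Type u} [Field k] {N : ℕ}

local notation "𝒢" => homogeneousSubmodule (Fin (N + 1)) k

lemma awayLift_algebraMap {S : Type*} [CommRing S] (θ : MvPolynomial (Fin (N + 1)) k →+* S)
    (f : MvPolynomial (Fin (N + 1)) k) (hf : IsUnit (θ f)) (y : 𝒢 0) :
    awayLift θ f hf (fromZeroRingHom 𝒢 _ y) = θ y.1 :=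
  IsLocalization.Away.lift_eq (S := Localization.Away f) f hf y.1

lemma notMem_of_toProj_mem_basicOpen {S : Type u} [CommRing S]
    (θ : MvPolynomial (Fin (N + 1)) k →+* S) (a b : Fin (N + 1)) (hb : IsUnit (θ (X b)))
    (q : PrimeSpectrum S)
    (hq : toProj θ (X b) (X_mem k b) one_pos hb q ∈ Proj.basicOpen 𝒢 (X a)) :
    θ (X a) ∉ q.asIdeal := by
  have h1 := Proj.awayι_preimage_basicOpen 𝒢 (X_mem k b) one_pos (X_mem k a) one_pos
  have h2 : Spec.map (CommRingCat.ofHom (awayLift θ (X b) hb)) q ∈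
      Proj.awayι 𝒢 (X b) (X_mem k b) one_pos ⁻¹ᵁ Proj.basicOpen 𝒢 (X a) := by
    exact hq
  rw [h1] at h2
  intro hmem
  refine h2 ?_
  change awayLift θ (X b) hb _ ∈ q.asIdeal
  rw [← Ideal.mul_unit_mem_iff_mem _ (hb.pow 1), awayLift_mk_mul, map_pow]
  exact Ideal.pow_mem_of_mem _ hmem _ one_pos

lemma toProj_comp_projSpaceHom {S : Type u} [CommRing S] [Algebra k S]
    (θ : MvPolynomial (Fin (N + 1)) k →ₐ[k] S) (a : Fin (N + 1)) (ha : IsUnit (θ.toRingHom (X a))) :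
    toProj θ.toRingHom (X a) (X_mem k a) one_pos ha ≫ projSpaceHom k N =
      Spec.map (CommRingCat.ofHom (algebraMap k S)) := by
  rw [toProj, projSpaceHom, Category.assoc, Proj.awayι_toSpecZero_assoc, ← Spec.map_comp,
    ← Spec.map_comp, ← CommRingCat.ofHom_comp, ← CommRingCat.ofHom_comp]
  congr 2
  ext r
  exact (awayLift_algebraMap _ _ ha _).trans (θ.commutes r)

end

variable {k A K : Type u} [Field k] [CommRing A] [Field K] [Algebra k A] [Algebra k K]
  [Algebra A K] [IsScalarTower k A K] {n e : ℕ}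

namespace IsGeneralPoint

variable {x : Fin (n + 1 + 1) → K} {T W : A} {Y : Scheme.{u}} {π : Y ⟶ Spec (.of A)}
  {g : Spec (.of K) ⟶ Y}
  {f : ∀ i, Spec (.of (ratioAlgebra A (monom e x (algebraMap A K T)) i)) ⟶ Y}

/-- The charts `(a, 0)` cover the fibres over the points other than the origin. -/
lemma fst_mem_range (h : IsGeneralPoint k e x T W)
    (hM : IsRatioModel (monom e x (algebraMap A K T)) π g f) {H : Y ⟶ projSpace k (n + 1)}
    (hH : ∀ (a j : Fin (n + 1 + 1)) (hj : j.1 < e + 1), f (vertex e a j.1) ≫ H =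
      toProj (h.coordHom a j hj).toRingHom (X a) (X_mem k a) one_pos (h.isUnit_coordHom a j hj))
    {t : Spec (.of k) ⟶ Spec (.of A)} {ε : A →ₐ[k] k}
    (ht : t = Spec.map (CommRingCat.ofHom ε.toRingHom)) (h0 : ε T ≠ 0) (z : ↥(pullback π t))
    (a : Fin (n + 1 + 1)) (hz : H (pullback.fst π t z) ∈
      Proj.basicOpen (homogeneousSubmodule (Fin (n + 1 + 1)) k) (X a)) :
    pullback.fst π t z ∈ Set.range (f (vertex e a (0 : Fin (n + 1 + 1)).1)) := by
  have key (w : Spec (.of k)) : T ∉ (t w).asIdeal := by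
    rw [ht]
    intro hmem
    have h3 : ε T ∈ w.asIdeal := hmem
    exact (PrimeSpectrum.isPrime w).ne_top (Ideal.eq_top_of_isUnit_mem _ h3 h0.isUnit)
  have hT (b j : Fin (n + 1 + 1)) (q : Spec (.of
      (ratioAlgebra A (monom e x (algebraMap A K T)) (vertex e b j.1))))
      (hq : f (vertex e b j.1) q = pullback.fst π t z) :
      algebraMap A _ T ∉ PrimeSpectrum.asIdeal q := by
    intro hmem
    have h1 : Spec.map (CommRingCat.ofHom (algebraMap A _)) q = t (pullback.snd π t z) := by
      rw [← Scheme.Hom.comp_apply, ← pullback.condition, Scheme.Hom.comp_apply, ← hq,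
        ← Scheme.Hom.comp_apply, hM.comp_eq]
    refine key (pullback.snd π t z) ?_
    rw [← h1]
    exact hmem
  -- Start from any chart `(b, j)` at the point. As `x a ≠ 0`, the point lies in the chart `(a, j)`;
  -- as the parameter is not zero, it lies in `(a, 0)`.
  obtain ⟨b, j, hj, q, hq⟩ := h.exists_vertex hM (pullback.fst π t z)
  have h1 : h.chartHom b j hj (X (.inl a)) ∉ PrimeSpectrum.asIdeal q := by
    rw [← h.coordHom_X]
    refine notMem_of_toProj_mem_basicOpen (h.coordHom b j hj).toRingHom a b
      (h.isUnit_coordHom b j hj) q ?_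
    rw [← hH, Scheme.Hom.comp_apply, hq]
    exact hz
  have hprime := PrimeSpectrum.isPrime q
  rw [← h.ratio_mem_iff b j hj a] at h1
  obtain ⟨q', hq'⟩ := (hM.mem_range_iff _ _ q).mpr h1
  rw [← hq, ← hq']
  have hprime' := PrimeSpectrum.isPrime q'
  exact (hM.mem_range_iff _ _ q').mpr
    (h.ratio_zero_notMem a j hj (PrimeSpectrum.asIdeal q') (hT a j q' (hq'.trans hq)))

/-- The embedding is the restriction to the fibre of the morphism from the whole model to projective
space. The charts `(a, 0)` are the preimages in the fibre of the standard charts, and there the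
ideal is that of the dehomogenized form. -/
theorem isSmoothHypersurface_fibre [CharZero k] (h : IsGeneralPoint k e x T W) (hen : e ≤ n)
    (hM : IsRatioModel (monom e x (algebraMap A K T)) π g f)
    (t : Spec (.of k) ⟶ Spec (.of A)) (ε : A →ₐ[k] k)
    (ht : t = Spec.map (CommRingCat.ofHom ε.toRingHom))
    (hε : RingHom.ker ε = Ideal.span {T - algebraMap k A (ε T)}) (h0 : ε T ≠ 0) :
    IsSmoothHypersurface n (e + 1) (pullback.snd π t) := by
  obtain ⟨H, hH⟩ := h.exists_hom_projSpace hM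
  have := hM.isOpenImmersion
  choose c hc hfst hsnd hrange using fun a : Fin (n + 1 + 1) ↦
    exists_fibreChart ε hε π t ht (f (vertex e a (0 : Fin (n + 1 + 1)).1)) (hM.comp_eq _)
  have hcov (a : Fin (n + 1 + 1)) (z : ↥(pullback π t)) (hz : (pullback.fst π t ≫ H) z ∈
      Proj.basicOpen (homogeneousSubmodule (Fin (n + 1 + 1)) k) (X a)) : z ∈ Set.range (c a) :=
    hrange a z (h.fst_mem_range hM hH ht h0 z a hz)
  have hunit (a : Fin (n + 1 + 1)) : (h.fibreEval ε a).toRingHom (X a) = 1 :=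
    h.fibreEval_X_self ε a
  have hcomp (a : Fin (n + 1 + 1)) : c a ≫ pullback.fst π t ≫ H =
      toProj (h.fibreEval ε a).toRingHom (X a) (X_mem k a) one_pos
        (hunit a ▸ isUnit_one) := by
    rw [reassoc_of% hfst a, hH a 0 (val_zero_lt (n + 1) e), toProj, toProj,
      ← Spec.map_comp_assoc, ← CommRingCat.ofHom_comp,
      comp_awayLift _ (h.fibreEval ε a).toRingHom _ (X_mem k a) _ (hunit a ▸ isUnit_one) 1]
    intro m p _
    rw [one_pow, one_mul]
    rfl
  have hex (z : ↥(pullback π t)) : ∃ a, z ∈ Set.range (c a) := by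
    have h1 : (pullback.fst π t ≫ H) z ∈ (⊤ : (projSpace k (n + 1)).Opens) := trivial
    rw [← iSup_basicOpen_X, TopologicalSpace.Opens.mem_iSup] at h1
    obtain ⟨a, ha⟩ := h1
    exact ⟨a, hcov a z ha⟩
  let 𝒰 : (pullback π t).OpenCover := Scheme.Cover.mkOfCovers (Fin (n + 1 + 1))
    (fun a ↦ Spec (.of (h.FibreChart ε a))) c (fun z ↦ by
      obtain ⟨a, y, hy⟩ := hex z
      exact ⟨a, y, hy⟩)
  refine ⟨?_, ⟨fibreForm (n + 1 + 1) (e + 1) (ε T), ?_⟩, pullback.fst π t ≫ H, ?_, ?_, ?_⟩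
  · exact of_charts (P := @SmoothOfRelativeDimension n) c hex _ _ hsnd fun a ↦
      h.locally_isStandardSmooth_fibre ε a (Nat.succ_pos n) h0
  · exact fibreForm_isHomogeneous h.lt _
  · intro hzero
    exact fibreForm_ne_zero (Nat.succ_ne_zero e) (by omega) h0 (congrArg Subtype.val hzero)
  · refine isZeroScheme_of_charts _ _ (fun a ↦ h.FibreChart ε a) c
      (fun a ↦ awayLift (h.fibreEval ε a).toRingHom (X a) (hunit a ▸ isUnit_one))
      (fun a ↦ awayLift_surjective _ (h.fibreEval_surjective ε a h0) a (hunit a))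
      (fun a ↦ ker_awayLift _ a (hunit a) _ (h.ker_fibreEval ε a h0)) hcomp hcov
  · have key (a : Fin (n + 1 + 1)) :
        c a ≫ (pullback.fst π t ≫ H) ≫ projSpaceHom k (n + 1) = c a ≫ pullback.snd π t := by
      rw [hsnd, ← Category.assoc]
      refine (congrArg (· ≫ projSpaceHom k (n + 1)) (hcomp a)).trans ?_
      exact toProj_comp_projSpaceHom (h.fibreEval ε a) a (hunit a ▸ isUnit_one)
    exact 𝒰.hom_ext _ _ key

end IsGeneralPoint

end HypersurfaceFibres

/-! ### Classes of locally closed subschemes of affine schemes -/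

noncomputable section LocallyClosedClass

variable {k : Type u} [Field k] {B D : Type u} [CommRing B] [Algebra k B] [CommRing D] [Algebra k D]

/-- The homomorphism `φ` identifies `D` with the localization `(B ⧸ I)_f`. -/
structure IsLocQuot (I : Ideal B) (f : B) (φ : B →ₐ[k] D) : Prop where
  le_ker : ∀ b ∈ I, φ b = 0
  isUnit : IsUnit (φ f)
  surj : ∀ d, ∃ (n : ℕ) (b : B), d * φ f ^ n = φ b
  exists_mem : ∀ b, φ b = 0 → ∃ n : ℕ, f ^ n * b ∈ I

variable (k) in
/-- The canonical homomorphism to the localization of a quotient. -/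
def locMap (I : Ideal B) (f : B) : B →ₐ[k] Localization.Away (Ideal.Quotient.mk I f) :=
  (IsScalarTower.toAlgHom k (B ⧸ I) _).comp (Ideal.Quotient.mkₐ k I)

lemma isLocQuot_locMap (I : Ideal B) (f : B) : IsLocQuot I f (locMap k I f) where
  le_ker b hb := by
    change algebraMap (B ⧸ I) (Localization.Away (Ideal.Quotient.mk I f)) (Ideal.Quotient.mk I b) = 0
    rw [Ideal.Quotient.eq_zero_iff_mem.mpr hb, map_zero]
  isUnit := IsLocalization.Away.algebraMap_isUnit (S := Localization.Away (Ideal.Quotient.mk I f))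
    (Ideal.Quotient.mk I f)
  surj d := by
    obtain ⟨n, b, hb⟩ := IsLocalization.Away.surj (Ideal.Quotient.mk I f) d
    obtain ⟨b, rfl⟩ := Ideal.Quotient.mk_surjective b
    exact ⟨n, b, hb⟩
  exists_mem b hb := by
    obtain ⟨⟨_, n, rfl⟩, hn⟩ := (IsLocalization.map_eq_zero_iff
      (Submonoid.powers (Ideal.Quotient.mk I f))
      (Localization.Away (Ideal.Quotient.mk I f)) (Ideal.Quotient.mk I b)).mp hb
    refine ⟨n, Ideal.Quotient.eq_zero_iff_mem.mp ?_⟩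
    rw [map_mul, map_pow]
    exact hn

lemma isLocQuot_quotient (I : Ideal B) : IsLocQuot I 1 (Ideal.Quotient.mkₐ k I) where
  le_ker _ hb := Ideal.Quotient.eq_zero_iff_mem.mpr hb
  isUnit := by
    rw [map_one]
    exact isUnit_one
  surj d := by
    obtain ⟨b, rfl⟩ := Ideal.Quotient.mk_surjective d
    exact ⟨0, b, by rw [pow_zero, mul_one]; rfl⟩
  exists_mem b hb := ⟨0, by
    rw [pow_zero, one_mul]
    exact Ideal.Quotient.eq_zero_iff_mem.mp hb⟩

namespace IsLocQuot

variable {I : Ideal B} {f : B} {φ : B →ₐ[k] D}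

/-- The localization of a quotient is unique. -/
def algEquiv {D' : Type u} [CommRing D'] [Algebra k D'] {φ' : B →ₐ[k] D'} (h : IsLocQuot I f φ)
    (h' : IsLocQuot I f φ') : D ≃ₐ[k] D' := by
  letI := (Ideal.Quotient.liftₐ I φ h.le_ker).toAlgebra
  letI := (Ideal.Quotient.liftₐ I φ' h'.le_ker).toAlgebra
  haveI : IsScalarTower k (B ⧸ I) D := .of_algebraMap_eq'
    (Ideal.Quotient.liftₐ I φ h.le_ker).comp_algebraMap.symm
  haveI : IsScalarTower k (B ⧸ I) D' := .of_algebraMap_eq'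
    (Ideal.Quotient.liftₐ I φ' h'.le_ker).comp_algebraMap.symm
  have key {D : Type u} [CommRing D] [Algebra k D] {φ : B →ₐ[k] D} (h : IsLocQuot I f φ)
      [Algebra (B ⧸ I) D]
      (halg : ∀ b, algebraMap (B ⧸ I) D (Ideal.Quotient.mk I b) = φ b) :
      IsLocalization (Submonoid.powers (Ideal.Quotient.mk I f)) D := by
    refine ⟨?_, ?_, ?_⟩
    · rintro ⟨_, n, rfl⟩
      dsimp only
      rw [map_pow, halg]
      exact h.isUnit.pow n
    · intro d
      obtain ⟨n, b, hb⟩ := h.surj d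
      refine ⟨⟨Ideal.Quotient.mk I b, ⟨_, n, rfl⟩⟩, ?_⟩
      dsimp only
      rw [map_pow, halg, halg, hb]
    · intro b c hbc
      obtain ⟨b, rfl⟩ := Ideal.Quotient.mk_surjective b
      obtain ⟨c, rfl⟩ := Ideal.Quotient.mk_surjective c
      rw [halg, halg, ← sub_eq_zero, ← map_sub] at hbc
      obtain ⟨n, hn⟩ := h.exists_mem _ hbc
      refine ⟨⟨_, n, rfl⟩, ?_⟩
      dsimp only
      rw [← map_pow, ← map_mul, ← map_mul, Ideal.Quotient.eq, ← mul_sub]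
      exact hn
  haveI := key h fun b ↦ rfl
  haveI := key h' fun b ↦ rfl
  exact (IsLocalization.algEquiv (Submonoid.powers (Ideal.Quotient.mk I f)) D D').restrictScalars k

/-- A closed subscheme of a locally closed subscheme. -/
lemma quotient (h : IsLocQuot I f φ) (g : B) :
    IsLocQuot (I ⊔ Ideal.span {g}) f ((Ideal.Quotient.mkₐ k (Ideal.span {φ g})).comp φ) where
  le_ker := by
    have : I ⊔ Ideal.span {g} ≤
        RingHom.ker ((Ideal.Quotient.mkₐ k (Ideal.span {φ g})).comp φ) := by
      rw [sup_le_iff, Ideal.span_singleton_le_iff_mem]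
      refine ⟨fun b hb ↦ ?_, ?_⟩
      · rw [RingHom.mem_ker, AlgHom.comp_apply, h.le_ker b hb, map_zero]
      · exact Ideal.Quotient.eq_zero_iff_mem.mpr (Ideal.mem_span_singleton_self _)
    exact fun b hb ↦ this hb
  isUnit := h.isUnit.map (Ideal.Quotient.mkₐ k (Ideal.span {φ g}))
  surj d := by
    obtain ⟨d, rfl⟩ := Ideal.Quotient.mk_surjective d
    obtain ⟨n, b, hb⟩ := h.surj d
    refine ⟨n, b, ?_⟩
    rw [AlgHom.comp_apply, AlgHom.comp_apply, ← hb, map_mul, map_pow]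
    rfl
  exists_mem b hb := by
    obtain ⟨d, hd⟩ := Ideal.mem_span_singleton.mp (Ideal.Quotient.eq_zero_iff_mem.mp hb)
    change φ b = φ g * d at hd
    obtain ⟨n, c, hc⟩ := h.surj d
    have h1 : φ (f ^ n * b - g * c) = 0 := by
      rw [map_sub, map_mul, map_mul, map_pow, ← hc, hd]
      ring
    obtain ⟨m, hm⟩ := h.exists_mem _ h1
    refine ⟨m + n, ?_⟩
    have h2 : f ^ (m + n) * b = f ^ m * (f ^ n * b - g * c) + f ^ m * c * g := by ring
    rw [h2]
    exact add_mem (Ideal.mem_sup_left hm)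
      (Ideal.mem_sup_right (Ideal.mul_mem_left _ _ (Ideal.mem_span_singleton_self _)))

/-- A principal open subscheme of a locally closed subscheme. -/
lemma away (h : IsLocQuot I f φ) (g : B) :
    IsLocQuot I (f * g) ((IsScalarTower.toAlgHom k D (Localization.Away (φ g))).comp φ) where
  le_ker b hb := by rw [AlgHom.comp_apply, h.le_ker b hb, map_zero]
  isUnit := by
    rw [map_mul]
    exact (h.isUnit.map (algebraMap D (Localization.Away (φ g)))).mul
      (IsLocalization.Away.algebraMap_isUnit (S := Localization.Away (φ g)) (φ g))
  surj d := by
    obtain ⟨n, d', hd⟩ := IsLocalization.Away.surj (φ g) d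
    obtain ⟨m, b, hb⟩ := h.surj d'
    refine ⟨m + n, b * f ^ n * g ^ m, ?_⟩
    have h1 : algebraMap D (Localization.Away (φ g)) (φ b) =
        d * algebraMap D _ (φ g) ^ n * algebraMap D _ (φ f) ^ m := by
      rw [hd, ← hb, map_mul, map_pow]
    change d * algebraMap D (Localization.Away (φ g)) (φ (f * g)) ^ (m + n) =
      algebraMap D (Localization.Away (φ g)) (φ (b * f ^ n * g ^ m))
    simp only [map_mul, map_pow, h1]
    ring
  exists_mem b hb := by
    obtain ⟨⟨_, n, rfl⟩, hn⟩ := (IsLocalization.map_eq_zero_iff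
      (Submonoid.powers (φ g)) (Localization.Away (φ g)) (φ b)).mp hb
    have h1 : φ (g ^ n * b) = 0 := by
      rw [map_mul, map_pow]
      exact hn
    obtain ⟨m, hm⟩ := h.exists_mem _ h1
    refine ⟨m + n, ?_⟩
    have h2 : (f * g) ^ (m + n) * b = f ^ n * g ^ m * (f ^ m * (g ^ n * b)) := by ring
    rw [h2]
    exact Ideal.mul_mem_left _ _ hm

end IsLocQuot

variable [Algebra.FiniteType k B] [Algebra.FiniteType k D]

variable (k) in
/-- The class of the locally closed subscheme `V(I) ∩ D(f)` of `Spec B`. -/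
def locClass (I : Ideal B) (f : B) : K0VarModL k :=
  algClass k (Localization.Away (Ideal.Quotient.mk I f))

lemma IsLocQuot.algClass_eq {I : Ideal B} {f : B} {φ : B →ₐ[k] D} (h : IsLocQuot I f φ) :
    algClass k D = locClass k I f :=
  algClass_congr (h.algEquiv (isLocQuot_locMap I f))

lemma locClass_one (I : Ideal B) : locClass k I 1 = algClass k (B ⧸ I) :=
  (isLocQuot_quotient I).algClass_eq.symm

/-- The scissor relation along `g = 0`. -/
lemma locClass_cut (I : Ideal B) (f g : B) :
    locClass k I f = locClass k I (f * g) + locClass k (I ⊔ Ideal.span {g}) f := by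
  have h := isLocQuot_locMap (k := k) I f
  rw [← (h.away g).algClass_eq, ← (h.quotient g).algClass_eq]
  refine algClass_eq_add (locMap k I f g) (Ideal.Quotient.mkₐ k _) Ideal.Quotient.mk_surjective ?_
  exact Ideal.mk_ker

lemma locClass_eq_zero {I : Ideal B} {f : B} (hf : f ∈ I) : locClass k I f = 0 := by
  have h := isLocQuot_locMap (k := k) I f
  have h1 := h.isUnit
  rw [h.le_ker f hf] at h1
  have := subsingleton_of_zero_eq_one (isUnit_zero_iff.mp h1)
  exact algClass_of_subsingleton

/-- Elements that vanish after `f` has been inverted may be added to the ideal. -/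
lemma locClass_eq_sup {I : Ideal B} {f g : B} (hfg : f * g ∈ I) :
    locClass k I f = locClass k (I ⊔ Ideal.span {g}) f := by
  rw [locClass_cut I f g, locClass_eq_zero hfg, zero_add]

end LocallyClosedClass

/-! ### The class of a chain of blow-ups -/

noncomputable section BlowupClass

open Polynomial

variable {k : Type u} [Field k] {R : Type u} [CommRing R] [Algebra k R] [Algebra.FiniteType k R]

lemma algClass_quotient_map_C (I : Ideal R) : algClass k (R[X] ⧸ I.map (C : R →+* R[X])) = 0 := by
  let e : (R ⧸ I)[X] ≃ₐ[k] R[X] ⧸ I.map (C : R →+* R[X]) :=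
    AlgEquiv.ofRingEquiv (f := I.polynomialQuotientEquivQuotientPolynomial) fun r ↦ by
      have h1 : algebraMap k (R ⧸ I)[X] r =
          (C (algebraMap k R r)).map (Ideal.Quotient.mk I) := by
        rw [map_C]
        rfl
      rw [h1, Ideal.polynomialQuotientEquivQuotientPolynomial_map_mk]
      rfl
  rw [← algClass_congr e]
  exact algClass_polynomial

lemma isLocQuot_zero_section (I : Ideal R) (c : R) :
    IsLocQuot (I.map C ⊔ Ideal.span {X}) (C c)
      ((locMap k I c).comp ((aeval (0 : R) : R[X] →ₐ[R] R).restrictScalars k)) := by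
  have h := isLocQuot_locMap (k := k) I c
  have hC (r : R) : (locMap k I c).comp ((aeval (0 : R) : R[X] →ₐ[R] R).restrictScalars k) (C r) =
      locMap k I c r := by
    simp
  have hX : (locMap k I c).comp ((aeval (0 : R) : R[X] →ₐ[R] R).restrictScalars k) X = 0 := by
    simp
  set φ := (locMap k I c).comp ((aeval (0 : R) : R[X] →ₐ[R] R).restrictScalars k)
  refine ⟨?_, ?_, ?_, ?_⟩
  · have : I.map C ⊔ Ideal.span {X} ≤ RingHom.ker φ := by
      rw [sup_le_iff, Ideal.map_le_iff_le_comap, Ideal.span_singleton_le_iff_mem]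
      refine ⟨fun b hb ↦ ?_, hX⟩
      rw [Ideal.mem_comap, RingHom.mem_ker, hC, h.le_ker b hb]
    exact fun b hb ↦ this hb
  · rw [hC]
    exact h.isUnit
  · intro d
    obtain ⟨n, b, hb⟩ := h.surj d
    exact ⟨n, C b, by rw [hC, hC, hb]⟩
  · intro p hp
    rw [← divX_mul_X_add p, map_add, map_mul, hX, mul_zero, zero_add, hC] at hp
    obtain ⟨n, hn⟩ := h.exists_mem _ hp
    refine ⟨n, ?_⟩
    rw [← divX_mul_X_add p, mul_add, ← mul_assoc]
    refine add_mem (Ideal.mem_sup_right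
      (Ideal.mul_mem_left _ _ (Ideal.mem_span_singleton_self _))) (Ideal.mem_sup_left ?_)
    rw [← C_pow, ← C_mul]
    exact Ideal.mem_map_of_mem _ hn

/-- The closed subscheme `c v = 0` of an affine line over a base. -/
lemma locClass_mul_X (I : Ideal R) (c : R) :
    locClass k (I.map C ⊔ Ideal.span {C c * X}) 1 = locClass k I c := by
  have h1 : I.map C ⊔ Ideal.span {C c * X} ⊔ Ideal.span {C c} =
      (I ⊔ Ideal.span {c}).map (C : R →+* R[X]) := by
    rw [Ideal.map_sup, Ideal.map_span, Set.image_singleton, sup_assoc]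
    congr 1
    rw [sup_eq_right, Ideal.span_singleton_le_iff_mem]
    exact Ideal.mul_mem_right _ _ (Ideal.mem_span_singleton_self _)
  have h2 : I.map C ⊔ Ideal.span {C c * X} ⊔ Ideal.span {X} =
      I.map (C : R →+* R[X]) ⊔ Ideal.span {X} := by
    rw [sup_assoc]
    congr 1
    rw [sup_eq_right, Ideal.span_singleton_le_iff_mem]
    exact Ideal.mul_mem_left _ _ (Ideal.mem_span_singleton_self _)
  -- Where `c = 0` the whole line is left, which has class zero; where `c ≠ 0` only the zero section
  -- is left.
  rw [locClass_cut _ _ (C c), h1, locClass_one, algClass_quotient_map_C, add_zero, one_mul,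
    locClass_eq_sup (g := X) (Ideal.mem_sup_right (Ideal.mem_span_singleton_self _)), h2,
    ← (isLocQuot_zero_section I c).algClass_eq]
  rfl

variable (y F l : R)

/-- Modulo `y - F v` each factor `F` turns one `v` into `y`, so a power of `F` removes `v` from a
polynomial. -/
lemma exists_mul_sub_mem (p : R[X]) : ∃ (n : ℕ) (r : R),
    C F ^ n * p - C r ∈ Ideal.span {C y - C F * X} := by
  induction p using Polynomial.induction_on with
  | C a => exact ⟨0, a, by simp⟩
  | add p q hp hq =>
    obtain ⟨n, r, hr⟩ := hp
    obtain ⟨m, s, hs⟩ := hq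
    refine ⟨n + m, F ^ m * r + F ^ n * s, ?_⟩
    have : C F ^ (n + m) * (p + q) - C (F ^ m * r + F ^ n * s) =
        C F ^ m * (C F ^ n * p - C r) + C F ^ n * (C F ^ m * q - C s) := by
      simp only [C_add, C_mul, C_pow]
      ring
    rw [this]
    exact add_mem (Ideal.mul_mem_left _ _ hr) (Ideal.mul_mem_left _ _ hs)
  | monomial m a hp =>
    obtain ⟨n, r, hr⟩ := hp
    refine ⟨n + 1, y * r, ?_⟩
    have : C F ^ (n + 1) * (C a * X ^ (m + 1)) - C (y * r) =
        C F * X * (C F ^ n * (C a * X ^ m) - C r) - C r * (C y - C F * X) := by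
      rw [C_mul]
      ring
    rw [this]
    exact sub_mem (Ideal.mul_mem_left _ _ hr)
      (Ideal.mul_mem_left _ _ (Ideal.mem_span_singleton_self _))

/-- The graph of `v = y / F`. -/
lemma locClass_graph : locClass k (Ideal.span {C y - C F * X, C l * X}) (C F) =
    locClass k (Ideal.span {y * l}) F := by
  have h := isLocQuot_locMap (k := k) (Ideal.span {y * l}) F
  set ψ := locMap k (Ideal.span {y * l}) F
  obtain ⟨v, hv⟩ := h.isUnit
  let s := ψ y * ↑v⁻¹
  have hs : s * ψ F = ψ y := by
    rw [← hv, mul_assoc, Units.inv_mul, mul_one]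
  -- The section `v = y / F`; on it the equation `l v = 0` becomes `y l = 0`, as `F` is a unit.
  let φ : R[X] →ₐ[k] Localization.Away (Ideal.Quotient.mk (Ideal.span {y * l}) F) :=
    aevalTower ψ s
  have hC (r : R) : φ (C r) = ψ r := aevalTower_C ψ s r
  have hX : φ X = s := aevalTower_X ψ s
  have hle : Ideal.span {C y - C F * X, C l * X} ≤ RingHom.ker φ := by
    rw [Ideal.span_le]
    rintro _ (rfl | rfl)
    · rw [SetLike.mem_coe, RingHom.mem_ker, map_sub, map_mul, hC, hC, hX, mul_comm (ψ F), hs, sub_self]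
    · rw [SetLike.mem_coe, RingHom.mem_ker, map_mul, hC, hX]
      refine h.isUnit.mul_left_injective ?_
      dsimp only
      rw [zero_mul, mul_assoc, hs, ← map_mul, mul_comm l y]
      exact h.le_ker _ (Ideal.mem_span_singleton_self _)
  have hφ : IsLocQuot (Ideal.span {C y - C F * X, C l * X}) (C F) φ := by
    refine ⟨fun b hb ↦ hle hb, ?_, fun d ↦ ?_, fun p hp ↦ ?_⟩
    · rw [hC]
      exact h.isUnit
    · obtain ⟨n, b, hb⟩ := h.surj d
      exact ⟨n, C b, by rw [hC, hC, hb]⟩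
    · obtain ⟨n, r, hr⟩ := exists_mul_sub_mem y F p
      replace hr := Ideal.span_mono (Set.singleton_subset_iff.mpr
        (Set.mem_insert (C y - C F * X) {C l * X})) hr
      have h1 := hle hr
      rw [RingHom.mem_ker, map_sub, map_mul, hp, mul_zero, zero_sub, neg_eq_zero, hC] at h1
      obtain ⟨m, hm⟩ := h.exists_mem r h1
      obtain ⟨q, hq⟩ := Ideal.mem_span_singleton.mp hm
      refine ⟨m + n, ?_⟩
      have h2 : C F ^ (m + n) * p = C F ^ m * (C F ^ n * p - C r) +
          (C l * C q * (C y - C F * X) + C F * C q * (C l * X)) := by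
        have h3 : C F ^ m * C r = C y * C l * C q := by
          rw [← C_pow, ← C_mul, ← C_mul, ← C_mul, hq]
        linear_combination h3
      rw [h2]
      exact add_mem (Ideal.mul_mem_left _ _ hr) (add_mem
        (Ideal.mul_mem_left _ _ (Ideal.subset_span (by simp)))
        (Ideal.mul_mem_left _ _ (Ideal.subset_span (by simp))))
  rw [← hφ.algClass_eq]
  rfl

/-- Stratify the locus where `F` and the product of the `y i` vanish by the first `y j` that
vanishes. -/
lemma sum_locClass_pair (y : ℕ → R) (m : ℕ) :
    ∑ j ∈ Finset.range m, locClass k (Ideal.span {y j, F}) (∏ i ∈ Finset.range j, y i) =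
      locClass k (Ideal.span {∏ i ∈ Finset.range m, y i, F}) 1 := by
  induction m with
  | zero =>
    rw [Finset.range_zero, Finset.sum_empty, Finset.prod_empty]
    exact (locClass_eq_zero (Ideal.subset_span (by simp))).symm
  | succ m ih =>
    set p := ∏ i ∈ Finset.range m, y i
    rw [Finset.sum_range_succ, ih, Finset.prod_range_succ, locClass_cut (Ideal.span {_ * _, F}) 1 p,
      one_mul, add_comm]
    congr 1
    · rw [locClass_eq_sup (I := Ideal.span {p * y m, F}) (f := p) (g := y m)
        (Ideal.subset_span (by simp))]
      congr 1
      have h := Ideal.span_singleton_le_span_singleton.mpr (dvd_mul_left (y m) p)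
      rw [Ideal.span_insert (p * y m), sup_right_comm, Ideal.span_insert (y m), sup_eq_right.mpr h]
    · congr 1
      have h := Ideal.span_singleton_le_span_singleton.mpr (dvd_mul_right p (y m))
      rw [Ideal.span_insert (p * y m), sup_right_comm, Ideal.span_insert p, sup_eq_right.mpr h]

/-- The sum of the classes of the strata of the zero fibre, over an affine chart. -/
theorem sum_algClass_strata (y : ℕ → R) (e : ℕ) :
    ∑ j ∈ Finset.range e,
        algClass k (R[X] ⧸ Ideal.span {C (y j), C F, C (∏ i ∈ Finset.range j, y i) * X}) +
      algClass k (R[X] ⧸ Ideal.span {C (y e) - C F * X, C (∏ i ∈ Finset.range e, y i) * X}) =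
      algClass k (R ⧸ Ideal.span {∏ i ∈ Finset.range (e + 1), y i}) := by
  have h1 (j : ℕ) (c : R) : Ideal.span {C (y j), C F, C c * X} =
      (Ideal.span {y j, F}).map (C : R →+* R[X]) ⊔ Ideal.span {C c * X} := by
    rw [Ideal.map_span, Set.image_pair, ← Ideal.span_union, Set.insert_union, Set.singleton_union]
  have h2 (c : R) : Ideal.span {C (y e) - C F * X, C c * X} ⊔ Ideal.span {C F} =
      (Ideal.span {y e, F}).map (C : R →+* R[X]) ⊔ Ideal.span {C c * X} := by
    rw [← h1]
    apply le_antisymm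
    · rw [sup_le_iff, Ideal.span_le, Ideal.span_singleton_le_iff_mem]
      refine ⟨?_, Ideal.subset_span (by simp)⟩
      rintro _ (rfl | rfl)
      · exact sub_mem (Ideal.subset_span (by simp))
          (Ideal.mul_mem_right _ _ (Ideal.subset_span (by simp)))
      · exact Ideal.subset_span (by simp)
    · rw [Ideal.span_le]
      have hF : C F ∈ Ideal.span {C (y e) - C F * X, C c * X} ⊔ Ideal.span {C F} :=
        Ideal.mem_sup_right (Ideal.mem_span_singleton_self _)
      rintro _ (rfl | rfl | rfl)
      · have h3 : C (y e) - C F * X + X * C F ∈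
            Ideal.span {C (y e) - C F * X, C c * X} ⊔ Ideal.span {C F} :=
          add_mem (Ideal.mem_sup_left (Ideal.subset_span (by simp))) (Ideal.mul_mem_left _ _ hF)
        have h4 : C (y e) - C F * X + X * C F = C (y e) := by ring
        rw [h4] at h3
        exact h3
      · exact hF
      · exact Ideal.mem_sup_left (Ideal.subset_span (by simp))
  simp only [← locClass_one]
  -- Cut the last piece along `F`. The part with `F ≠ 0` is the graph of `y e / F` and gives the
  -- part of `y 0 ⋯ y e = 0` with `F ≠ 0`. The part with `F = 0` has the shape of the other pieces,
  -- and with it the sum runs over `j ≤ e` and gives the part with `F = 0`.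
  rw [locClass_cut (Ideal.span {C (y e) - C F * X, C (∏ i ∈ Finset.range e, y i) * X}) 1 (C F),
    one_mul, locClass_graph, h2, locClass_mul_X]
  simp only [h1, locClass_mul_X]
  rw [add_left_comm, ← Finset.sum_range_succ, sum_locClass_pair F y (e + 1),
    Finset.prod_range_succ, mul_comm (y e), locClass_cut (Ideal.span {_}) 1 F, one_mul,
    Ideal.span_insert]

end BlowupClass

/-! ### The pieces of the zero fibre -/

noncomputable section SliceClass

open MvPolynomial

variable (k : Type u) [Field k] {N : ℕ}

/-- The ideal of the affine space `x_b = 0` for `b < a`, `x_a = 1`. -/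
def sliceIdeal (a : Fin N) : Ideal (MvPolynomial (Fin N) k) :=
  Ideal.span (X '' Set.Iio a ∪ {X a - 1})

/-- The coordinate ring of the affine space `x_b = 0` for `b < a`, `x_a = 1`. -/
def SliceRing (a : Fin N) : Type u := MvPolynomial (Fin N) k ⧸ sliceIdeal k a

instance (a : Fin N) : CommRing (SliceRing k a) :=
  inferInstanceAs (CommRing (MvPolynomial (Fin N) k ⧸ sliceIdeal k a))

instance (a : Fin N) : Algebra k (SliceRing k a) :=
  inferInstanceAs (Algebra k (MvPolynomial (Fin N) k ⧸ sliceIdeal k a))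

/-- The restriction of polynomials to the affine space `x_b = 0` for `b < a`, `x_a = 1`. -/
def sliceMk (a : Fin N) : MvPolynomial (Fin N) k →ₐ[k] SliceRing k a :=
  Ideal.Quotient.mkₐ k (sliceIdeal k a)

variable {k} in
lemma sliceMk_surjective (a : Fin N) : Function.Surjective (sliceMk k a) :=
  Ideal.Quotient.mk_surjective

instance (a : Fin N) : Algebra.FiniteType k (SliceRing k a) :=
  .of_surjective (sliceMk k a) (sliceMk_surjective a)

/-- The coordinates on an affine space of the standard stratification of projective space. -/
def sliceCoord (a i : Fin N) : SliceRing k a := sliceMk k a (X i)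

variable {k}

lemma sliceMk_eq_zero {a : Fin N} {p : MvPolynomial (Fin N) k} (hp : p ∈ sliceIdeal k a) :
    sliceMk k a p = 0 :=
  Ideal.Quotient.eq_zero_iff_mem.mpr hp

lemma sliceCoord_of_lt {a b : Fin N} (hb : b < a) : sliceCoord k a b = 0 :=
  sliceMk_eq_zero (Ideal.subset_span (.inl ⟨b, hb, rfl⟩))

lemma sliceCoord_self (a : Fin N) : sliceCoord k a a = 1 := by
  rw [sliceCoord, ← sub_eq_zero, ← map_one (sliceMk k a), ← map_sub]
  exact sliceMk_eq_zero (Ideal.subset_span (.inr rfl))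

/-- The last variable is not in the equations and splits off an affine line. -/
lemma algClass_quotient_rename_castSucc {M : ℕ} (I : Ideal (MvPolynomial (Fin M) k)) :
    algClass k (MvPolynomial (Fin (M + 1)) k ⧸ I.map (rename Fin.castSucc)) = 0 := by
  rw [← algClass_quotient_map_C (k := k) I]
  let E : MvPolynomial (Fin (M + 1)) k ≃ₐ[k] Polynomial (MvPolynomial (Fin M) k) :=
    (renameEquiv k finSuccEquivLast).trans (optionEquivLeft k (Fin M))
  refine algClass_congr (Ideal.quotientEquivAlg _ _ E ?_)
  have h : (Polynomial.C : MvPolynomial (Fin M) k →+* _) =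
      (E : MvPolynomial (Fin (M + 1)) k →+* Polynomial (MvPolynomial (Fin M) k)).comp
        (rename Fin.castSucc : MvPolynomial (Fin M) k →ₐ[k] _).toRingHom := by
    refine MvPolynomial.ringHom_ext (fun r ↦ ?_) fun i ↦ ?_ <;> simp [E]
  rw [h, ← Ideal.map_map]
  rfl

/-- The coordinate `x_M` occurs neither in the equations of the slice, as `a < M`, nor in the
product, as `m ≤ M`. -/
lemma algClass_slice_of_ne_last {M m : ℕ} (hm : m ≤ M) {a : Fin (M + 1)} (ha : a ≠ Fin.last M) :
    algClass k (SliceRing k a ⧸ Ideal.span {fullProd m (sliceCoord k a)}) = 0 := by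
  obtain ⟨a, rfl⟩ := Fin.exists_castSucc_eq.mpr ha
  have h1 : Ideal.span {fullProd m (sliceCoord k a.castSucc)} =
      (Ideal.span {fullProd m (X : Fin (M + 1) → MvPolynomial (Fin (M + 1)) k)}).map
        (sliceMk k a.castSucc) := by
    rw [Ideal.map_span, Set.image_singleton]
    congr 2
    exact (map_fullProd (sliceMk k a.castSucc).toRingHom m X).symm
  have h2 : sliceIdeal k a.castSucc ⊔ Ideal.span {fullProd m X} =
      (sliceIdeal k a ⊔ Ideal.span {fullProd m X}).map (rename Fin.castSucc) := by
    rw [Ideal.map_sup, sliceIdeal, sliceIdeal, Ideal.map_span, Ideal.map_span, Set.image_union,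
      Set.image_image, Set.image_singleton, Set.image_singleton, map_sub, map_one, rename_X]
    congr 3
    · ext p
      simp only [rename_X, Set.mem_image, Set.mem_Iio]
      constructor
      · rintro ⟨b, hb, rfl⟩
        have hb' : b ≠ Fin.last M := (hb.trans_le (Fin.le_last _)).ne
        obtain ⟨b, rfl⟩ := Fin.exists_castSucc_eq.mpr hb'
        exact ⟨b, Fin.castSucc_lt_castSucc_iff.mp hb, rfl⟩
      · rintro ⟨b, hb, rfl⟩
        exact ⟨_, Fin.castSucc_lt_castSucc_iff.mpr hb, rfl⟩
    · have h3 := map_fullProd (rename Fin.castSucc : MvPolynomial (Fin M) k →ₐ[k]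
        MvPolynomial (Fin (M + 1)) k).toRingHom m X
      change rename Fin.castSucc _ = _ at h3
      rw [h3, fullProd, fullProd, Finset.prod_filter, Finset.prod_filter, Fin.prod_univ_castSucc,
        if_neg (by simpa using hm), mul_one]
      simp
  rw [← algClass_quotient_rename_castSucc (sliceIdeal k a ⊔ Ideal.span {fullProd m X}), ← h2, h1]
  exact algClass_congr (DoubleQuot.quotQuotEquivQuotSupₐ k _ _)

/-- The slice is the point whose only nonzero coordinate is the last one; there `x₀ = 0`, so the
product imposes no condition. -/
lemma algClass_slice_last {M m : ℕ} (hM : M ≠ 0) (hm : m ≠ 0) :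
    algClass k (SliceRing k (Fin.last M) ⧸
      Ideal.span {fullProd m (sliceCoord k (Fin.last M))}) = 1 := by
  have h0 : fullProd m (sliceCoord k (Fin.last M)) = 0 :=
    Finset.prod_eq_zero (i := (0 : Fin (M + 1))) (by simpa using Nat.pos_of_ne_zero hm)
      (sliceCoord_of_lt (Fin.lt_def.mpr (Nat.pos_of_ne_zero hM)))
  let θ : MvPolynomial (Fin (M + 1)) k →ₐ[k] k := aeval fun i ↦ if i = Fin.last M then 1 else 0
  have hle : sliceIdeal k (Fin.last M) ≤ RingHom.ker θ := by
    rw [sliceIdeal, Ideal.span_le]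
    rintro _ (⟨b, hb, rfl⟩ | rfl)
    · simp [θ, (Set.mem_Iio.mp hb).ne]
    · simp [θ]
  have hinj : Function.Injective (algebraMap k (SliceRing k (Fin.last M))) := by
    have : Nontrivial (SliceRing k (Fin.last M)) := by
      refine Ideal.Quotient.nontrivial_iff.mpr fun htop ↦ ?_
      have h1 : (1 : MvPolynomial (Fin (M + 1)) k) ∈ RingHom.ker θ :=
        hle (htop ▸ Submodule.mem_top)
      rw [RingHom.mem_ker, map_one] at h1
      exact one_ne_zero h1
    exact (algebraMap k _).injective
  have hsurj : Function.Surjective (algebraMap k (SliceRing k (Fin.last M))) := by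
    intro z
    obtain ⟨p, rfl⟩ := sliceMk_surjective (Fin.last M) z
    change sliceMk k _ p ∈ (algebraMap k (SliceRing k (Fin.last M))).range
    induction p using MvPolynomial.induction_on with
    | C r => exact ⟨r, ((sliceMk k (Fin.last M)).commutes r).symm⟩
    | add p q hp hq => rw [map_add]; exact add_mem hp hq
    | mul_X p i hp =>
      rw [map_mul]
      refine mul_mem hp ?_
      change sliceCoord k _ i ∈ _
      rcases (Fin.le_last i).lt_or_eq with hi | hi
      · rw [sliceCoord_of_lt hi]
        exact zero_mem _
      · rw [hi, sliceCoord_self]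
        exact one_mem _
  have hbot : Ideal.span {fullProd m (sliceCoord k (Fin.last M))} = ⊥ := by
    rw [h0, Ideal.span_singleton_eq_bot]
  rw [hbot, ← algClass_self, ← algClass_congr (AlgEquiv.quotientBot k (SliceRing k (Fin.last M))).symm]
  exact (algClass_congr (AlgEquiv.ofBijective (Algebra.ofId k _) ⟨hinj, hsurj⟩)).symm

lemma fullProd_eq_prod_range {R : Type*} [CommRing R] (y : Fin N → R) (z : ℕ → R)
    (hz : ∀ i : Fin N, z i.1 = y i) {m : ℕ} (hm : m ≤ N) :
    fullProd m y = ∏ i ∈ Finset.range m, z i := by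
  induction m with
  | zero => simp [fullProd]
  | succ m ih =>
    rw [Finset.prod_range_succ, ← ih (by omega), hz ⟨m, hm⟩]
    exact fullProd_succ ⟨m, hm⟩ y

end SliceClass

/-! ### The strata of the zero fibre as closed subschemes of affine lines -/

noncomputable section ZeroFibrePieces

open MvPolynomial

variable {k A K : Type u} [Field k] [CommRing A] [Field K] [Algebra k A] [Algebra k K]
  [Algebra A K] [IsScalarTower k A K] {N e : ℕ}

namespace IsGeneralPoint

variable {x : Fin N → K} {T W : A}

/-- The coordinate ring of the intersection of a chart with the zero fibre. -/
abbrev ZeroChart (_h : IsGeneralPoint k e x T W) (a j : Fin N) : Type u :=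
  ratioAlgebra A (monom e x (algebraMap A K T)) (vertex e a j.1) ⧸
    Ideal.span {algebraMap A (ratioAlgebra A (monom e x (algebraMap A K T)) (vertex e a j.1)) T}

instance (h : IsGeneralPoint k e x T W) (a j : Fin N) : CommRing (h.ZeroChart a j) :=
  Ideal.Quotient.commRing _

/-- The coordinates on the intersection of a chart with the zero fibre. -/
def zeroChartHom (h : IsGeneralPoint k e x T W) (a j : Fin N) (hj : j.1 < e + 1) :
    MvPolynomial (ChartVar N) k →ₐ[k] h.ZeroChart a j :=
  (Ideal.Quotient.mkₐ k _).comp (h.chartHom a j hj)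

lemma zeroChartHom_surjective (h : IsGeneralPoint k e x T W) (a j : Fin N) (hj : j.1 < e + 1) :
    Function.Surjective (h.zeroChartHom a j hj) :=
  Ideal.Quotient.mk_surjective.comp (h.chartHom_surjective a j hj)

/-- The coordinates that vanish on the complement of the earlier charts. -/
def pieceVars (e : ℕ) (a j : Fin N) : Set (ChartVar N) :=
  .inl '' Set.Iio a ∪ {s | s = .inr 0 ∧ j.1 < e}

/-- The ideal of the complement of the earlier charts. -/
def pieceIdeal (h : IsGeneralPoint k e x T W) (a j : Fin N) (hj : j.1 < e + 1) :
    Ideal (h.ZeroChart a j) :=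
  (Ideal.span (X '' pieceVars e a j)).map (h.zeroChartHom a j hj)

/-- The coordinate ring of the complement of the earlier charts. -/
abbrev Piece (h : IsGeneralPoint k e x T W) (a j : Fin N) (hj : j.1 < e + 1) : Type u :=
  h.ZeroChart a j ⧸ h.pieceIdeal a j hj

instance (h : IsGeneralPoint k e x T W) (a j : Fin N) (hj : j.1 < e + 1) :
    CommRing (h.Piece a j hj) :=
  Ideal.Quotient.commRing _

/-- The coordinates on the complement of the earlier charts. -/
def pieceHom (h : IsGeneralPoint k e x T W) (a j : Fin N) (hj : j.1 < e + 1) :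
    MvPolynomial (ChartVar N) k →ₐ[k] h.Piece a j hj :=
  (Ideal.Quotient.mkₐ k _).comp (h.zeroChartHom a j hj)

lemma pieceHom_surjective (h : IsGeneralPoint k e x T W) (a j : Fin N) (hj : j.1 < e + 1) :
    Function.Surjective (h.pieceHom a j hj) :=
  Ideal.Quotient.mk_surjective.comp (h.zeroChartHom_surjective a j hj)

instance (h : IsGeneralPoint k e x T W) (a j : Fin N) (hj : j.1 < e + 1) :
    Algebra.FiniteType k (h.Piece a j hj) :=
  .of_surjective (h.pieceHom a j hj) (h.pieceHom_surjective a j hj)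

variable (h : IsGeneralPoint k e x T W) (a j : Fin N) (hj : j.1 < e + 1)

lemma pieceHom_X {s : ChartVar N} (hs : s ∈ pieceVars e a j) : h.pieceHom a j hj (X s) = 0 :=
  Ideal.Quotient.eq_zero_iff_mem.mpr
    (Ideal.mem_map_of_mem _ (Ideal.subset_span (Set.mem_image_of_mem _ hs)))

lemma pieceHom_param :
    h.pieceHom a j hj (X (.inr 1) * lowProd j (fun i => X (.inl i))) = 0 := by
  have h1 : h.zeroChartHom a j hj (X (.inr 1) * lowProd j (fun i => X (.inl i))) = 0 := by
    refine Ideal.Quotient.eq_zero_iff_mem.mpr ?_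
    change h.chartHom a j hj _ ∈ _
    rw [← h.algebraMap_param]
    exact Ideal.mem_span_singleton_self _
  rw [pieceHom, AlgHom.comp_apply, h1, map_zero]

lemma pieceHom_chartRel (i : Fin 4) : h.pieceHom a j hj (chartRel k (e + 1) a j i) = 0 := by
  have h1 : h.chartHom a j hj (chartRel k (e + 1) a j i) = 0 :=
    Subtype.ext (h.chartEval_chartRel a j hj i)
  rw [pieceHom, AlgHom.comp_apply, zeroChartHom, AlgHom.comp_apply, h1, map_zero, map_zero]

/-- The relations between the coordinates on a piece of the zero fibre. -/
lemma eq_zero_of_pieceHom_eq_zero [CharZero k] {E : Type*} [CommRing E] [Algebra k E]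
    (α : MvPolynomial (ChartVar N) k →ₐ[k] E) (h1 : ∀ s ∈ pieceVars e a j, α (X s) = 0)
    (h2 : α (X (.inr 1) * lowProd j (fun i => X (.inl i))) = 0)
    (h3 : ∀ i, α (chartRel k (e + 1) a j i) = 0) (q : MvPolynomial (ChartVar N) k)
    (hq : h.pieceHom a j hj q = 0) : α q = 0 := by
  have hq' : h.zeroChartHom a j hj q ∈ h.pieceIdeal a j hj := Ideal.Quotient.eq_zero_iff_mem.mp hq
  obtain ⟨l, hl, hlq⟩ := (Ideal.mem_map_iff_of_surjective (h.zeroChartHom a j hj)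
    (h.zeroChartHom_surjective a j hj)).mp hq'
  have hle1 : Ideal.span (X '' pieceVars e a j) ≤ RingHom.ker α := by
    rw [Ideal.span_le]
    rintro _ ⟨s, hs, rfl⟩
    exact h1 s hs
  have hle3 : Ideal.span (Set.range (chartRel k (e + 1) a j)) ≤ RingHom.ker α := by
    rw [Ideal.span_le]
    rintro _ ⟨i, rfl⟩
    exact h3 i
  -- Up to an element `l` of the piece ideal, `q` is a multiple of the parameter modulo the chart
  -- relations, and `α` kills all three contributions.
  have h4 : h.chartHom a j hj (q - l) ∈ Ideal.span {algebraMap A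
      (ratioAlgebra A (monom e x (algebraMap A K T)) (vertex e a j.1)) T} := by
    refine Ideal.Quotient.eq_zero_iff_mem.mp ?_
    change h.zeroChartHom a j hj (q - l) = 0
    rw [map_sub, hlq, sub_self]
  obtain ⟨c, hc⟩ := Ideal.mem_span_singleton.mp h4
  obtain ⟨r, rfl⟩ := h.chartHom_surjective a j hj c
  rw [h.algebraMap_param a j hj, ← map_mul, ← sub_eq_zero, ← map_sub, ← RingHom.mem_ker,
    h.ker_chartHom a j hj] at hc
  have h5 := hle3 hc
  rw [RingHom.mem_ker, map_sub, map_mul, h2, zero_mul, sub_zero, map_sub, sub_eq_zero] at h5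
  rw [h5]
  exact hle1 hl

/-- The ideal of a piece of the zero fibre in an affine line over an affine space, where `U` is the
value of the coordinate `u`. -/
def lineIdeal (e : ℕ) (a j : Fin N) (U : SliceRing k a) : Ideal (Polynomial (SliceRing k a)) :=
  Ideal.span {Polynomial.C (sliceCoord k a j) - Polynomial.C U * Polynomial.X, Polynomial.C (lowProd j (sliceCoord k a)) * Polynomial.X,
    Polynomial.C (U * midProd (e + 1) j (sliceCoord k a) - fermat (e + 1) (sliceCoord k a))}

/-- The coordinates on a piece of the zero fibre in terms of an affine line over an affine space. -/
def lineHom (e : ℕ) (a j : Fin N) (U : SliceRing k a) :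
    MvPolynomial (ChartVar N) k →ₐ[k] Polynomial (SliceRing k a) ⧸ lineIdeal e a j U :=
  (Ideal.Quotient.mkₐ k _).comp
    (aeval (Sum.elim (fun i => Polynomial.C (sliceCoord k a i)) ![Polynomial.C U, Polynomial.X, 1]))

section lineHom

variable (e) (U : SliceRing k a)

lemma lineHom_inl (i : Fin N) : lineHom e a j U (X (.inl i)) =
    Ideal.Quotient.mk _ (Polynomial.C (sliceCoord k a i)) := by
  simp [lineHom]

lemma lineHom_inr_zero : lineHom e a j U (X (.inr 0)) = Ideal.Quotient.mk _ (Polynomial.C U) := by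
  simp [lineHom]

lemma lineHom_inr_one : lineHom e a j U (X (.inr 1)) = Ideal.Quotient.mk _ Polynomial.X := by
  simp [lineHom]

lemma lineHom_inr_two : lineHom e a j U (X (.inr 2)) = 1 := by
  simp [lineHom]

lemma lineHom_rename (p : MvPolynomial (Fin N) k) : lineHom e a j U (rename .inl p) =
    Ideal.Quotient.mk _ (Polynomial.C (sliceMk k a p)) := by
  induction p using MvPolynomial.induction_on with
  | C r =>
    rw [rename_C]
    exact (lineHom e a j U).commutes r
  | add p q hp hq => simp only [map_add, hp, hq]
  | mul_X p i hp =>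
    rw [map_mul, map_mul, hp, rename_X, lineHom_inl, map_mul, map_mul, map_mul]
    rfl

lemma lineHom_surjective : Function.Surjective (lineHom e a j U) := by
  intro z
  obtain ⟨p, rfl⟩ := Ideal.Quotient.mk_surjective z
  change Ideal.Quotient.mk _ p ∈ (lineHom e a j U).range
  induction p using Polynomial.induction_on' with
  | add p q hp hq => rw [map_add]; exact add_mem hp hq
  | monomial n r =>
    rw [← Polynomial.C_mul_X_pow_eq_monomial, map_mul, map_pow, ← lineHom_inr_one]
    obtain ⟨p, rfl⟩ := sliceMk_surjective a r
    rw [← lineHom_rename]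
    exact mul_mem (AlgHom.mem_range_self _ _) (pow_mem (AlgHom.mem_range_self _ _) _)

end lineHom

/-- A piece of the zero fibre is a closed subscheme of an affine line over an affine space. -/
theorem algClass_piece [CharZero k] (p : MvPolynomial (Fin N) k)
    (hp : h.pieceHom a j hj (X (.inr 0)) = h.pieceHom a j hj (rename .inl p))
    (hp0 : j.1 < e → p = 0) :
    algClass k (h.Piece a j hj) = algClass k (Polynomial (SliceRing k a) ⧸
      lineIdeal e a j (sliceMk k a p)) := by
  set U : SliceRing k a := sliceMk k a p with hU
  set θ := h.pieceHom a j hj with hθ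
  have hrel := h.pieceHom_chartRel a j hj
  have hpar := h.pieceHom_param a j hj
  rw [← hθ] at hrel hpar
  have hlow : lowProd j (fun i => (X (.inl i) : MvPolynomial (ChartVar N) k)) =
      rename .inl (lowProd j X) := by
    simp [lowProd]
  have hmid : midProd (e + 1) j (fun i => (X (.inl i) : MvPolynomial (ChartVar N) k)) =
      rename .inl (midProd (e + 1) j X) := by
    simp [midProd]
  have hfer : fermat (e + 1) (fun i => (X (.inl i) : MvPolynomial (ChartVar N) k)) =
      rename .inl (fermat (e + 1) X) := by
    simp [fermat]
  have hlow' : lowProd j (sliceCoord k a) = sliceMk k a (lowProd j X) :=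
    (map_lowProd (sliceMk k a).toRingHom _ _).symm
  have hmid' : midProd (e + 1) j (sliceCoord k a) = sliceMk k a (midProd (e + 1) j X) :=
    (map_midProd (sliceMk k a).toRingHom _ _ _).symm
  have hfer' : fermat (e + 1) (sliceCoord k a) = sliceMk k a (fermat (e + 1) X) :=
    (map_fermat (sliceMk k a).toRingHom _ _).symm
  -- On the zero fibre the discriminant is `1`, so `w = 1`. As `u` is the polynomial `p` in the `x
  -- i`, only `v` remains as a coordinate on the line.
  have hdisc (R : Type u) [CommRing R] : discr (e + 1) (0 : R) = 1 := by simp [discr]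
  -- the inverse homomorphism
  let ψ : SliceRing k a →ₐ[k] h.Piece a j hj :=
    Ideal.Quotient.liftₐ (sliceIdeal k a) (θ.comp (rename .inl)) (by
      have : sliceIdeal k a ≤ RingHom.ker (θ.comp (rename .inl)) := by
        rw [sliceIdeal, Ideal.span_le]
        rintro _ (⟨b, hb, rfl⟩ | rfl)
        · rw [SetLike.mem_coe, RingHom.mem_ker, AlgHom.comp_apply, rename_X]
          exact h.pieceHom_X a j hj (.inl ⟨b, hb, rfl⟩)
        · rw [SetLike.mem_coe, RingHom.mem_ker, AlgHom.comp_apply, map_sub, rename_X, map_one]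
          exact hrel 0
      exact fun b hb ↦ this hb)
  have hψ (q) : ψ (sliceMk k a q) = θ (rename .inl q) := rfl
  let β' : Polynomial (SliceRing k a) →ₐ[k] h.Piece a j hj :=
    Polynomial.aevalTower ψ (θ (X (.inr 1)))
  have hβC (r) : β' (Polynomial.C r) = ψ r := Polynomial.aevalTower_C _ _ _
  have hβX : β' Polynomial.X = θ (X (.inr 1)) := Polynomial.aevalTower_X _ _
  have hle : lineIdeal e a j U ≤ RingHom.ker β' := by
    rw [lineIdeal, Ideal.span_le]
    rintro _ (rfl | rfl | rfl)
    · rw [SetLike.mem_coe, RingHom.mem_ker, map_sub, map_mul, hβC, hβC, hβX, hU, hψ, ← hp, sliceCoord,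
        hψ, rename_X, ← map_mul, ← map_sub]
      exact hrel 1
    · rw [SetLike.mem_coe, RingHom.mem_ker, map_mul, hβC, hβX, hlow', hψ, ← map_mul, mul_comm, ← hlow]
      exact hpar
    · rw [SetLike.mem_coe, RingHom.mem_ker, hβC, map_sub, map_mul, hmid', hfer', hU, hψ, hψ, hψ, ← hp,
        ← map_mul, ← map_sub, ← hmid, ← hfer]
      exact hrel 2
  let β : Polynomial (SliceRing k a) ⧸ lineIdeal e a j U →ₐ[k] h.Piece a j hj :=
    Ideal.Quotient.liftₐ _ β' fun b hb ↦ hle hb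
  have hβα : β.comp (lineHom e a j U) = θ := by
    refine MvPolynomial.algHom_ext fun s ↦ ?_
    rw [AlgHom.comp_apply]
    rcases s with i | i
    · rw [lineHom_inl]
      change β' (Polynomial.C (sliceMk k a (X i))) = _
      rw [hβC, hψ, rename_X]
    · match i with
      | 0 =>
        rw [lineHom_inr_zero]
        change β' (Polynomial.C U) = _
        rw [hβC, hU, hψ, hp]
      | 1 =>
        rw [lineHom_inr_one]
        exact hβX
      | 2 =>
        rw [lineHom_inr_two, map_one]
        have h1 := hrel 3
        have h2 := map_discr θ.toRingHom (e + 1) (X (.inr 1) * lowProd j (fun i => X (.inl i)))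
        simp only [AlgHom.toRingHom_eq_coe, RingHom.coe_coe] at h2
        rw [chartRel_three, map_sub, map_mul, h2, hpar, hdisc, mul_one, map_one, sub_eq_zero] at h1
        exact h1.symm
  have hmem {q} (hq : q ∈ lineIdeal e a j U) : Ideal.Quotient.mk (lineIdeal e a j U) q = 0 :=
    Ideal.Quotient.eq_zero_iff_mem.mpr hq
  have hαpar : lineHom e a j U (X (.inr 1) * lowProd j (fun i => X (.inl i))) = 0 := by
    rw [hlow, map_mul, lineHom_inr_one, lineHom_rename, ← map_mul, mul_comm, ← hlow']
    exact hmem (Ideal.subset_span (by simp))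
  have hker (q) (hq : θ q = 0) : lineHom e a j U q = 0 := by
    refine h.eq_zero_of_pieceHom_eq_zero a j hj (lineHom e a j U) ?_ hαpar ?_ q hq
    · rintro _ (⟨b, hb, rfl⟩ | ⟨rfl, hje⟩)
      · rw [lineHom_inl, sliceCoord_of_lt hb, map_zero, map_zero]
      · rw [lineHom_inr_zero, hU, hp0 hje, map_zero, map_zero, map_zero]
    · intro i
      match i with
      | 0 =>
        rw [chartRel_zero, map_sub, lineHom_inl, sliceCoord_self, map_one, map_one, map_one, sub_self]
      | 1 =>
        rw [chartRel_one, map_sub, map_mul, lineHom_inl, lineHom_inr_zero, lineHom_inr_one, ← map_mul,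
          ← map_sub]
        exact hmem (Ideal.subset_span (by simp))
      | 2 =>
        rw [chartRel_two, map_sub, map_mul, lineHom_inr_zero, hmid, hfer, lineHom_rename,
          lineHom_rename, ← map_mul, ← map_sub, ← Polynomial.C_mul, ← Polynomial.C_sub, ← hmid', ← hfer']
        exact hmem (Ideal.subset_span (by simp))
      | 3 =>
        have h2 := map_discr (lineHom e a j U).toRingHom (e + 1)
          (X (.inr 1) * lowProd j (fun i => X (.inl i)))
        simp only [AlgHom.toRingHom_eq_coe, RingHom.coe_coe] at h2
        rw [chartRel_three, map_sub, map_mul, h2, hαpar, hdisc, lineHom_inr_two, map_one, mul_one,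
          sub_self]
  refine (algClass_congr (AlgEquiv.ofBijective β ⟨?_, ?_⟩)).symm
  · rw [injective_iff_map_eq_zero]
    intro z hz
    obtain ⟨q, rfl⟩ := lineHom_surjective e a j U z
    refine hker q ?_
    rw [← hβα]
    exact hz
  · intro z
    obtain ⟨q, rfl⟩ := h.pieceHom_surjective a j hj z
    exact ⟨lineHom e a j U q, DFunLike.congr_fun hβα q⟩

end IsGeneralPoint

end ZeroFibrePieces

/-! ### Summation over the strata -/

noncomputable section ZeroFibreClass

open MvPolynomial

variable {k A K : Type u} [Field k] [CommRing A] [Field K] [Algebra k A] [Algebra k K]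
  [Algebra A K] [IsScalarTower k A K]

namespace IsGeneralPoint

section

variable {N e : ℕ} {x : Fin N → K} {T W : A}

/-- For `j = e` the product in the third relation is empty, and the relation reads `u = F`. -/
lemma pieceHom_inr_zero_of_eq (h : IsGeneralPoint k e x T W) (a j : Fin N) (hj : j.1 < e + 1)
    (hje : j.1 = e) :
    h.pieceHom a j hj (X (.inr 0)) = h.pieceHom a j hj (rename .inl (fermat (e + 1) X)) := by
  have h1 := h.pieceHom_chartRel a j hj 2
  have h2 : midProd (e + 1) j (fun i => (X (.inl i) : MvPolynomial (ChartVar N) k)) = 1 := by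
    refine Finset.prod_eq_one fun i hi => ?_
    simp only [Finset.mem_filter, Fin.lt_def] at hi
    omega
  rw [chartRel_two, h2, mul_one, map_sub, sub_eq_zero] at h1
  rw [h1]
  simp [fermat]

/-- With `u = 0` for `j < e` and `u = F` for `j = e`, the pieces are those of `sum_algClass_strata`
over the slice with index `a`. -/
theorem sum_algClass_piece [CharZero k] (h : IsGeneralPoint k e x T W) (a : Fin N) :
    ∑ j : Fin (e + 1), algClass k (h.Piece a (j.castLE h.lt) j.2) =
      algClass k (SliceRing k a ⧸ Ideal.span {fullProd (e + 1) (sliceCoord k a)}) := by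
  let y (i : ℕ) : SliceRing k a := if hi : i < N then sliceCoord k a ⟨i, hi⟩ else 0
  have hy (i : Fin N) : y i.1 = sliceCoord k a i := dif_pos i.2
  have hlow (j : Fin N) : lowProd j (sliceCoord k a) = ∏ i ∈ Finset.range j.1, y i := by
    rw [lowProd_eq_fullProd, fullProd_eq_prod_range _ y hy j.2.le]
  have hF : sliceMk k a (fermat (e + 1) X) = fermat (e + 1) (sliceCoord k a) :=
    map_fermat (sliceMk k a).toRingHom _ _
  rw [fullProd_eq_prod_range _ y hy h.lt,
    ← sum_algClass_strata (fermat (e + 1) (sliceCoord k a)) y e, Fin.sum_univ_castSucc,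
    Finset.sum_range]
  congr 1
  · refine Finset.sum_congr rfl fun j _ ↦ ?_
    have h0 : ((j.castSucc).castLE h.lt : Fin N) ∈ {l : Fin N | l.1 < e} := j.2
    rw [h.algClass_piece a _ _ 0 (by
      rw [h.pieceHom_X _ _ _ (.inr ⟨rfl, h0⟩), map_zero, map_zero]) fun _ ↦ rfl]
    refine algClass_congr (Ideal.quotientEquivAlgOfEq k ?_)
    rw [lineIdeal, map_zero, map_zero, zero_mul, zero_mul, sub_zero, zero_sub, map_neg, hlow, ← hy]
    change Ideal.span {Polynomial.C (y j.1), Polynomial.C (∏ i ∈ Finset.range j.1, y i) *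
      Polynomial.X, _} = _
    rw [Set.pair_comm, Ideal.span_insert, Ideal.span_insert, Ideal.span_singleton_neg,
      ← Ideal.span_insert, ← Ideal.span_insert]
  · have hmid : midProd (e + 1) ((Fin.last e).castLE h.lt) (sliceCoord k a) = 1 := by
      refine Finset.prod_eq_one fun i hi => ?_
      simp only [Finset.mem_filter, Fin.lt_def, Fin.val_castLE, Fin.val_last] at hi
      omega
    rw [h.algClass_piece a _ _ (fermat (e + 1) X) (h.pieceHom_inr_zero_of_eq a _ _ rfl)
      fun h1 ↦ absurd h1 (lt_irrefl e)]
    refine algClass_congr (Ideal.quotientEquivAlgOfEq k ?_)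
    rw [lineIdeal, hF, hmid, mul_one, sub_self, map_zero, hlow, ← hy]
    change Ideal.span {Polynomial.C (y e) - _, Polynomial.C (∏ i ∈ Finset.range e, y i) *
      Polynomial.X, _} = _
    rw [Ideal.span_insert, Ideal.span_insert, Ideal.span_singleton_eq_bot.mpr rfl, sup_bot_eq,
      ← Ideal.span_insert]

end

section

variable {M e : ℕ} {x : Fin (M + 1) → K} {T W : A} {Y : Scheme.{u}} {π : Y ⟶ Spec (.of A)}
  {g : Spec (.of K) ⟶ Y}
  {f : ∀ i, Spec (.of (ratioAlgebra A (monom e x (algebraMap A K T)) i)) ⟶ Y}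

/-- Only the slice with the last index contributes; for the others a coordinate outside the product
is free. -/
theorem sum_sum_algClass_piece [CharZero k] (h : IsGeneralPoint k e x T W) (heM : e < M) :
    ∑ a, ∑ j : Fin (e + 1), algClass k (h.Piece a (j.castLE h.lt) j.2) = 1 := by
  simp only [h.sum_algClass_piece]
  rw [Finset.sum_eq_single (Fin.last M), algClass_slice_last (by omega) (Nat.succ_ne_zero e)]
  · intro a _ ha
    exact algClass_slice_of_ne_last heM ha
  · simp

/-- The class of the zero fibre. -/
theorem mk_classOf_zero_fibre [CharZero k] (h : IsGeneralPoint k e x T W) (heM : e < M)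
    (hM : IsRatioModel (monom e x (algebraMap A K T)) π g f)
    (t : Spec (.of k) ⟶ Spec (.of A)) (ε : A →ₐ[k] k)
    (ht : t = Spec.map (CommRingCat.ofHom ε.toRingHom)) (hε : RingHom.ker ε = Ideal.span {T})
    [LocallyOfFiniteType (pullback.snd π t)] [QuasiCompact (pullback.snd π t)] :
    Ideal.Quotient.mk (Ideal.span {K0Var.lefschetz k}) (K0Var.classOf (pullback.snd π t)) = 1 := by
  have := hM.isOpenImmersion
  -- The second index is reversed: larger `j` come first, so that removing the earlier charts
  -- imposes `u = 0` for `j < e` and nothing for `j = e`.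
  let ι : Type := Fin (M + 1) ×ₗ (Fin (e + 1))ᵒᵈ
  let va (i : ι) : Fin (M + 1) := (ofLex i).1
  let vj (i : ι) : Fin (e + 1) := OrderDual.ofDual (ofLex i).2
  let vj' (i : ι) : Fin (M + 1) := (vj i).castLE h.lt
  have hvj (i : ι) : (vj' i).1 < e + 1 := (vj i).2
  choose c hc hfst hsnd hrange using fun i : ι ↦
    exists_fibreChart ε hε π t ht (f (vertex e (va i) (vj' i).1)) (hM.comp_eq _)
  have hft (i : ι) : Algebra.FiniteType k (h.ZeroChart (va i) (vj' i)) :=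
    .of_surjective _ (h.zeroChartHom_surjective (va i) (vj' i) (hvj i))
  let mk (i : ι) : CommRingCat.of
      (ratioAlgebra A (monom e x (algebraMap A K T)) (vertex e (va i) (vj' i).1)) ⟶
        CommRingCat.of (h.ZeroChart (va i) (vj' i)) :=
    CommRingCat.ofHom (Ideal.Quotient.mk (Ideal.span {algebraMap A _ T}))
  have hfst' (i : ι) (p : Spec (.of (h.ZeroChart (va i) (vj' i)))) :
      pullback.fst π t (c i p) = f _ (Spec.map (mk i) p) := by
    rw [← Scheme.Hom.comp_apply, hfst, Scheme.Hom.comp_apply]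
  have key := classOf_eq_sum_algClass (pullback.snd π t) (ι := ι)
    (fun i ↦ h.ZeroChart (va i) (vj' i)) c hsnd ?_
    (fun i ↦ h.pieceIdeal (va i) (vj' i) (hvj i)) ?_
  · rw [key, ← h.sum_sum_algClass_piece heM, ← Fintype.sum_prod_type']
    exact Fintype.sum_equiv (ofLex.trans (Equiv.prodCongr (Equiv.refl _) OrderDual.ofDual)) _ _
      fun i ↦ rfl
  · intro z
    obtain ⟨a, j, hj, hz⟩ := h.exists_vertex hM (pullback.fst π t z)
    exact ⟨toLex (a, OrderDual.toDual ⟨j.1, hj⟩), hrange _ z hz⟩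
  · intro i p
    let q : Spec (.of (ratioAlgebra A (monom e x (algebraMap A K T)) (vertex e (va i) (vj' i).1))) :=
      Spec.map (mk i) p
    have hq : pullback.fst π t (c i p) = f _ q := hfst' i p
    have hmem (l : ι) : c i p ∉ Set.range (c l) ↔
        ratio A (monom e x (algebraMap A K T)) (vertex e (va i) (vj' i).1)
          (vertex e (va l) (vj' l).1) ∈ PrimeSpectrum.asIdeal q := by
      rw [← not_iff_not, not_not, ← hM.mem_range_iff _ _ q]
      refine ⟨?_, fun hl ↦ hrange l _ (hq ▸ hl)⟩
      rintro ⟨w, hw⟩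
      rw [← hq, ← hw, hfst']
      exact ⟨_, rfl⟩
    have hprime := PrimeSpectrum.isPrime q
    have hiff := h.forall_ratio_mem_iff (va i) (vj' i) (hvj i) (PrimeSpectrum.asIdeal q)
    have hlt (l : ι) : l < i ↔ va l < va i ∨ va l = va i ∧ vj' i < vj' l :=
      Prod.Lex.lt_iff
    have hL : (∀ l < i, c i p ∉ Set.range (c l)) ↔ ∀ b l : Fin (M + 1), l.1 < e + 1 →
        (b < va i ∨ b = va i ∧ vj' i < l) →
        ratio A (monom e x (algebraMap A K T)) (vertex e (va i) (vj' i).1)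
          (vertex e b l.1) ∈ PrimeSpectrum.asIdeal q := by
      constructor
      · intro H b l hl hbl
        exact (hmem (toLex (b, OrderDual.toDual ⟨l.1, hl⟩))).mp (H _ ((hlt _).mpr hbl))
      · intro H l hl
        exact (hmem l).mpr (H (va l) (vj' l) (hvj l) ((hlt l).mp hl))
    refine Iff.trans ?_ (hiff.symm.trans hL.symm)
    rw [pieceIdeal, Ideal.map_le_iff_le_comap, Ideal.span_le]
    constructor
    · intro H
      exact ⟨fun b hb ↦ H ⟨_, .inl ⟨b, hb, rfl⟩, rfl⟩, fun hj ↦ H ⟨_, .inr ⟨rfl, hj⟩, rfl⟩⟩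
    · rintro ⟨H1, H2⟩ _ ⟨_, (⟨b, hb, rfl⟩ | ⟨rfl, hj⟩), rfl⟩
      · exact H1 b hb
      · exact H2 hj

end

end IsGeneralPoint

end ZeroFibreClass

/-! ### Open subschemes of the affine line -/

noncomputable section PuncturedLine

open Polynomial

variable {k : Type u} [Field k]

lemma smoothOfRelativeDimension_affineLine :
    SmoothOfRelativeDimension 1 (Spec.map (CommRingCat.ofHom (algebraMap k k[X]))) := by
  rw [HasRingHomProperty.Spec_iff (P := @SmoothOfRelativeDimension 1)]
  let E : MvPolynomial PUnit k ≃ₐ[k] k[X] := MvPolynomial.uniqueAlgEquiv k PUnit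
  refine locally_isStandardSmooth_of_jacobian (τ := Empty) E.toAlgHom E.surjective nofun ?_ rfl
    fun κ _ ev c _ ↦ funext nofun
  rw [Set.range_eq_empty, Ideal.span_empty]
  exact (RingHom.injective_iff_ker_eq_bot _).mp E.injective

variable {g : k[X]} {A : Type u} [CommRing A] [Algebra k[X] A] [Algebra k A] [IsScalarTower k k[X] A]
  [IsLocalization.Away g A]

lemma isDomain_of_away (hg : g ≠ 0) : IsDomain A :=
  IsLocalization.isDomain_of_le_nonZeroDivisors A (M := Submonoid.powers g)
    (powers_le_nonZeroDivisors_of_noZeroDivisors hg)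

lemma isDedekindDomain_of_away [IsDomain A] (hg : g ≠ 0) : IsDedekindDomain A :=
  IsLocalization.isDedekindDomain k[X] (M := Submonoid.powers g)
    (powers_le_nonZeroDivisors_of_noZeroDivisors hg) A

lemma isSmoothConnectedCurve_of_away (hg : g ≠ 0) :
    IsSmoothConnectedCurve (Spec.map (CommRingCat.ofHom (algebraMap k A))) where
  smooth := by
    have : IsOpenImmersion (Spec.map (CommRingCat.ofHom (algebraMap k[X] A))) :=
      IsOpenImmersion.of_isLocalization g
    have := smoothOfRelativeDimension_affineLine (k := k)
    rw [IsScalarTower.algebraMap_eq k k[X] A, CommRingCat.ofHom_comp, Spec.map_comp]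
    exact smoothOfRelativeDimension_comp (n := 0) (m := 1) _ _
  separated := inferInstance
  quasiCompact := inferInstance
  connected := by
    have := isDomain_of_away (A := A) hg
    infer_instance

lemma exists_mul_pow_eq_aeval (z : A) : ∃ (n : ℕ) (p : k[X]),
    z * algebraMap k[X] A g ^ n = aeval (algebraMap k[X] A X) p := by
  obtain ⟨n, p, hp⟩ := IsLocalization.Away.surj g z
  refine ⟨n, p, ?_⟩
  rw [hp, aeval_algebraMap_apply, aeval_X_left_apply]

lemma adjoin_eq_top_of_away {W : A} (hW : W * algebraMap k[X] A g = 1) :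
    Algebra.adjoin k {algebraMap k[X] A X, W} = ⊤ := by
  refine Algebra.eq_top_iff.mpr fun z ↦ ?_
  obtain ⟨n, p, hp⟩ := exists_mul_pow_eq_aeval (g := g) z
  have h1 : z = aeval (algebraMap k[X] A X) p * W ^ n := by
    rw [← hp, mul_assoc, ← mul_pow, mul_comm _ W, hW, one_pow, mul_one]
  rw [h1]
  refine mul_mem ?_ (pow_mem (Algebra.subset_adjoin (by simp)) _)
  exact Algebra.adjoin_mono (by simp) (aeval_mem_adjoin_singleton k _)

lemma algHom_eq_of_away (g : k[X]) [IsLocalization.Away g A] {ε ε' : A →ₐ[k] k}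
    (h : ε (algebraMap k[X] A X) = ε' (algebraMap k[X] A X)) : ε = ε' := by
  refine IsLocalization.algHom_ext (A := k[X]) (Submonoid.powers g) ?_
  exact Polynomial.algHom_ext h

lemma ker_eq_span_of_away (g : k[X]) [IsLocalization.Away g A] (ε : A →ₐ[k] k) : RingHom.ker ε =
    Ideal.span {algebraMap k[X] A X - algebraMap k A (ε (algebraMap k[X] A X))} := by
  set T := algebraMap k[X] A X with hT
  have hu : IsUnit (algebraMap k[X] A g) := IsLocalization.Away.algebraMap_isUnit g
  apply le_antisymm
  · intro z hz
    obtain ⟨n, p, hp⟩ := exists_mul_pow_eq_aeval (g := g) z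
    -- Up to a unit, `z` is a polynomial in the parameter; it has the root `ε T`.
    rw [← Ideal.mul_unit_mem_iff_mem _ (hu.pow n), hp, Ideal.mem_span_singleton]
    have h1 : p.eval (ε T) = 0 := by
      have h2 := congrArg ε hp
      rw [map_mul, hz, zero_mul, ← aeval_algHom_apply] at h2
      exact h2.symm
    obtain ⟨q, hq⟩ := dvd_iff_isRoot.mpr h1
    refine ⟨aeval T q, ?_⟩
    rw [hq, map_mul, map_sub, aeval_X, aeval_C]
  · rw [Ideal.span_singleton_le_iff_mem, RingHom.mem_ker, map_sub, AlgHom.commutes]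
    exact sub_self _

/-- Rational points of an affine scheme. -/
lemma exists_algHom_eq_Spec_map (B : Type u) [CommRing B] [Algebra k B]
    (t : RationalPoint (Spec.map (CommRingCat.ofHom (algebraMap k B)))) :
    ∃ ε : B →ₐ[k] k, t.1 = Spec.map (CommRingCat.ofHom ε.toRingHom) := by
  obtain ⟨t, ht⟩ := t
  let φ := Spec.preimage t
  have hφ : Spec.map φ = t := Spec.map_preimage t
  have h1 : CommRingCat.ofHom (algebraMap k B) ≫ φ = 𝟙 _ := by
    rw [← Spec.map_inj, Spec.map_comp, hφ, ht, Spec.map_id]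
  refine ⟨{ φ.hom with commutes' := fun r ↦ ?_ }, hφ.symm⟩
  exact congrArg (fun f ↦ f.hom r) h1

end PuncturedLine

/-! ### The general point of the family -/

noncomputable section GeneralPoint

open MvPolynomial

variable {k : Type u} [Field k] {N : ℕ} {K : Type u} [Field K] [Algebra k K] {x : Fin N → K}

/-- Powers of `X a` clear the denominators `x a`, and setting `X a = 1` makes these powers invisible
again. -/
lemma exists_homogenization {a : Fin N} (ha : x a ≠ 0) (h : MvPolynomial (Fin N) k) :
    ∃ (D : ℕ) (H : MvPolynomial (Fin N) k),
      aeval x H = x a ^ D * aeval (fun i ↦ x i / x a) h ∧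
      aeval (Function.update X a (1 : MvPolynomial (Fin N) k)) H =
        aeval (Function.update X a (1 : MvPolynomial (Fin N) k)) h := by
  induction h using MvPolynomial.induction_on with
  | C r =>
    refine ⟨0, C r, ?_, rfl⟩
    rw [pow_zero, one_mul, ← algebraMap_eq, AlgHom.commutes, AlgHom.commutes]
  | add p q hp hq =>
    obtain ⟨D, P, hP, hP'⟩ := hp
    obtain ⟨D', Q, hQ, hQ'⟩ := hq
    refine ⟨D + D', X a ^ D' * P + X a ^ D * Q, ?_, ?_⟩
    · simp only [map_add, map_mul, map_pow, hP, hQ, aeval_X]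
      ring
    · simp only [map_add, map_mul, map_pow, hP', hQ', aeval_X, Function.update_self, one_pow,
        one_mul]
  | mul_X p i hp =>
    obtain ⟨D, P, hP, hP'⟩ := hp
    refine ⟨D + 1, P * X i, ?_, ?_⟩
    · rw [map_mul, map_mul, hP, aeval_X, aeval_X]
      field_simp
      ring
    · simp only [map_mul, hP']

lemma sub_aeval_update_mem (a : Fin N) (h : MvPolynomial (Fin N) k) :
    h - aeval (Function.update X a (1 : MvPolynomial (Fin N) k)) h ∈ Ideal.span {X a - 1} := by
  rw [← Ideal.Quotient.eq]
  have h1 : Ideal.Quotient.mkₐ k (Ideal.span {(X a - 1 : MvPolynomial (Fin N) k)}) =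
      (Ideal.Quotient.mkₐ k (Ideal.span {(X a - 1 : MvPolynomial (Fin N) k)})).comp
        (aeval (Function.update X a (1 : MvPolynomial (Fin N) k))) := by
    refine MvPolynomial.algHom_ext fun i ↦ ?_
    rw [AlgHom.comp_apply, aeval_X]
    by_cases hi : i = a
    · rw [hi, Function.update_self]
      exact Ideal.Quotient.eq.mpr (Ideal.mem_span_singleton_self _)
    · rw [Function.update_of_ne hi]
  exact DFunLike.congr_fun h1 h

/-- The polynomial `H` obtained by clearing denominators vanishes at `x`, so it is zero, and `h`
becomes zero when `X a` is set to `1`. -/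
lemma AlgebraicIndependent.mem_span_of_aeval_div_eq_zero (hx : AlgebraicIndependent k x)
    (a : Fin N) (h : MvPolynomial (Fin N) k) (h0 : aeval (fun i ↦ x i / x a) h = 0) :
    h ∈ Ideal.span {X a - 1} := by
  obtain ⟨D, H, hH, hH'⟩ := exists_homogenization (hx.ne_zero a) h
  rw [h0, mul_zero] at hH
  have h1 := sub_aeval_update_mem a h
  rwa [← hH', hx.eq_zero_of_aeval_eq_zero H hH, map_zero, sub_zero] at h1

lemma eval_single_fermat {d : ℕ} (hd : d ≠ 0) (a : Fin N) :
    eval (Pi.single a (1 : k)) (fermat d X) = 1 := by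
  rw [map_fermat, fermat, Finset.sum_eq_single a]
  · simp
  · intro b _ hb
    simp [hb, hd]
  · simp

lemma aeval_fermat (d : ℕ) : aeval x (fermat d X : MvPolynomial (Fin N) k) = fermat d x := by
  simp [fermat]

lemma aeval_fullProd (d : ℕ) : aeval x (fullProd d X : MvPolynomial (Fin N) k) = fullProd d x := by
  simp [fullProd]

lemma AlgebraicIndependent.fermat_ne_zero (hx : AlgebraicIndependent k x) {d : ℕ} (hd : d ≠ 0)
    (hdN : d < N) : fermat d x ≠ 0 := by
  rw [← aeval_fermat (k := k)]
  intro h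
  have h1 := eval_single_fermat (k := k) hd ⟨d, hdN⟩
  rw [hx.eq_zero_of_aeval_eq_zero _ h, map_zero] at h1
  exact zero_ne_one h1

/-- The parameter of the family at its general point is transcendental. -/
lemma AlgebraicIndependent.transcendental_param [IsAlgClosed k] (hx : AlgebraicIndependent k x)
    {d : ℕ} (hd : d ≠ 0) (hdN : d < N) : Transcendental k (fullProd d x / fermat d x) := by
  intro halg
  obtain ⟨c, hc⟩ := minpoly.mem_range_of_degree_eq_one k _
    (IsAlgClosed.degree_eq_one_of_irreducible k (minpoly.irreducible halg.isIntegral))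
  -- If the parameter were a constant `c`, then `c F = P` as polynomials. At the coordinate point of
  -- `x_d` one has `F = 1` and `P = 0`.
  have hc0 : c = 0 := by
    have h1 : aeval x (C c * fermat d X - fullProd d X) = 0 := by
      rw [map_sub, map_mul, aeval_C, aeval_fermat, aeval_fullProd, hc,
        div_mul_cancel₀ _ (hx.fermat_ne_zero hd hdN), sub_self]
    have h2 := congrArg (eval (Pi.single (⟨d, hdN⟩ : Fin N) (1 : k)))
      (hx.eq_zero_of_aeval_eq_zero _ h1)
    have h3 : eval (Pi.single (⟨d, hdN⟩ : Fin N) (1 : k)) (fullProd d X) = 0 := by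
      rw [map_fullProd]
      refine Finset.prod_eq_zero (i := ⟨0, by omega⟩) (by simpa using Nat.pos_of_ne_zero hd) ?_
      have : (⟨0, by omega⟩ : Fin N) ≠ ⟨d, hdN⟩ := by simpa using hd.symm
      simp [this]
    rwa [map_sub, map_mul, eval_single_fermat hd, h3, eval_C, mul_one, sub_zero, map_zero] at h2
  rw [hc0, map_zero, eq_comm, div_eq_zero_iff] at hc
  exact hc.elim (fullProd_ne_zero x hx.ne_zero d) (hx.fermat_ne_zero hd hdN)

end GeneralPoint

/-! ### The family -/

noncomputable section Family

variable {k A K : Type u} [Field k] [CommRing A] [Field K] [Algebra k A] [Algebra k K]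
  [Algebra A K] [IsScalarTower k A K] {N e : ℕ} {x : Fin N → K}

section

open Polynomial

variable [Algebra k[X] A] [IsScalarTower k k[X] A]

lemma discr_X_ne_zero (d : ℕ) (hd : d ≠ 0) : discr d (X : k[X]) ≠ 0 := by
  intro h
  have h1 := congrArg (eval 0) h
  simp [_root_.discr, hd] at h1

lemma AlgebraicIndependent.exists_isGeneralPoint (hx : AlgebraicIndependent k x) (heN : e + 1 < N)
    [IsLocalization.Away (discr (e + 1) (X : k[X])) A]
    (hT : algebraMap A K (algebraMap k[X] A X) = fullProd (e + 1) x / fermat (e + 1) x) :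
    ∃ W, IsGeneralPoint k e x (algebraMap k[X] A X) W := by
  have hu : IsUnit (algebraMap k[X] A (discr (e + 1) X)) :=
    IsLocalization.Away.algebraMap_isUnit _
  obtain ⟨v, hv⟩ := hu
  have hW : ↑v⁻¹ * algebraMap k[X] A (discr (e + 1) X) = 1 := by rw [← hv, Units.inv_mul]
  have hF := hx.fermat_ne_zero (Nat.succ_ne_zero e) heN
  refine ⟨↑v⁻¹, by omega, hx.ne_zero, hx.mem_span_of_aeval_div_eq_zero, ?_, ?_, ?_,
    adjoin_eq_top_of_away hW⟩
  · rw [hT]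
    exact div_ne_zero (fullProd_ne_zero x hx.ne_zero _) hF
  · rw [hT, div_mul_cancel₀ _ hF]
  · rw [← map_discr, hW]

lemma algebraMap_injective_of_transcendental (g : k[X]) [IsLocalization.Away g A]
    (hT : Transcendental k (algebraMap A K (algebraMap k[X] A X))) :
    Function.Injective (algebraMap A K) := by
  rw [injective_iff_map_eq_zero]
  intro z hz
  obtain ⟨n, p, hp⟩ := exists_mul_pow_eq_aeval (g := g) z
  have h1 := congrArg (algebraMap A K) hp
  rw [map_mul, hz, zero_mul, ← aeval_algebraMap_apply, eq_comm] at h1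
  have h2 : p = 0 := by
    by_contra hp0
    exact hT ⟨p, hp0, h1⟩
  rw [h2, map_zero] at hp
  have hu : IsUnit (algebraMap k[X] A g) := IsLocalization.Away.algebraMap_isUnit g
  exact (hu.pow n).mul_left_eq_zero.mp hp

end

namespace IsGeneralPoint

variable {T W : A} {Y : Scheme.{u}} {π : Y ⟶ Spec (.of A)} {g : Spec (.of K) ⟶ Y}
  {f : ∀ i, Spec (.of (ratioAlgebra A (monom e x (algebraMap A K T)) i)) ⟶ Y}

/-- The pairs `(a, j)` which are the numbers of charts. -/
abbrev VertexIndex (N e : ℕ) : Type := {p : Fin N × Fin N // p.2.1 < e + 1}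

theorem smooth_comp [CharZero k] (h : IsGeneralPoint k e x T W)
    (hM : IsRatioModel (monom e x (algebraMap A K T)) π g f) :
    Smooth (π ≫ Spec.map (CommRingCat.ofHom (algebraMap k A))) := by
  have := hM.isOpenImmersion
  have h1 : SmoothOfRelativeDimension (N - 1)
      (π ≫ Spec.map (CommRingCat.ofHom (algebraMap k A))) := by
    refine of_charts (P := @SmoothOfRelativeDimension (N - 1))
      (S := fun v : VertexIndex N e ↦
        ratioAlgebra A (monom e x (algebraMap A K T)) (vertex e v.1.1 v.1.2.1))
      (fun v ↦ f (vertex e v.1.1 v.1.2.1)) (fun p ↦ ?_) _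
      (fun v ↦ algebraMap k _) (fun v ↦ ?_)
      fun v ↦ h.locally_isStandardSmooth v.1.1 v.1.2 v.2
    · obtain ⟨a, j, hj, hp⟩ := h.exists_vertex hM p
      exact ⟨⟨(a, j), hj⟩, hp⟩
    · rw [← Category.assoc, hM.comp_eq, ← Spec.map_comp, ← CommRingCat.ofHom_comp,
        ← IsScalarTower.algebraMap_eq]
  exact SmoothOfRelativeDimension.smooth (n := N - 1) _

theorem isSNCDivisor_zero_fibre [CharZero k] (h : IsGeneralPoint k e x T W)
    (hM : IsRatioModel (monom e x (algebraMap A K T)) π g f)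
    (t : Spec (.of k) ⟶ Spec (.of A)) (ε : A →ₐ[k] k)
    (ht : t = Spec.map (CommRingCat.ofHom ε.toRingHom)) (hε : RingHom.ker ε = Ideal.span {T}) :
    IsSNCDivisor (pullback.fst π t) := by
  have := hM.isOpenImmersion
  have : IsClosedImmersion t := by
    rw [ht]
    exact IsClosedImmersion.spec_of_surjective _ fun r ↦ ⟨algebraMap k A r, ε.commutes r⟩
  choose c hc hfst hsnd hrange using fun v : VertexIndex N e ↦
    exists_fibreChart ε hε π t ht (f (vertex e v.1.1 v.1.2.1)) (hM.comp_eq _)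
  refine isSNCDivisor_of_charts _ _ _ _ c hfst (fun z ↦ ?_) fun v q _ R _ _ _ _ hq ↦
    h.isSNCIdeal v.1.1 v.1.2 v.2 q R hq
  obtain ⟨a, j, hj, hz⟩ := h.exists_vertex hM (pullback.fst π t z)
  exact ⟨⟨(a, j), hj⟩, hrange ⟨(a, j), hj⟩ z hz⟩

end IsGeneralPoint

/-- The rings of the charts are subrings of `K`, hence torsion-free over the Dedekind domain `A`,
hence flat. -/
lemma IsRatioModel.flat {ι : Type} {m : ι → K} {Y : Scheme.{u}} {π : Y ⟶ Spec (.of A)}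
    {g : Spec (.of K) ⟶ Y} {f : ∀ i, Spec (.of (ratioAlgebra A m i)) ⟶ Y}
    [IsDedekindDomain A] (hM : IsRatioModel m π g f) (hA : Function.Injective (algebraMap A K)) :
    Flat π := by
  have := hM.isOpenImmersion
  refine of_charts (P := @Flat) f hM.exists_mem π _ hM.comp_eq fun i ↦ ?_
  rw [RingHom.flat_algebraMap_iff]
  have : Module.IsTorsionFree A (ratioAlgebra A m i) := by
    rw [Module.isTorsionFree_iff_algebraMap_injective]
    intro y z hyz
    exact hA (congrArg Subtype.val hyz)
  infer_instance

end Family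

section MainTheorem

open Polynomial

variable (k : Type u) [Field k] [IsAlgClosed k]

/-- The coordinate ring of the base of the family, the general point of the family over it, and the
function field. -/
lemma exists_generalPoint (n e : ℕ) (hen : e ≤ n) :
    ∃ (A K : Type u) (_ : CommRing A) (_ : Field K) (_ : Algebra k A) (_ : Algebra k K)
      (_ : Algebra A K) (_ : IsScalarTower k A K) (_ : Algebra k[X] A) (_ : IsScalarTower k k[X] A)
      (_ : IsLocalization.Away (_root_.discr (e + 1) (X : k[X])) A) (x : Fin (n + 1 + 1) → K) (W : A),
      Function.Injective (algebraMap A K) ∧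
        IsGeneralPoint k e x (algebraMap k[X] A X) W := by
  -- All homogeneous coordinates are taken as independent. The field `K` is larger than the function
  -- field of the family, which does no harm: the parameter has degree zero and the monomials have
  -- equal degrees, so only elements of degree zero enter the charts.
  let S := MvPolynomial (Fin (n + 1 + 1)) k
  let K := FractionRing S
  let x (i : Fin (n + 1 + 1)) : K := algebraMap S K (MvPolynomial.X i)
  have hx : AlgebraicIndependent k x := by
    have h1 : MvPolynomial.aeval x = IsScalarTower.toAlgHom k S K := by
      refine MvPolynomial.algHom_ext fun i ↦ ?_
      rw [MvPolynomial.aeval_X]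
      rfl
    rw [AlgebraicIndependent, h1]
    exact IsFractionRing.injective S K
  have htr := hx.transcendental_param (Nat.succ_ne_zero e) (by omega)
  set t := fullProd (e + 1) x / fermat (e + 1) x
  let g : k[X] := _root_.discr (e + 1) X
  let A := Localization.Away g
  have hg : g ≠ 0 := discr_X_ne_zero _ (Nat.succ_ne_zero e)
  have hu : IsUnit (aeval t g) := by
    refine Ne.isUnit fun h0 ↦ htr ⟨g, hg, h0⟩
  let φ : A →ₐ[k] K := IsLocalization.Away.liftAlgHom g hu
  have hφ (p : k[X]) : φ (algebraMap k[X] A p) = aeval t p := IsLocalization.Away.lift_eq g hu p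
  let _ : Algebra A K := φ.toAlgebra
  have : IsScalarTower k A K := .of_algebraMap_eq' φ.comp_algebraMap.symm
  have hT : algebraMap A K (algebraMap k[X] A X) = t := (hφ X).trans (aeval_X t)
  obtain ⟨W, hW⟩ := hx.exists_isGeneralPoint (A := A) (e := e) (by omega) hT
  exact ⟨A, K, inferInstance, inferInstance, inferInstance, inferInstance, inferInstance,
    inferInstance, inferInstance, inferInstance, inferInstance, x, W,
    algebraMap_injective_of_transcendental g (hT ▸ htr), hW⟩

theorem exists_family [CharZero k] (n e : ℕ) (hen : e ≤ n) :
    ∃ (C X : Scheme.{u}) (s : C ⟶ Spec (.of k)) (o : RationalPoint s) (π : X ⟶ C)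
      (_ : IsProper π),
      IsSmoothConnectedCurve s ∧ Flat π ∧ Smooth (π ≫ s) ∧
      (∀ t : RationalPoint s, t ≠ o → IsSmoothHypersurface n (e + 1) (fibreHom π t)) ∧
      IsReduced (fibre π o) ∧ IsSNCDivisor (fibreι π o) ∧
      K0Var.classOf (fibreHom π o) - 1 ∈ Ideal.span {K0Var.lefschetz k} := by
  obtain ⟨A, K, _, _, _, _, _, _, _, _, _, x, W, hinj, h⟩ := exists_generalPoint k n e hen
  have hg : _root_.discr (e + 1) (X : k[X]) ≠ 0 := discr_X_ne_zero _ (Nat.succ_ne_zero e)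
  have := isDomain_of_away (k := k) (A := A) hg
  have := isDedekindDomain_of_away (k := k) (A := A) hg
  set T := algebraMap k[X] A X with hT
  obtain ⟨Y, π, γ, f, hπ, h1, h2, h3, h4, h5⟩ := exists_projectiveModel (A := A)
    (m := monom e x (algebraMap A K T)) (monom_ne_zero h.ne_zero h.param_ne_zero)
  have hM : IsRatioModel (monom e x (algebraMap A K T)) π γ f := ⟨h1, h2, h3, h4, h5⟩
  -- The discriminant is `1` at `0`, so the origin belongs to the base.
  have hu : IsUnit (aeval (0 : k) (_root_.discr (e + 1) (X : k[X]))) := by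
    simp [_root_.discr]
  let ε₀ : A →ₐ[k] k := IsLocalization.Away.liftAlgHom (_root_.discr (e + 1) (X : k[X])) hu
  have hε₀ : ε₀ T = 0 :=
    (IsLocalization.Away.lift_eq (_root_.discr (e + 1) (X : k[X])) hu X).trans (aeval_X 0)
  have hker₀ : RingHom.ker ε₀ = Ideal.span {T} := by
    rw [ker_eq_span_of_away (_root_.discr (e + 1) (X : k[X])) ε₀, ← hT, hε₀, map_zero, sub_zero]
  let o : RationalPoint (Spec.map (CommRingCat.ofHom (algebraMap k A))) :=
    ⟨Spec.map (CommRingCat.ofHom ε₀.toRingHom), by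
      rw [← Spec.map_comp, ← CommRingCat.ofHom_comp, ← Spec.map_id]
      congr 2
      exact RingHom.ext ε₀.commutes⟩
  have hsnc : IsSNCDivisor (fibreι π o) := h.isSNCDivisor_zero_fibre hM o.1 ε₀ rfl hker₀
  refine ⟨_, Y, _, o, π, hπ, isSmoothConnectedCurve_of_away hg, hM.flat hinj, h.smooth_comp hM,
    fun t ht ↦ ?_, hsnc.isReduced, hsnc, ?_⟩
  · obtain ⟨ε, hε⟩ := exists_algHom_eq_Spec_map A t
    refine h.isSmoothHypersurface_fibre hen hM t.1 ε hε
      (ker_eq_span_of_away (_root_.discr (e + 1) (X : k[X])) ε) fun h0 ↦ ht ?_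
    have : ε = ε₀ := algHom_eq_of_away (_root_.discr (e + 1) (X : k[X])) (h0.trans hε₀.symm)
    exact Subtype.ext (hε.trans (by rw [this]))
  · rw [← Ideal.Quotient.eq, map_one]
    exact h.mk_classOf_zero_fibre (by omega) hM o.1 ε₀ rfl hker₀

end MainTheorem

theorem lemma3p5 (k : Type u) [Field k] [IsAlgClosed k] [CharZero k] (n d : ℕ)
    (hn : 2 ≤ n) (hd : 1 ≤ d) (hdn : d ≤ n + 1) :
    ∃ (C X : Scheme.{u}) (s : C ⟶ Spec (.of k)) (o : RationalPoint s) (π : X ⟶ C)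
      (_ : IsProper π),
      IsSmoothConnectedCurve s ∧ Flat π ∧ Smooth (π ≫ s) ∧
      (∀ t : RationalPoint s, t ≠ o → IsSmoothHypersurface n d (fibreHom π t)) ∧
      IsReduced (fibre π o) ∧ IsSNCDivisor (fibreι π o) ∧
      K0Var.classOf (fibreHom π o) - 1 ∈ Ideal.span {K0Var.lefschetz k} := by
  obtain ⟨e, rfl⟩ : ∃ e, d = e + 1 := ⟨d - 1, by omega⟩
  exact exists_family k n e (by omega)
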